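/- Let $G$ be a compact connected simple Lie group with Lie algebra $\mathfrak g$ (a finite-dimensional real Lie algebra with negative definite Killing form $B$), let $\mathfrak h\subset\mathfrak g$ be the Lie algebra of a maximal torus, i.e. a maximal abelian subalgebra, let $R$ be the root system of $(\mathfrak g^{\mathbb C},\mathfrak h^{\mathbb C})$ with a base $\Pi=\{\alpha_1,\dots,\alpha_\ell\}$, and let $\tau$ be the conjugation of $\mathfrak g^{\mathbb C}$ with respect to $\mathfrak g$. A subset $\Pi_M\subset\Pi$ determines a generalized flag manifold $M=G/K$: put $\Pi_K=\Pi\setminus\Pi_M$, let $R_K$ be the set of roots that are integral combinations of $\Pi_K$, $\mathfrak t=\{X: \varphi(X)=0 \text{ for all }\varphi\in R_K\}$ (in the real span of the coroots), and $\kappa(\alpha)=\alpha|_{\mathfrak t}$. Then $\mathfrak k^{\mathbb C}=\mathfrak h^{\mathbb C}\oplus\bigoplus_{\alpha\in R_K}\mathfrak g_\alpha^{\mathbb C}$, and a positive $\mathfrak t$-root $\xi\in\kappa(R\setminus R_K)$ gives the isotropy summand $(\mathfrak m_\xi\oplus\mathfrak m_{-\xi})^\tau\subset\mathfrak g$, where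 $\mathfrak m_\xi=\bigoplus_{\alpha\in R\setminus R_K,\ \kappa(\alpha)=\xi}\mathfrak g_\alpha^{\mathbb C}$. The flag manifolds of Type II are the following. They have four isotropy summands $\mathfrak m_1,\dots,\mathfrak m_4$, which belong to the $\mathfrak t$-roots $\xi_1,\dots,\xi_4$ below. * Type IIa, $\Pi_M=\{\alpha,\beta\}$, where $\alpha,\beta$ have coefficients $1,2$ in the highest root, with $\xi_1=\kappa(\alpha)$, $\xi_2=\kappa(\beta)$, $\xi_3=\kappa(\alpha)+\kappa(\beta)$, $\xi_4=\kappa(\alpha)+2\kappa(\beta)$: $G=SO(2\ell+1)$ ($\ell\ge2$) and $G=SO(2\ell)_{(i)}$ ($\ell\ge4$), with $\alpha=\alpha_1$, $\beta=\alpha_2$ in the usual numbering; $G=E_6$ (resp. $E_7$), where $\alpha$ is the end node of a longest arm of the Dynkin diagram and $\beta$ is its neighbour. * Type IIb, $\Pi_M=\{\alpha_p,\alpha_\ell\}$, where $\alpha_p,\alpha_\ell$ have coefficients $2,1$ in the highest root, with $\xi_1=\kappa(\alpha_p)$, $\xi_2=\kappa(\alpha_\ell)$, $\xi_3=\kappa(\alpha_p)+\kappa(\alpha_\ell)$,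 $\xi_4=2\kappa(\alpha_p)+\kappa(\alpha_\ell)$: $G=Sp(\ell)$ with $\ell\ge2$, $1\le p\le\ell-1$, and $G=SO(2\ell)_{(ii)}$ with $\ell\ge4$, $2\le p\le\ell-2$. For $i,j,k\in\{1,2,3,4\}$ let $[ijk]=\sum_{s,t,u}B([X_s,Y_t],Z_u)^2$, where $(X_s)$, $(Y_t)$, $(Z_u)$ are bases of $\mathfrak m_i,\mathfrak m_j,\mathfrak m_k$ that are orthonormal for $-B$ (for $i=j$ the same basis is used, and so on). The following values hold for every choice of these bases. (1) If $M$ is of Type IIa, then $[ijk]=0$ unless $(i,j,k)$ is a permutation of $(1,2,3)$ or of $(2,3,4)$; for permutations of these the values $[123]$ and $[234]$ are nonzero and given by | $G$ | $[123]$ | $[234]$ | |---|---|---| | $SO(2\ell+1)$ | $\frac{2\ell-3}{2\ell-1}$ | $\frac{2\ell-3}{2\ell-1}$ | | $SO(2\ell)_{(i)}$ | $\frac{\ell-2}{\ell-1}$ | $\frac{\ell-2}{\ell-1}$ | | $E_6$ | $\frac56$ | $\frac52$ | | $E_7$ | $\frac89$ | $\frac{40}9$ | (2) If $M$ is of Type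 IIb, then $[ijk]=0$ unless $(i,j,k)$ is a permutation of $(1,2,3)$ or of $(1,3,4)$; for permutations of these the values $[123]$ and $[134]$ are nonzero and given by | $G$ | $[123]$ | $[134]$ | |---|---|---| | $Sp(\ell)$ | $\frac{p(\ell-p)(\ell-p+1)}{2(\ell+1)}$ | $\frac{p(p+1)(\ell-p)}{2(\ell+1)}$ | | $SO(2\ell)_{(ii)}$ | $\frac{p(\ell-p)(\ell-p-1)}{2(\ell-1)}$ | $\frac{p(p-1)(\ell-p)}{2(\ell-1)}$ | -/

import Mathlib

open scoped TensorProduct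

noncomputable section

namespace FlagManifold

/-! ### Compact semisimple Lie algebras and their maximal tori -/

/-- A finite-dimensional real Lie algebra is the Lie algebra of a compact connected semisimple Lie
group if and only if its Killing form is negative definite. -/
class IsCompactSemisimple (𝔤 : Type*) [LieRing 𝔤] [LieAlgebra ℝ 𝔤] : Prop where
  killing_neg : ∀ x : 𝔤, x ≠ 0 → killingForm ℝ 𝔤 x x < 0

/-- A maximal abelian subalgebra (the Lie algebra of a maximal torus). -/
class IsMaximalTorus {𝔤 : Type*} [LieRing 𝔤] [LieAlgebra ℝ 𝔤] (𝔥 : LieSubalgebra ℝ 𝔤) : Prop where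
  abelian : ∀ x ∈ 𝔥, ∀ y ∈ 𝔥, ⁅x, y⁆ = 0
  maximal : ∀ x : 𝔤, (∀ y ∈ 𝔥, ⁅x, y⁆ = 0) → x ∈ 𝔥

section Complexification

variable {𝔤 : Type*} [LieRing 𝔤] [LieAlgebra ℝ 𝔤]

theorem lie_mem_baseChange (𝔥 : LieSubalgebra ℝ 𝔤) {x y : ℂ ⊗[ℝ] 𝔤}
    (hx : x ∈ 𝔥.toSubmodule.baseChange ℂ) (hy : y ∈ 𝔥.toSubmodule.baseChange ℂ) :
    ⁅x, y⁆ ∈ 𝔥.toSubmodule.baseChange ℂ := by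
  rw [Submodule.baseChange_eq_span] at hx hy
  induction hx, hy using Submodule.span_induction₂ with
  | mem_mem u v hu hv =>
    obtain ⟨u, hu, rfl⟩ := hu
    obtain ⟨v, hv, rfl⟩ := hv
    exact Submodule.tmul_mem_baseChange_of_mem (1 * 1 : ℂ) (𝔥.lie_mem hu hv)
  | zero_left v _ => rw [zero_lie]; exact zero_mem _
  | zero_right u _ =>
    have h : ⁅u, (0 : ℂ ⊗[ℝ] 𝔤)⁆ = 0 := lie_zero u
    rw [h]; exact zero_mem _
  | add_left u v w _ _ _ hu hv => rw [add_lie]; exact add_mem hu hv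
  | add_right u v w _ _ _ hv hw =>
    have h : ⁅u, v + w⁆ = ⁅u, v⁆ + ⁅u, w⁆ := lie_add u v w
    rw [h]; exact add_mem hv hw
  | smul_left a u v _ _ h => rw [smul_lie]; exact Submodule.smul_mem _ _ h
  | smul_right a u v _ _ hv =>
    have h : ⁅u, a • v⁆ = a • ⁅u, v⁆ := lie_smul a u v
    rw [h]; exact Submodule.smul_mem _ _ hv

/-- The complexification `𝔥 ⊗ ℂ` of a subalgebra `𝔥` of `𝔤`, as a complex subalgebra of
`ℂ ⊗ 𝔤`. -/
def complexify (𝔥 : LieSubalgebra ℝ 𝔤) : LieSubalgebra ℂ (ℂ ⊗[ℝ] 𝔤) :=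
  { 𝔥.toSubmodule.baseChange ℂ with
    lie_mem' := fun hx hy => lie_mem_baseChange 𝔥 hx hy }

theorem tmul_mem_complexify {𝔥 : LieSubalgebra ℝ 𝔤} (a : ℂ) {x : 𝔤} (hx : x ∈ 𝔥) :
    a ⊗ₜ[ℝ] x ∈ complexify 𝔥 :=
  Submodule.tmul_mem_baseChange_of_mem (p := 𝔥.toSubmodule) a hx

theorem exists_eq_add_I (z : ℂ ⊗[ℝ] 𝔤) :
    ∃ x y : 𝔤, z = (1 : ℂ) ⊗ₜ[ℝ] x + Complex.I ⊗ₜ[ℝ] y := by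
  induction z using TensorProduct.induction_on with
  | zero => exact ⟨0, 0, by simp⟩
  | add u v hu hv =>
    obtain ⟨x, y, rfl⟩ := hu
    obtain ⟨x', y', rfl⟩ := hv
    exact ⟨x + x', y + y', by rw [TensorProduct.tmul_add, TensorProduct.tmul_add]; abel⟩
  | tmul a u =>
    refine ⟨a.re • u, a.im • u, ?_⟩
    rw [TensorProduct.tmul_smul, TensorProduct.tmul_smul, TensorProduct.smul_tmul',
      TensorProduct.smul_tmul', ← TensorProduct.add_tmul]
    congr 1
    apply Complex.ext <;> simp

/-- The projection `x + i y ↦ f 1 • x + f i • y` given by a real functional `f` on `ℂ`. -/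
def proj (f : ℂ →ₗ[ℝ] ℝ) : ℂ ⊗[ℝ] 𝔤 →ₗ[ℝ] 𝔤 :=
  (TensorProduct.lid ℝ 𝔤).toLinearMap ∘ₗ f.rTensor 𝔤

theorem proj_mem {𝔥 : LieSubalgebra ℝ 𝔤} (f : ℂ →ₗ[ℝ] ℝ) {z : ℂ ⊗[ℝ] 𝔤}
    (hz : z ∈ complexify 𝔥) : proj f z ∈ 𝔥 := by
  change z ∈ 𝔥.toSubmodule.baseChange ℂ at hz
  rw [Submodule.baseChange_eq_span] at hz
  have key : ∀ a : ℂ, proj f (a • z) ∈ 𝔥.toSubmodule := by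
    induction hz using Submodule.span_induction with
    | zero => simp
    | add u v _ _ hu hv => intro a; rw [smul_add, map_add]; exact add_mem (hu a) (hv a)
    | smul c u _ hu => intro a; rw [smul_smul]; exact hu _
    | mem u hu =>
      intro a
      obtain ⟨u, hu, rfl⟩ := hu
      simpa [proj, TensorProduct.smul_tmul'] using 𝔥.smul_mem _ hu
  simpa using key 1

theorem mem_complexify_iff {𝔥 : LieSubalgebra ℝ 𝔤} (x y : 𝔤) :
    (1 : ℂ) ⊗ₜ[ℝ] x + Complex.I ⊗ₜ[ℝ] y ∈ complexify 𝔥 ↔ x ∈ 𝔥 ∧ y ∈ 𝔥 := by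
  constructor
  · intro h
    have h1 := proj_mem Complex.reLm h
    have h2 := proj_mem Complex.imLm h
    simp [proj] at h1 h2
    exact ⟨h1, h2⟩
  · rintro ⟨hx, hy⟩
    exact add_mem (tmul_mem_complexify _ hx) (tmul_mem_complexify _ hy)

instance instIsKilling [FiniteDimensional ℝ 𝔤] [IsCompactSemisimple 𝔤] :
    LieAlgebra.IsKilling ℂ (ℂ ⊗[ℝ] 𝔤) := by
  constructor
  rw [eq_bot_iff]
  intro z hz
  rw [LieIdeal.mem_killingCompl] at hz
  obtain ⟨x, y, rfl⟩ := exists_eq_add_I z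
  have key : ∀ w : 𝔤, killingForm ℝ 𝔤 w x = 0 ∧ killingForm ℝ 𝔤 w y = 0 := by
    intro w
    have h := hz ((1 : ℂ) ⊗ₜ[ℝ] w) (by trivial)
    rw [killingForm, LieModule.traceForm_baseChange] at h
    simp [map_add, Complex.ext_iff] at h
    exact h
  have hx : x = 0 := by
    by_contra hx
    exact (IsCompactSemisimple.killing_neg x hx).ne (key x).1
  have hy : y = 0 := by
    by_contra hy
    exact (IsCompactSemisimple.killing_neg y hy).ne (key y).2
  simp [hx, hy]

instance instIsCartanSubalgebra [IsCompactSemisimple 𝔤] (𝔥 : LieSubalgebra ℝ 𝔤)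
    [IsMaximalTorus 𝔥] : (complexify 𝔥).IsCartanSubalgebra where
  nilpotent := by
    have : IsLieAbelian (complexify 𝔥) := by
      constructor
      rintro ⟨u, hu⟩ ⟨v, hv⟩
      obtain ⟨x, y, rfl⟩ := exists_eq_add_I u
      obtain ⟨x', y', rfl⟩ := exists_eq_add_I v
      rw [mem_complexify_iff] at hu hv
      have hc := IsMaximalTorus.abelian (𝔥 := 𝔥)
      apply Subtype.ext
      simp [add_lie, lie_add, hc _ hu.1 _ hv.1, hc _ hu.1 _ hv.2, hc _ hu.2 _ hv.1,
        hc _ hu.2 _ hv.2]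
    infer_instance
  self_normalizing := by
    refine le_antisymm ?_ (LieSubalgebra.le_normalizer _)
    intro z hz
    rw [LieSubalgebra.mem_normalizer_iff] at hz
    obtain ⟨x, y, rfl⟩ := exists_eq_add_I z
    have hc := IsMaximalTorus.abelian (𝔥 := 𝔥)
    have step : ∀ u : 𝔤, (∀ h ∈ 𝔥, ⁅u, h⁆ ∈ 𝔥) → u ∈ 𝔥 := by
      intro u hu
      refine IsMaximalTorus.maximal u fun h hh => ?_
      by_contra hne
      apply (IsCompactSemisimple.killing_neg _ hne).ne
      rw [killingForm, LieModule.traceForm_apply_lie_apply, hc h hh _ (hu h hh)]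
      simp
    rw [mem_complexify_iff]
    have hxy : ∀ h ∈ 𝔥, ⁅x, h⁆ ∈ 𝔥 ∧ ⁅y, h⁆ ∈ 𝔥 := by
      intro h hh
      have h1 := hz _ (tmul_mem_complexify 1 hh)
      rw [add_lie, LieAlgebra.ExtendScalars.bracket_tmul,
        LieAlgebra.ExtendScalars.bracket_tmul, mul_one, mul_one, mem_complexify_iff] at h1
      exact h1
    exact ⟨step x fun h hh => (hxy h hh).1, step y fun h hh => (hxy h hh).2⟩

end Complexification

/-! ### The isotropy summands of a flag manifold

Throughout, `𝔤` is compact semisimple, `𝔥` is a maximal torus, `R` is the root system of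
`ℂ ⊗ 𝔤` with respect to the Cartan subalgebra `ℂ ⊗ 𝔥`, `b` is a base `Π` of `R`, and the set
`black = Π_M` of simple roots describes the flag manifold `G/K` with `Π_K = Π \ Π_M`. -/

section Summands

variable {𝔤 : Type*} [LieRing 𝔤] [LieAlgebra ℝ 𝔤] [FiniteDimensional ℝ 𝔤] [IsCompactSemisimple 𝔤]

/-- The root system `R` of `(ℂ ⊗ 𝔤, ℂ ⊗ 𝔥)`. -/
abbrev roots (𝔥 : LieSubalgebra ℝ 𝔤) [IsMaximalTorus 𝔥] :
    RootPairing (complexify 𝔥).root ℂ (Module.Dual ℂ (complexify 𝔥)) (complexify 𝔥) :=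
  LieAlgebra.IsKilling.rootSystem (complexify 𝔥)

variable {𝔥 : LieSubalgebra ℝ 𝔤} [IsMaximalTorus 𝔥]

/-- `R_K`: the roots that are integral combinations of `Π_K = Π \ Π_M`. -/
def rootsK (b : (roots 𝔥).Base) (black : Set (complexify 𝔥).root) : Set (complexify 𝔥).root :=
  {α | (roots 𝔥).root α ∈ Submodule.span ℤ ((roots 𝔥).root '' ((b.support : Set _) \ black))}

/-- The centre `𝔱 ⊗ ℂ` of `ℂ ⊗ 𝔨`: the common kernel of the roots in `R_K`. -/
def centre (b : (roots 𝔥).Base) (black : Set (complexify 𝔥).root) :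
    Submodule ℂ (complexify 𝔥) :=
  ⨅ φ ∈ rootsK b black, LinearMap.ker ((roots 𝔥).root φ)

/-- The restriction `κ(α) = α|_𝔱`; two roots agree on `𝔱` if and only if they agree on its
complexification. The `𝔱`-roots are the values of `κ` on `R \ R_K`. -/
def kappa (b : (roots 𝔥).Base) (black : Set (complexify 𝔥).root) (α : (complexify 𝔥).root) :
    Module.Dual ℂ (centre b black) :=
  ((roots 𝔥).root α).domRestrict (centre b black)

/-- `𝔪_ξ`: the sum of the root spaces of the complementary roots `α ∈ R \ R_K` with
`κ(α) = ξ`. -/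
def complexSummand (b : (roots 𝔥).Base) (black : Set (complexify 𝔥).root)
    (ξ : Module.Dual ℂ (centre b black)) : Submodule ℂ (ℂ ⊗[ℝ] 𝔤) :=
  ⨆ α : (complexify 𝔥).root, ⨆ _ : α ∉ rootsK b black ∧ kappa b black α = ξ,
    (LieAlgebra.rootSpace (complexify 𝔥) α.1).toSubmodule

/-- The real isotropy summand `(𝔪_ξ ⊕ 𝔪_{-ξ})^τ`, where `τ` is the conjugation of `ℂ ⊗ 𝔤` with
respect to `𝔤`: the elements of `𝔤 = 1 ⊗ 𝔤` that lie in `𝔪_ξ ⊕ 𝔪_{-ξ}`. -/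
def realSummand (b : (roots 𝔥).Base) (black : Set (complexify 𝔥).root)
    (ξ : Module.Dual ℂ (centre b black)) : Submodule ℝ 𝔤 :=
  ((complexSummand b black ξ ⊔ complexSummand b black (-ξ)).restrictScalars ℝ).comap
    (TensorProduct.mk ℝ ℂ 𝔤 1)

/-- The summands `𝔪₁, 𝔪₂, 𝔪₃, 𝔪₄` for `Π_M = {α, β}`, `ht α = 1`, `ht β = 2`: they belong to the
positive `𝔱`-roots `κ(α), κ(β), κ(α) + κ(β), κ(α) + 2 κ(β)`. -/
def summandsIIa (b : (roots 𝔥).Base) (α β : (complexify 𝔥).root) : Fin 4 → Submodule ℝ 𝔤 :=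
  ![realSummand b {α, β} (kappa b {α, β} α),
    realSummand b {α, β} (kappa b {α, β} β),
    realSummand b {α, β} (kappa b {α, β} α + kappa b {α, β} β),
    realSummand b {α, β} (kappa b {α, β} α + (2 : ℂ) • kappa b {α, β} β)]

/-- The summands `𝔪₁, 𝔪₂, 𝔪₃, 𝔪₄` for `Π_M = {α, β}`, `ht α = 2`, `ht β = 1`: they belong to the
positive `𝔱`-roots `κ(α), κ(β), κ(α) + κ(β), 2 κ(α) + κ(β)`. -/
def summandsIIb (b : (roots 𝔥).Base) (α β : (complexify 𝔥).root) : Fin 4 → Submodule ℝ 𝔤 :=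
  ![realSummand b {α, β} (kappa b {α, β} α),
    realSummand b {α, β} (kappa b {α, β} β),
    realSummand b {α, β} (kappa b {α, β} α + kappa b {α, β} β),
    realSummand b {α, β} ((2 : ℂ) • kappa b {α, β} α + kappa b {α, β} β)]

/-- `e` numbers the simple roots as `α₁, …, α_ℓ` (counted from `0` here) so that the Cartan matrix
`2 (αᵢ, αⱼ) / (αⱼ, αⱼ)` is `A`. -/
def IsNumbering (b : (roots 𝔥).Base) {ℓ : ℕ} (A : Matrix (Fin ℓ) (Fin ℓ) ℤ)
    (e : Fin ℓ ≃ b.support) : Prop :=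
  ∀ i j, b.cartanMatrix (e i) (e j) = A i j

end Summands

/-! ### The numbers `[ijk]` -/

section Triples

variable {𝔤 : Type*} [LieRing 𝔤] [LieAlgebra ℝ 𝔤]

/-- `X` is an orthonormal basis of the subspace `V` with respect to the negative of the Killing
form of `𝔤`. -/
def IsOrthonormalBasis {V : Submodule ℝ 𝔤} {d : ℕ} (X : Module.Basis (Fin d) ℝ V) : Prop :=
  ∀ s t, -killingForm ℝ 𝔤 (X s : 𝔤) (X t : 𝔤) = if s = t then 1 else 0

/-- The sum of the squares of `B([X_s, Y_t], Z_u)` over all `s, t, u`. -/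
def triple {V W U : Submodule ℝ 𝔤} {p q r : ℕ} (X : Module.Basis (Fin p) ℝ V)
    (Y : Module.Basis (Fin q) ℝ W) (Z : Module.Basis (Fin r) ℝ U) : ℝ :=
  ∑ s, ∑ t, ∑ u, (killingForm ℝ 𝔤 ⁅(X s : 𝔤), (Y t : 𝔤)⁆ (Z u : 𝔤)) ^ 2

/-- For every choice of orthonormal bases of the four summands, the numbers `[ijk]`
(`i, j, k` counted from `0`) are equal to `c i j k`. -/
def HasTriples (m : Fin 4 → Submodule ℝ 𝔤) (c : Fin 4 → Fin 4 → Fin 4 → ℝ) : Prop :=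
  ∀ (d : Fin 4 → ℕ) (X : ∀ i, Module.Basis (Fin (d i)) ℝ (m i)), (∀ i, IsOrthonormalBasis (X i)) →
    ∀ i j k, triple (X i) (X j) (X k) = c i j k

/-- The numbers `[123] = x` and `[234] = y` are nonzero, and all `[ijk]` for which `(i, j, k)` is
not a permutation of `(1, 2, 3)` or of `(2, 3, 4)` vanish. -/
def HasNonzeroTriplesIIa (m : Fin 4 → Submodule ℝ 𝔤) (x y : ℝ) : Prop :=
  x ≠ 0 ∧ y ≠ 0 ∧ HasTriples m fun i j k =>
    if ({i, j, k} : Multiset (Fin 4)) = {0, 1, 2} then x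
    else if ({i, j, k} : Multiset (Fin 4)) = {1, 2, 3} then y else 0

/-- The numbers `[123] = x` and `[134] = y` are nonzero, and all `[ijk]` for which `(i, j, k)` is
not a permutation of `(1, 2, 3)` or of `(1, 3, 4)` vanish. -/
def HasNonzeroTriplesIIb (m : Fin 4 → Submodule ℝ 𝔤) (x y : ℝ) : Prop :=
  x ≠ 0 ∧ y ≠ 0 ∧ HasTriples m fun i j k =>
    if ({i, j, k} : Multiset (Fin 4)) = {0, 1, 2} then x
    else if ({i, j, k} : Multiset (Fin 4)) = {0, 2, 3} then y else 0

/-- Orthonormal bases exist, so that `HasTriples` is never satisfied for want of bases. -/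
theorem exists_isOrthonormalBasis [FiniteDimensional ℝ 𝔤] [IsCompactSemisimple 𝔤]
    (V : Submodule ℝ 𝔤) :
    ∃ X : Module.Basis (Fin (Module.finrank ℝ V)) ℝ V, IsOrthonormalBasis X := by
  let B : LinearMap.BilinForm ℝ V := (-(killingForm ℝ 𝔤)).restrict V
  have hB : ∀ x y : V, B x y = -killingForm ℝ 𝔤 (x : 𝔤) (y : 𝔤) := fun x y => rfl
  have hs : LinearMap.IsSymm B := ⟨fun x y => by
    simp only [hB, RingHom.id_apply]
    rw [killingForm, LieModule.traceForm_comm]⟩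
  obtain ⟨v, hv⟩ := LinearMap.BilinForm.exists_orthogonal_basis (B := B) hs
  have hpos : ∀ s, 0 < B (v s) (v s) := fun s => by
    rw [hB]
    have := IsCompactSemisimple.killing_neg (v s : 𝔤) (fun h => v.ne_zero s (Subtype.ext h))
    linarith
  have hu : ∀ s, IsUnit ((Real.sqrt (B (v s) (v s)))⁻¹) := fun s =>
    (inv_ne_zero (Real.sqrt_pos.2 (hpos s)).ne').isUnit
  refine ⟨v.isUnitSMul hu, fun s t => ?_⟩
  rw [← hB, Module.Basis.isUnitSMul_apply, Module.Basis.isUnitSMul_apply]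
  by_cases hst : s = t
  · subst hst
    have h := Real.mul_self_sqrt (hpos s).le
    have h0 := (Real.sqrt_pos.2 (hpos s)).ne'
    simp only [map_smul, LinearMap.smul_apply, smul_eq_mul, if_true]
    field_simp
    nlinarith [h]
  · have h0 : B (v s) (v t) = 0 := hv hst
    simp [hst, h0]

end Triples

end FlagManifold

end

open scoped TensorProduct
set_option linter.unusedSectionVars false

noncomputable section

namespace FlagManifold

open LieAlgebra LieAlgebra.IsKilling LieModule

/-! ### Root vectors and the Casimir element of a sum of root spaces -/

section RootVectors

variable {L : Type*} [LieRing L] [LieAlgebra ℂ L] [FiniteDimensional ℂ L]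
  [LieAlgebra.IsKilling ℂ L]

/-! Complexify, and choose root vectors E_α ∈ 𝔤_α, F_α ∈ 𝔤_{-α} with B(E_α, F_α) = 1. A basis of a
real isotropy summand that is orthonormal for -B spans the corresponding sum of root spaces over ℂ,
so its Casimir tensor is minus the tensor Σ E_α ⊗ F_α over the roots of that summand. Substituting
this in all three slots (`RootVectors.sum_sq_eq`, `triple_eq_neg_sum`) gives [ijk] = -Σ B([E_γ,
E_δ], F_ε) B([F_γ, F_δ], E_ε), where γ, δ, ε restrict to ±ξ_i, ±ξ_j, ±ξ_k. A term can be nonzero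
only if κ(γ) + κ(δ) = κ(ε), whence the vanishing statements (`triple_eq_zero`).

The nonzero values need no structure constants. Order the three 𝔱-roots so that ξ₂ = ξ₁ + ξ₃ while
ξ₁ + ξ₂ is not the restriction of a root; the small coefficients of the two black simple roots make
this possible. For γ over ξ₁ and δ over -ξ₂ the bracket [F_γ, E_δ] vanishes, so the Jacobi identity
reduces the sum over ε to the action of [E_γ, F_γ] on E_δ, that is, to the inner product (γ, δ).
Hence [ijk] = 2 Σ (γ, δ) over the roots γ above ξ₁ and δ above ξ₂ (`triple_eq_two_mul_sum`).

These sums are evaluated in a `RootModel`, a set of integral vectors with the given Cartan matrix.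
Simple reflections and negation generate the abstract roots as well as the model, so the two
correspond, and the identity Σ_β (γ, β) β = γ fixes the normalization of the inner product
(`scale_mul_rootInner`). For E₆ and E₇ the sums are computed from lists of positive roots; for the
classical types they reduce to counting vectors ±e_i ± e_j (`innerSum_firstDegree`,
`innerSum_lastDegree`). -/

/-- Root vectors `E α ∈ 𝔤_α`, `F α ∈ 𝔤_{-α}` that are dual to each other for the Killing form. -/
structure RootVectors (H : LieSubalgebra ℂ L) [H.IsCartanSubalgebra] where
  E : H.root → L
  F : H.root → L
  E_mem : ∀ α, E α ∈ rootSpace H α.1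
  F_mem : ∀ α, F α ∈ rootSpace H (-α.1 : Weight ℂ H L)
  killing : ∀ α, killingForm ℂ L (E α) (F α) = 1

variable {H : LieSubalgebra ℂ L} [H.IsCartanSubalgebra]

/-- A vector of 𝔤_α that is orthogonal to 𝔤_{-α} lies in the radical of the Killing form, which is
zero; so a nonzero one pairs nontrivially with some vector of 𝔤_{-α}, which can be rescaled. -/
theorem exists_rootVectors : Nonempty (RootVectors H) := by
  have key : ∀ α : H.root, ∃ e ∈ rootSpace H α.1, ∃ f ∈ rootSpace H (-α.1 : Weight ℂ H L),
      killingForm ℂ L e f = 1 := by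
    intro α
    obtain ⟨e, he, he0⟩ := α.1.exists_ne_zero
    obtain ⟨f, hf, hef⟩ : ∃ f ∈ rootSpace H (-α.1 : H → ℂ), killingForm ℂ L e f ≠ 0 := by
      contrapose! he0
      simpa using mem_ker_killingForm_of_mem_rootSpace_of_forall_rootSpace_neg ℂ L H he he0
    refine ⟨e, he, (killingForm ℂ L e f)⁻¹ • f, ?_, ?_⟩
    · rw [Weight.coe_neg]; exact (rootSpace H _).smul_mem _ hf
    · simp [hef]
  choose E hE F hF hEF using key
  exact ⟨⟨E, F, hE, hF, hEF⟩⟩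

theorem toLinear_root_injective {α β : H.root}
    (h : α.1.toLinear = β.1.toLinear) : α = β := by
  apply Subtype.ext
  apply DFunLike.coe_injective
  ext x
  exact LinearMap.congr_fun h x

/-- The opposite of a root. -/
def negRoot (α : H.root) : H.root := ⟨-α.1, by simpa using H.isNonZero_coe_root α⟩

@[simp] theorem negRoot_negRoot (α : H.root) : negRoot (negRoot α) = α := by
  apply Subtype.ext; simp [negRoot]

theorem toLinear_negRoot (α : H.root) : (negRoot α).1.toLinear = -α.1.toLinear := rfl

/-- The sum of the root spaces of the roots in `I`. -/
def rootSum (I : Finset H.root) : Submodule ℂ L :=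
  ⨆ α ∈ I, (rootSpace H α.1).toSubmodule

theorem mem_rootSum {I : Finset H.root} {α : H.root} (hα : α ∈ I) {x : L}
    (hx : x ∈ rootSpace H α.1) : x ∈ rootSum I :=
  (le_iSup₂_of_le (f := fun (α : H.root) (_ : α ∈ I) => (rootSpace H α.1).toSubmodule) α hα le_rfl)
    hx

theorem rootSum_union [DecidableEq H.root] (I J : Finset H.root) :
    rootSum (I ∪ J) = rootSum I ⊔ rootSum J := by
  unfold rootSum
  simp only [Finset.mem_union, iSup_or, iSup_sup_eq]

namespace RootVectors

variable (v : RootVectors H)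

theorem killing_E_F [DecidableEq H.root] (α β : H.root) :
    killingForm ℂ L (v.E α) (v.F β) = if α = β then 1 else 0 := by
  split_ifs with h
  · subst h; exact v.killing α
  · refine killingForm_apply_eq_zero_of_mem_rootSpace_of_add_ne_zero ℂ L H (v.E_mem α) (v.F_mem β) ?_
    intro h0
    apply h
    apply toLinear_root_injective
    ext x
    have := congrFun h0 x
    simp only [Pi.add_apply, Weight.coe_neg, Pi.neg_apply, Pi.zero_apply] at this
    simpa [sub_eq_zero] using sub_eq_zero.1 (by simpa [sub_eq_add_neg] using this)

theorem exists_smul_E (α : H.root) {x : L} (hx : x ∈ rootSpace H α.1) : ∃ c : ℂ, x = c • v.E α := by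
  have h1 := finrank_rootSpace_eq_one α.1 (H.isNonZero_coe_root α)
  have hne : (⟨v.E α, v.E_mem α⟩ : rootSpace H α.1) ≠ 0 := by
    intro h
    have h' : v.E α = 0 := congrArg Subtype.val h
    have := v.killing α
    simp [h'] at this
  obtain ⟨c, hc⟩ := (finrank_eq_one_iff_of_nonzero' _ hne).1 h1 ⟨x, hx⟩
  exact ⟨c, by simpa using (congrArg Subtype.val hc).symm⟩

/-- Root spaces are lines and the families E, F are dual, so pairing with `v.F α` reads off the
coefficient of `v.E α`. -/
theorem eq_sum_of_mem {I : Finset H.root} {z : L} (hz : z ∈ rootSum I) :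
    z = ∑ α ∈ I, killingForm ℂ L z (v.F α) • v.E α := by
  classical
  unfold rootSum at hz
  induction hz using Submodule.iSup_induction' with
  | zero => simp
  | add x y _ _ hx hy =>
    conv_lhs => rw [hx, hy]
    simp [add_smul, Finset.sum_add_distrib]
  | mem α x hx =>
    by_cases hα : α ∈ I
    · simp only [hα, iSup_pos] at hx
      obtain ⟨c, rfl⟩ := v.exists_smul_E α hx
      simp [v.killing_E_F, hα]
    · simp only [hα, iSup_neg, not_false_eq_true, Submodule.mem_bot] at hx
      simp [hx]

/-- A family that is orthonormal for the negative of the Killing form and spans the sum of the root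
spaces of `I` has the same Casimir element as the root vectors. -/
theorem sum_mul_eq {I : Finset H.root} (hI : ∀ α ∈ I, negRoot α ∈ I) {p : ℕ} (x : Fin p → L)
    (hx : ∀ s, x s ∈ rootSum I)
    (hspan : ∀ z ∈ rootSum I, z = -∑ s, killingForm ℂ L z (x s) • x s) (g₁ g₂ : L →ₗ[ℂ] ℂ) :
    ∑ s, g₁ (x s) * g₂ (x s) = -∑ α ∈ I, g₁ (v.E α) * g₂ (v.F α) := by
  have h1 : ∀ s, g₁ (x s) * g₂ (x s) =
      ∑ α ∈ I, g₁ (v.E α) * (killingForm ℂ L (v.F α) (x s) * g₂ (x s)) := by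
    intro s
    conv_lhs => rw [v.eq_sum_of_mem (hx s)]
    rw [map_sum, Finset.sum_mul]
    refine Finset.sum_congr rfl fun α _ => ?_
    rw [map_smul, smul_eq_mul, LieModule.traceForm_comm, ← v.eq_sum_of_mem (hx s)]
    ring
  rw [Finset.sum_congr rfl fun s _ => h1 s, Finset.sum_comm, ← Finset.sum_neg_distrib]
  refine Finset.sum_congr rfl fun α hα => ?_
  -- Closure of `I` under negation puts `v.F α` in the span of the family, so the remaining sum over
  -- `s` collapses to `-g₂ (v.F α)`.
  have hF : v.F α ∈ rootSum I := mem_rootSum (hI α hα) (v.F_mem α)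
  conv_rhs => rw [hspan _ hF]
  rw [← Finset.mul_sum, map_neg, map_sum]
  simp

/-- The sum of squares that defines `[ijk]`, in terms of root vectors. -/
theorem sum_sq_eq {I J M : Finset H.root} (hI : ∀ α ∈ I, negRoot α ∈ I)
    (hJ : ∀ α ∈ J, negRoot α ∈ J) (hM : ∀ α ∈ M, negRoot α ∈ M) {p q r : ℕ}
    (x : Fin p → L) (y : Fin q → L) (z : Fin r → L)
    (hx : ∀ s, x s ∈ rootSum I) (hy : ∀ s, y s ∈ rootSum J) (hz : ∀ s, z s ∈ rootSum M)
    (hx' : ∀ w ∈ rootSum I, w = -∑ s, killingForm ℂ L w (x s) • x s)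
    (hy' : ∀ w ∈ rootSum J, w = -∑ s, killingForm ℂ L w (y s) • y s)
    (hz' : ∀ w ∈ rootSum M, w = -∑ s, killingForm ℂ L w (z s) • z s) :
    ∑ s, ∑ t, ∑ u, (killingForm ℂ L ⁅x s, y t⁆ (z u)) ^ 2 =
      -∑ γ ∈ I, ∑ δ ∈ J, ∑ ε ∈ M, killingForm ℂ L ⁅v.E γ, v.E δ⁆ (v.F ε) *
        killingForm ℂ L ⁅v.F γ, v.F δ⁆ (v.E ε) := by
  -- The Casimir identity is used once per slot; each use contributes a factor -1, hence the overall
  -- sign (-1)³.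
  have h1 : ∀ s t, ∑ u, (killingForm ℂ L ⁅x s, y t⁆ (z u)) ^ 2 =
      -∑ ε ∈ M, killingForm ℂ L ⁅x s, y t⁆ (v.F ε) * killingForm ℂ L ⁅x s, y t⁆ (v.E ε) := by
    intro s t
    have := v.sum_mul_eq hM z hz hz' (killingForm ℂ L ⁅x s, y t⁆) (killingForm ℂ L ⁅x s, y t⁆)
    simp only [sq, this]
    simp only [mul_comm]
  have h2 : ∀ s, ∀ ε, ∑ t, killingForm ℂ L ⁅x s, y t⁆ (v.F ε) * killingForm ℂ L ⁅x s, y t⁆ (v.E ε) =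
      -∑ δ ∈ J, killingForm ℂ L ⁅x s, v.E δ⁆ (v.F ε) * killingForm ℂ L ⁅x s, v.F δ⁆ (v.E ε) := by
    intro s ε
    exact v.sum_mul_eq hJ y hy hy' ((killingForm ℂ L).flip (v.F ε) ∘ₗ (LieAlgebra.ad ℂ L (x s)))
      ((killingForm ℂ L).flip (v.E ε) ∘ₗ (LieAlgebra.ad ℂ L (x s)))
  have h3 : ∀ δ ε, ∑ s, killingForm ℂ L ⁅x s, v.E δ⁆ (v.F ε) * killingForm ℂ L ⁅x s, v.F δ⁆ (v.E ε) =
      -∑ γ ∈ I, killingForm ℂ L ⁅v.E γ, v.E δ⁆ (v.F ε) *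
        killingForm ℂ L ⁅v.F γ, v.F δ⁆ (v.E ε) := by
    intro δ ε
    -- The summation variable now stands on the left of the bracket, so the functionals involve
    -- `-ad`.
    have := v.sum_mul_eq hI x hx hx'
      ((killingForm ℂ L).flip (v.F ε) ∘ₗ (-(LieAlgebra.ad ℂ L (v.E δ))))
      ((killingForm ℂ L).flip (v.E ε) ∘ₗ (-(LieAlgebra.ad ℂ L (v.F δ))))
    have e : ∀ a b c : L, (((killingForm ℂ L).flip c) ∘ₗ (-(LieAlgebra.ad ℂ L b))) a =
        killingForm ℂ L ⁅a, b⁆ c := by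
      intro a b c
      rw [LinearMap.comp_apply, LinearMap.neg_apply, LieAlgebra.ad_apply, lie_skew]; rfl
    simpa only [e] using this
  calc ∑ s, ∑ t, ∑ u, (killingForm ℂ L ⁅x s, y t⁆ (z u)) ^ 2
      = ∑ s, ∑ ε ∈ M, ∑ δ ∈ J, killingForm ℂ L ⁅x s, v.E δ⁆ (v.F ε) *
          killingForm ℂ L ⁅x s, v.F δ⁆ (v.E ε) := by
        refine Finset.sum_congr rfl fun s _ => ?_
        rw [Finset.sum_congr rfl fun t _ => h1 s t, Finset.sum_neg_distrib, Finset.sum_comm,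
          ← Finset.sum_neg_distrib]
        exact Finset.sum_congr rfl fun ε _ => by rw [h2, neg_neg]
    _ = ∑ ε ∈ M, ∑ δ ∈ J, ∑ s, killingForm ℂ L ⁅x s, v.E δ⁆ (v.F ε) *
          killingForm ℂ L ⁅x s, v.F δ⁆ (v.E ε) := by
        rw [Finset.sum_comm]
        exact Finset.sum_congr rfl fun ε _ => Finset.sum_comm
    _ = _ := by
        simp only [h3, Finset.sum_neg_distrib]
        congr 1
        rw [Finset.sum_comm, Finset.sum_comm (s := I)]
        refine Finset.sum_congr rfl fun δ _ => ?_
        rw [Finset.sum_comm]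

end RootVectors

/-! ### Brackets of root vectors and a grading of the roots -/

/-- The inner product of two roots that is induced by the Killing form. -/
def rootInner (γ δ : H.root) : ℂ := δ.1 ((cartanEquivDual H).symm γ.1.toLinear)

theorem rootInner_negRoot_right (γ δ : H.root) : rootInner γ (negRoot δ) = -rootInner γ δ := rfl

theorem rootInner_negRoot_left (γ δ : H.root) : rootInner (negRoot γ) δ = -rootInner γ δ := by
  unfold rootInner
  rw [toLinear_negRoot, map_neg, ← Weight.toLinear_apply, map_neg, Weight.toLinear_apply]

variable {W : Type*} [AddCommGroup W] [Module ℂ W]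
  (κ : Module.Dual ℂ H →ₗ[ℂ] W)

open Classical in
/-- The roots of degree `w`. -/
def rootsOfDegree (w : W) : Finset H.root := {γ | κ γ.1.toLinear = w}

@[simp] theorem mem_rootsOfDegree {w : W} {γ : H.root} :
    γ ∈ rootsOfDegree κ w ↔ κ γ.1.toLinear = w := by simp [rootsOfDegree]

/-- If the weight space for α + β is nonzero, then α + β is a weight, and its nonzero degree rules
out the zero weight; so it is a root. Allowing weights for α and β covers the vectors `v.F γ` as
well. -/
theorem lie_mem_rootSum {α β : Weight ℂ H L} {x y : L} (hx : x ∈ rootSpace H α)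
    (hy : y ∈ rootSpace H β) (h : κ α.toLinear + κ β.toLinear ≠ 0) :
    ⁅x, y⁆ ∈ rootSum (rootsOfDegree κ (κ α.toLinear + κ β.toLinear)) := by
  have hxy : ⁅x, y⁆ ∈ rootSpace H ((α : H → ℂ) + β) := lie_mem_genWeightSpace_of_mem_genWeightSpace hx hy
  by_cases hb : rootSpace H ((α : H → ℂ) + β) = ⊥
  · rw [hb] at hxy
    rw [(LieSubmodule.mem_bot _).1 hxy]
    exact zero_mem _
  · let γ : Weight ℂ H L := ⟨(α : H → ℂ) + β, hb⟩
    have hγ : γ.toLinear = α.toLinear + β.toLinear := by ext x; rfl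
    have hγ0 : γ.IsNonZero := by
      intro h0
      apply h
      rw [← map_add, ← hγ, Weight.coe_toLinear_eq_zero_iff.2 h0, map_zero]
    exact mem_rootSum (α := ⟨γ, by simpa using hγ0⟩) (by simp [hγ]) hxy

theorem lie_eq_zero {α β : Weight ℂ H L} {x y : L} (hx : x ∈ rootSpace H α)
    (hy : y ∈ rootSpace H β) {w : W} (hw : κ α.toLinear + κ β.toLinear = w) (h : w ≠ 0)
    (hno : ∀ γ : H.root, κ γ.1.toLinear ≠ w) : ⁅x, y⁆ = 0 := by
  have := lie_mem_rootSum κ hx hy (hw ▸ h)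
  rw [hw, show rootsOfDegree κ w = ∅ by ext γ; simp [hno γ]] at this
  simpa [rootSum] using this

namespace RootVectors

variable (v : RootVectors H)

theorem killing_lie_mul_eq_zero {γ δ ε : H.root}
    (h : κ γ.1.toLinear + κ δ.1.toLinear ≠ κ ε.1.toLinear) :
    killingForm ℂ L ⁅v.E γ, v.E δ⁆ (v.F ε) = 0 := by
  have hxy : ⁅v.E γ, v.E δ⁆ ∈ rootSpace H ((γ.1 : H → ℂ) + δ.1) :=
    lie_mem_genWeightSpace_of_mem_genWeightSpace (v.E_mem γ) (v.E_mem δ)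
  refine killingForm_apply_eq_zero_of_mem_rootSpace_of_add_ne_zero ℂ L H hxy (v.F_mem ε) ?_
  intro h0
  apply h
  rw [← map_add]
  congr 1
  ext x
  have := congrFun h0 x
  simp only [Pi.add_apply, Weight.coe_neg, Pi.neg_apply, Pi.zero_apply] at this
  simpa using eq_of_sub_eq_zero (by simpa [sub_eq_add_neg] using this)

/-- If `γ - δ` is not a degree of the roots, then the contribution of `γ` and `δ` is given by their
inner product. -/
theorem sum_killing_lie_mul {M : Finset H.root} {γ δ : H.root} {w : W}
    (h : κ γ.1.toLinear + κ δ.1.toLinear = w) (hw : w ≠ 0) (hM : rootsOfDegree κ w ⊆ M)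
    (hne : κ δ.1.toLinear - κ γ.1.toLinear ≠ 0)
    (hno : ∀ ε : H.root, κ ε.1.toLinear ≠ κ δ.1.toLinear - κ γ.1.toLinear) :
    ∑ ε ∈ M, killingForm ℂ L ⁅v.E γ, v.E δ⁆ (v.F ε) * killingForm ℂ L ⁅v.F γ, v.F δ⁆ (v.E ε) =
      rootInner γ δ := by
  have hmem : ⁅v.E γ, v.E δ⁆ ∈ rootSum M := by
    have h1 := lie_mem_rootSum κ (v.E_mem γ) (v.E_mem δ) (h ▸ hw)
    rw [h] at h1
    have : rootSum (rootsOfDegree κ w) ≤ rootSum M :=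
      iSup₂_mono' fun α hα => ⟨α, hM hα, le_rfl⟩
    exact this h1
  -- The bracket has degree κ(δ) - κ(γ), which no root has. This removes one of the two Jacobi terms
  -- below.
  have hF : ⁅v.F γ, v.E δ⁆ = 0 := by
    refine lie_eq_zero κ (v.F_mem γ) (v.E_mem δ) (w := κ δ.1.toLinear - κ γ.1.toLinear) ?_ hne hno
    rw [Weight.toLinear_neg, map_neg]; abel
  -- With the normalization B(E_γ, F_γ) = 1 the bracket is the Cartan element dual to γ, which acts
  -- on `v.E δ` by the inner product of γ and δ.
  have hEF : ⁅v.E γ, v.F γ⁆ = (((cartanEquivDual H).symm γ.1.toLinear : H) : L) := by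
    rw [lie_eq_killingForm_smul_of_mem_rootSpace_of_mem_rootSpace_neg (v.E_mem γ) (v.F_mem γ),
      v.killing, one_smul]
  have hh : ⁅⁅v.E γ, v.F γ⁆, v.E δ⁆ = rootInner γ δ • v.E δ := by
    rw [hEF]
    exact lie_eq_smul_of_mem_rootSpace (v.E_mem δ) _
  -- Duality of E and F on `M` contracts the sum over ε to a single value of the Killing form.
  have h2 : ∑ ε ∈ M, killingForm ℂ L ⁅v.E γ, v.E δ⁆ (v.F ε) *
      killingForm ℂ L ⁅v.F γ, v.F δ⁆ (v.E ε) =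
      killingForm ℂ L ⁅v.F γ, v.F δ⁆ ⁅v.E γ, v.E δ⁆ := by
    conv_rhs => rw [v.eq_sum_of_mem hmem]
    simp
  have h3 : ⁅v.F γ, ⁅v.E γ, v.E δ⁆⁆ = -(rootInner γ δ • v.E δ) := by
    rw [leibniz_lie, hF, lie_zero, add_zero, ← hh, ← lie_skew (v.E γ) (v.F γ), neg_lie, neg_neg]
  rw [h2, ← lie_skew, map_neg, LinearMap.neg_apply, killingForm, LieModule.traceForm_apply_lie_apply]
  change -killingForm ℂ L (v.F δ) ⁅v.F γ, ⁅v.E γ, v.E δ⁆⁆ = _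
  rw [h3, map_neg, map_smul, neg_neg, LieModule.traceForm_comm]
  change rootInner γ δ • killingForm ℂ L (v.E δ) (v.F δ) = _
  rw [v.killing, smul_eq_mul, mul_one]

end RootVectors

end RootVectors

/-! ### The conjugation with respect to the compact real form -/

section Conjugation

variable {𝔤 : Type*} [LieRing 𝔤] [LieAlgebra ℝ 𝔤]

/-- The conjugation of `ℂ ⊗ 𝔤` with respect to `𝔤`. -/
def conjugation : ℂ ⊗[ℝ] 𝔤 →ₗ[ℝ] ℂ ⊗[ℝ] 𝔤 := LinearMap.rTensor 𝔤 Complex.conjAe.toLinearMap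

@[simp] theorem conjugation_tmul (a : ℂ) (x : 𝔤) :
    conjugation (a ⊗ₜ[ℝ] x) = (starRingEnd ℂ a) ⊗ₜ[ℝ] x := rfl

@[simp] theorem conjugation_conjugation (z : ℂ ⊗[ℝ] 𝔤) : conjugation (conjugation z) = z := by
  obtain ⟨x, y, rfl⟩ := exists_eq_add_I z
  simp

theorem conjugation_smul (a : ℂ) (z : ℂ ⊗[ℝ] 𝔤) :
    conjugation (a • z) = (starRingEnd ℂ a) • conjugation z := by
  obtain ⟨x, y, rfl⟩ := exists_eq_add_I z
  simp [TensorProduct.smul_tmul']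

theorem conjugation_lie (z w : ℂ ⊗[ℝ] 𝔤) :
    conjugation ⁅z, w⁆ = ⁅conjugation z, conjugation w⁆ := by
  obtain ⟨x, y, rfl⟩ := exists_eq_add_I z
  obtain ⟨x', y', rfl⟩ := exists_eq_add_I w
  simp [add_lie, lie_add]

theorem conjugation_mem_complexify {𝔥 : LieSubalgebra ℝ 𝔤} {z : ℂ ⊗[ℝ] 𝔤}
    (hz : z ∈ complexify 𝔥) : conjugation z ∈ complexify 𝔥 := by
  obtain ⟨x, y, rfl⟩ := exists_eq_add_I z
  rw [mem_complexify_iff] at hz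
  have : conjugation ((1 : ℂ) ⊗ₜ[ℝ] x + Complex.I ⊗ₜ[ℝ] y) =
      (1 : ℂ) ⊗ₜ[ℝ] x + Complex.I ⊗ₜ[ℝ] (-y) := by
    simp [TensorProduct.neg_tmul, TensorProduct.tmul_neg]
  rw [this, mem_complexify_iff]
  exact ⟨hz.1, neg_mem hz.2⟩

theorem tmul_add_I_inj {x y x' y' : 𝔤} (h : (1 : ℂ) ⊗ₜ[ℝ] x + Complex.I ⊗ₜ[ℝ] y =
    (1 : ℂ) ⊗ₜ[ℝ] x' + Complex.I ⊗ₜ[ℝ] y') : x = x' ∧ y = y' := by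
  have h1 := congrArg (proj Complex.reLm) h
  have h2 := congrArg (proj Complex.imLm) h
  simp [proj] at h1 h2
  exact ⟨h1, h2⟩

variable [FiniteDimensional ℝ 𝔤]

theorem killingForm_one_tmul (x y : 𝔤) :
    killingForm ℂ (ℂ ⊗[ℝ] 𝔤) ((1 : ℂ) ⊗ₜ[ℝ] x) ((1 : ℂ) ⊗ₜ[ℝ] y) = (killingForm ℝ 𝔤 x y : ℂ) := by
  rw [killingForm, LieModule.traceForm_baseChange]
  simp

variable [IsCompactSemisimple 𝔤] {𝔥 : LieSubalgebra ℝ 𝔤} [IsMaximalTorus 𝔥]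

/-- For h ∈ 𝔥 the operator ad h is skew for the definite Killing form, so its eigenvalues are purely
imaginary: the two skewness relations for the real and imaginary parts of an eigenvector add up to
Re c · (B(x, x) + B(y, y)) = 0. -/
theorem re_root_apply_eq_zero (α : Weight ℂ (complexify 𝔥) (ℂ ⊗[ℝ] 𝔤)) {h : 𝔤} (hh : h ∈ 𝔥) :
    (α ⟨(1 : ℂ) ⊗ₜ[ℝ] h, tmul_mem_complexify 1 hh⟩).re = 0 := by
  obtain ⟨z, hz, hz0⟩ := α.exists_ne_zero
  have h1 := lie_eq_smul_of_mem_rootSpace hz ⟨(1 : ℂ) ⊗ₜ[ℝ] h, tmul_mem_complexify 1 hh⟩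
  set c := α ⟨(1 : ℂ) ⊗ₜ[ℝ] h, tmul_mem_complexify 1 hh⟩ with hc
  obtain ⟨x, y, rfl⟩ := exists_eq_add_I z
  have h2 : (1 : ℂ) ⊗ₜ[ℝ] ⁅h, x⁆ + Complex.I ⊗ₜ[ℝ] ⁅h, y⁆ =
      (1 : ℂ) ⊗ₜ[ℝ] (c.re • x - c.im • y) + Complex.I ⊗ₜ[ℝ] (c.im • x + c.re • y) := by
    have h3 : ⁅(1 : ℂ) ⊗ₜ[ℝ] h, (1 : ℂ) ⊗ₜ[ℝ] x + Complex.I ⊗ₜ[ℝ] y⁆ =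
        c • ((1 : ℂ) ⊗ₜ[ℝ] x + Complex.I ⊗ₜ[ℝ] y) := h1
    have h4 : ⁅(1 : ℂ) ⊗ₜ[ℝ] h, (1 : ℂ) ⊗ₜ[ℝ] x + Complex.I ⊗ₜ[ℝ] y⁆ =
        (1 : ℂ) ⊗ₜ[ℝ] ⁅h, x⁆ + Complex.I ⊗ₜ[ℝ] ⁅h, y⁆ :=
      (lie_add ((1 : ℂ) ⊗ₜ[ℝ] h) ((1 : ℂ) ⊗ₜ[ℝ] x) (Complex.I ⊗ₜ[ℝ] y)).trans (by
        rw [LieAlgebra.ExtendScalars.bracket_tmul, LieAlgebra.ExtendScalars.bracket_tmul, one_mul,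
          one_mul])
    rw [← h4, h3]
    simp only [TensorProduct.tmul_add, TensorProduct.tmul_sub, TensorProduct.tmul_smul,
      TensorProduct.smul_tmul', smul_add]
    have e1 : c • (1 : ℂ) = c.re • (1 : ℂ) + c.im • Complex.I := by
      apply Complex.ext <;> simp
    have e2 : c • Complex.I = c.re • Complex.I - c.im • (1 : ℂ) := by
      apply Complex.ext <;> simp
    rw [e1, e2, TensorProduct.add_tmul, TensorProduct.sub_tmul]
    abel
  obtain ⟨hx, hy⟩ := tmul_add_I_inj h2
  have hskew : ∀ u : 𝔤, killingForm ℝ 𝔤 ⁅h, u⁆ u = 0 := by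
    intro u
    rw [killingForm, LieModule.traceForm_apply_lie_apply, lie_self, map_zero]
  have e1 := hskew x
  have e2 := hskew y
  rw [hx] at e1
  rw [hy] at e2
  simp only [map_sub, map_add, map_smul, LinearMap.sub_apply, LinearMap.add_apply,
    LinearMap.smul_apply, smul_eq_mul] at e1 e2
  have hsymm : killingForm ℝ 𝔤 y x = killingForm ℝ 𝔤 x y := LieModule.traceForm_comm ℝ 𝔤 𝔤 y x
  rw [hsymm] at e1
  have e3 : c.re * (killingForm ℝ 𝔤 x x + killingForm ℝ 𝔤 y y) = 0 := by linarith
  rcases mul_eq_zero.1 e3 with h0 | h0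
  · exact h0
  · exfalso
    apply hz0
    have nonpos : ∀ u : 𝔤, killingForm ℝ 𝔤 u u ≤ 0 := by
      intro u
      by_cases hu : u = 0
      · simp [hu]
      · exact (IsCompactSemisimple.killing_neg u hu).le
    have hx0 : x = 0 := by
      by_contra hx0
      linarith [IsCompactSemisimple.killing_neg x hx0, nonpos y]
    have hy0 : y = 0 := by
      by_contra hy0
      linarith [IsCompactSemisimple.killing_neg y hy0, nonpos x]
    simp [hx0, hy0]

/-- Roots are imaginary on 𝔥, so the conjugate of α(τh) is -α(h); applying τ to the eigenvalue
equation for τh gives the claim. -/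
theorem conjugation_mem_rootSpace {α : Weight ℂ (complexify 𝔥) (ℂ ⊗[ℝ] 𝔤)} {z : ℂ ⊗[ℝ] 𝔤}
    (hz : z ∈ rootSpace (complexify 𝔥) α) :
    conjugation z ∈ rootSpace (complexify 𝔥) (-α : Weight ℂ (complexify 𝔥) (ℂ ⊗[ℝ] 𝔤)) := by
  apply LieModule.weightSpace_le_genWeightSpace
  rw [LieModule.mem_weightSpace]
  intro h
  have hstar : starRingEnd ℂ (α ⟨conjugation (h : ℂ ⊗[ℝ] 𝔤), conjugation_mem_complexify h.2⟩) =
      -α h := by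
    obtain ⟨h, hh⟩ := h
    obtain ⟨a, b, rfl⟩ := exists_eq_add_I h
    have hab := (mem_complexify_iff a b).1 hh
    set u : complexify 𝔥 := ⟨(1 : ℂ) ⊗ₜ[ℝ] a, tmul_mem_complexify 1 hab.1⟩ with hu
    set v : complexify 𝔥 := ⟨(1 : ℂ) ⊗ₜ[ℝ] b, tmul_mem_complexify 1 hab.2⟩ with hv
    have e1 : (⟨(1 : ℂ) ⊗ₜ[ℝ] a + Complex.I ⊗ₜ[ℝ] b, hh⟩ : complexify 𝔥) = u + Complex.I • v := by
      apply Subtype.ext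
      simp [hu, hv, TensorProduct.smul_tmul']
    have e2 : (⟨conjugation ((1 : ℂ) ⊗ₜ[ℝ] a + Complex.I ⊗ₜ[ℝ] b),
        conjugation_mem_complexify hh⟩ : complexify 𝔥) = u - Complex.I • v := by
      apply Subtype.ext
      simp [hu, hv, TensorProduct.smul_tmul', TensorProduct.neg_tmul, sub_eq_add_neg]
    have h1 : (α u).re = 0 := re_root_apply_eq_zero α hab.1
    have h2 : (α v).re = 0 := re_root_apply_eq_zero α hab.2
    have e3 := congrArg α e1
    have e4 := congrArg α e2
    rw [e3, e4, ← Weight.toLinear_apply, ← Weight.toLinear_apply, map_sub, map_add, map_smul]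
    simp only [Weight.toLinear_apply, smul_eq_mul]
    apply Complex.ext <;> simp [h1, h2]
  have h1 := lie_eq_smul_of_mem_rootSpace hz
    ⟨conjugation (h : ℂ ⊗[ℝ] 𝔤), conjugation_mem_complexify h.2⟩
  have h2 := congrArg conjugation h1
  rw [conjugation_smul, hstar] at h2
  rw [Weight.coe_neg, Pi.neg_apply, ← h2]
  change ⁅(h : ℂ ⊗[ℝ] 𝔤), conjugation z⁆ = conjugation ⁅conjugation (h : ℂ ⊗[ℝ] 𝔤), z⁆
  rw [conjugation_lie, conjugation_conjugation]

theorem conjugation_mem_rootSum {I : Finset (complexify 𝔥).root} (hI : ∀ α ∈ I, negRoot α ∈ I)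
    {z : ℂ ⊗[ℝ] 𝔤} (hz : z ∈ rootSum I) : conjugation z ∈ rootSum I := by
  obtain ⟨v⟩ := exists_rootVectors (H := complexify 𝔥)
  rw [v.eq_sum_of_mem hz, map_sum]
  refine sum_mem fun α hα => ?_
  rw [conjugation_smul]
  exact Submodule.smul_mem _ _ (mem_rootSum (hI α hα) (conjugation_mem_rootSpace (v.E_mem α)))

/-- The two parts are obtained from the sum and the difference of the vector and its conjugate,
which stays in the sum because conjugation exchanges the root spaces of α and -α. -/
theorem one_tmul_mem_rootSum {I : Finset (complexify 𝔥).root} (hI : ∀ α ∈ I, negRoot α ∈ I)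
    {x y : 𝔤} (hz : (1 : ℂ) ⊗ₜ[ℝ] x + Complex.I ⊗ₜ[ℝ] y ∈ rootSum I) :
    (1 : ℂ) ⊗ₜ[ℝ] x ∈ rootSum I ∧ (1 : ℂ) ⊗ₜ[ℝ] y ∈ rootSum I := by
  have h1 := conjugation_mem_rootSum hI hz
  have hI' : Complex.I ⊗ₜ[ℝ] y = Complex.I • ((1 : ℂ) ⊗ₜ[ℝ] y) := by
    simp [TensorProduct.smul_tmul']
  have hc : conjugation ((1 : ℂ) ⊗ₜ[ℝ] x + Complex.I ⊗ₜ[ℝ] y) =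
      (1 : ℂ) ⊗ₜ[ℝ] x - Complex.I • ((1 : ℂ) ⊗ₜ[ℝ] y) := by
    rw [map_add, hI', conjugation_smul]
    simp [sub_eq_add_neg]
  rw [hc] at h1
  rw [hI'] at hz
  have h2 := Submodule.smul_mem _ (2⁻¹ : ℂ) (add_mem hz h1)
  have h3 := Submodule.smul_mem _ (2⁻¹ * -Complex.I : ℂ) (sub_mem hz h1)
  generalize (1 : ℂ) ⊗ₜ[ℝ] x = u at *
  generalize (1 : ℂ) ⊗ₜ[ℝ] y = w at *
  refine ⟨?_, ?_⟩
  · convert h2 using 1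
    module
  · convert h3 using 1
    rw [show u + Complex.I • w - (u - Complex.I • w) = (2 * Complex.I) • w by module, smul_smul,
      show (2⁻¹ * -Complex.I * (2 * Complex.I) : ℂ) = 1 by
        linear_combination (-1 : ℂ) * Complex.I_mul_I, one_smul]

end Conjugation

/-! ### The numbers `[ijk]` in terms of roots -/

section RealBases

variable {𝔤 : Type*} [LieRing 𝔤] [LieAlgebra ℝ 𝔤] [FiniteDimensional ℝ 𝔤] [IsCompactSemisimple 𝔤]
  {𝔥 : LieSubalgebra ℝ 𝔤} [IsMaximalTorus 𝔥]

theorem eq_neg_sum_of_isOrthonormalBasis {V : Submodule ℝ 𝔤} {d : ℕ}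
    {X : Module.Basis (Fin d) ℝ V} (hX : IsOrthonormalBasis X) {a : 𝔤} (ha : a ∈ V) :
    a = -∑ s, killingForm ℝ 𝔤 a (X s : 𝔤) • (X s : 𝔤) := by
  have h1 : a = ∑ s, X.repr ⟨a, ha⟩ s • (X s : 𝔤) := by
    have := congrArg V.subtype (X.sum_repr ⟨a, ha⟩)
    rw [map_sum] at this
    exact this.symm
  have h2 : ∀ t, killingForm ℝ 𝔤 a (X t : 𝔤) = -X.repr ⟨a, ha⟩ t := by
    intro t
    have h3 : ∀ s, killingForm ℝ 𝔤 (X s : 𝔤) (X t : 𝔤) = -if s = t then 1 else 0 := by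
      intro s; rw [← hX s t, neg_neg]
    conv_lhs => rw [h1]
    simp [h3]
  simp only [h2, neg_smul, Finset.sum_neg_distrib, neg_neg]
  exact h1

/-- This is the spanning hypothesis of `RootVectors.sum_mul_eq`: the real expansion applies
separately to the real and imaginary parts of `z`, both of which lie in `V`. -/
theorem eq_neg_sum_of_mem_rootSum {I : Finset (complexify 𝔥).root} (hI : ∀ α ∈ I, negRoot α ∈ I)
    {V : Submodule ℝ 𝔤} (hV : ∀ x, x ∈ V ↔ (1 : ℂ) ⊗ₜ[ℝ] x ∈ rootSum I) {d : ℕ}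
    {X : Module.Basis (Fin d) ℝ V} (hX : IsOrthonormalBasis X) {z : ℂ ⊗[ℝ] 𝔤}
    (hz : z ∈ rootSum I) :
    z = -∑ s, killingForm ℂ (ℂ ⊗[ℝ] 𝔤) z ((1 : ℂ) ⊗ₜ[ℝ] (X s : 𝔤)) •
      ((1 : ℂ) ⊗ₜ[ℝ] (X s : 𝔤)) := by
  obtain ⟨x, y, rfl⟩ := exists_eq_add_I z
  obtain ⟨hx, hy⟩ := one_tmul_mem_rootSum hI hz
  have key : ∀ x ∈ V, (1 : ℂ) ⊗ₜ[ℝ] x = -∑ s, killingForm ℂ (ℂ ⊗[ℝ] 𝔤) ((1 : ℂ) ⊗ₜ[ℝ] x)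
      ((1 : ℂ) ⊗ₜ[ℝ] (X s : 𝔤)) • ((1 : ℂ) ⊗ₜ[ℝ] (X s : 𝔤)) := by
    intro x hx
    conv_lhs => rw [eq_neg_sum_of_isOrthonormalBasis hX hx]
    rw [TensorProduct.tmul_neg, TensorProduct.tmul_sum]
    congr 1
    refine Finset.sum_congr rfl fun s _ => ?_
    rw [killingForm_one_tmul, TensorProduct.tmul_smul, TensorProduct.smul_tmul',
      TensorProduct.smul_tmul', Complex.real_smul, smul_eq_mul]
  have hI' : Complex.I ⊗ₜ[ℝ] y = Complex.I • ((1 : ℂ) ⊗ₜ[ℝ] y) := by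
    simp [TensorProduct.smul_tmul']
  rw [hI']
  simp only [map_add, map_smul, LinearMap.add_apply, LinearMap.smul_apply, add_smul,
    Finset.sum_add_distrib, neg_add, smul_assoc]
  rw [← Finset.smul_sum, ← smul_neg, ← key x ((hV x).2 hx), ← key y ((hV y).2 hy)]

theorem triple_eq_neg_sum (v : RootVectors (complexify 𝔥)) {I J M : Finset (complexify 𝔥).root}
    (hI : ∀ α ∈ I, negRoot α ∈ I) (hJ : ∀ α ∈ J, negRoot α ∈ J) (hM : ∀ α ∈ M, negRoot α ∈ M)
    {V₁ V₂ V₃ : Submodule ℝ 𝔤} (h₁ : ∀ x, x ∈ V₁ ↔ (1 : ℂ) ⊗ₜ[ℝ] x ∈ rootSum I)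
    (h₂ : ∀ x, x ∈ V₂ ↔ (1 : ℂ) ⊗ₜ[ℝ] x ∈ rootSum J)
    (h₃ : ∀ x, x ∈ V₃ ↔ (1 : ℂ) ⊗ₜ[ℝ] x ∈ rootSum M) {p q r : ℕ}
    {X : Module.Basis (Fin p) ℝ V₁} {Y : Module.Basis (Fin q) ℝ V₂} {Z : Module.Basis (Fin r) ℝ V₃}
    (hX : IsOrthonormalBasis X) (hY : IsOrthonormalBasis Y) (hZ : IsOrthonormalBasis Z) :
    ((triple X Y Z : ℝ) : ℂ) = -∑ γ ∈ I, ∑ δ ∈ J, ∑ ε ∈ M,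
      killingForm ℂ _ ⁅v.E γ, v.E δ⁆ (v.F ε) * killingForm ℂ _ ⁅v.F γ, v.F δ⁆ (v.E ε) := by
  rw [← v.sum_sq_eq hI hJ hM (fun s => (1 : ℂ) ⊗ₜ[ℝ] (X s : 𝔤)) (fun s => (1 : ℂ) ⊗ₜ[ℝ] (Y s : 𝔤))
    (fun s => (1 : ℂ) ⊗ₜ[ℝ] (Z s : 𝔤)) (fun s => (h₁ _).1 (X s).2) (fun s => (h₂ _).1 (Y s).2)
    (fun s => (h₃ _).1 (Z s).2) (fun w hw => eq_neg_sum_of_mem_rootSum hI h₁ hX hw)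
    (fun w hw => eq_neg_sum_of_mem_rootSum hJ h₂ hY hw)
    (fun w hw => eq_neg_sum_of_mem_rootSum hM h₃ hZ hw)]
  unfold triple
  push_cast
  simp only [LieAlgebra.ExtendScalars.bracket_tmul, one_mul, killingForm_one_tmul]

theorem triple_swap_left {V W U : Submodule ℝ 𝔤} {p q r : ℕ} (X : Module.Basis (Fin p) ℝ V)
    (Y : Module.Basis (Fin q) ℝ W) (Z : Module.Basis (Fin r) ℝ U) :
    triple X Y Z = triple Y X Z := by
  unfold triple
  rw [Finset.sum_comm]
  refine Finset.sum_congr rfl fun t _ => Finset.sum_congr rfl fun s _ =>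
    Finset.sum_congr rfl fun u _ => ?_
  rw [← lie_skew, map_neg, LinearMap.neg_apply, neg_sq]

/-- Invariance of the Killing form. Together with antisymmetry of the bracket it makes [ijk]
symmetric, so one convenient order per triple suffices. -/
theorem triple_swap_right {V W U : Submodule ℝ 𝔤} {p q r : ℕ} (X : Module.Basis (Fin p) ℝ V)
    (Y : Module.Basis (Fin q) ℝ W) (Z : Module.Basis (Fin r) ℝ U) :
    triple X Y Z = triple X Z Y := by
  unfold triple
  refine Finset.sum_congr rfl fun s _ => ?_
  rw [Finset.sum_comm]
  refine Finset.sum_congr rfl fun u _ => Finset.sum_congr rfl fun t _ => ?_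
  have : killingForm ℝ 𝔤 ⁅(X s : 𝔤), (Y t : 𝔤)⁆ (Z u : 𝔤) =
      -killingForm ℝ 𝔤 ⁅(X s : 𝔤), (Z u : 𝔤)⁆ (Y t : 𝔤) := by
    rw [← lie_skew, map_neg, LinearMap.neg_apply, killingForm, LieModule.traceForm_apply_lie_apply,
      LieModule.traceForm_comm]
  rw [this, neg_sq]

end RealBases

/-! ### The isotropy summands -/

section Summands

variable {𝔤 : Type*} [LieRing 𝔤] [LieAlgebra ℝ 𝔤] [FiniteDimensional ℝ 𝔤] [IsCompactSemisimple 𝔤]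
  {𝔥 : LieSubalgebra ℝ 𝔤} [IsMaximalTorus 𝔥] (b : (roots 𝔥).Base) (black : Set (complexify 𝔥).root)

/-- The restriction of functionals to the centre, as a linear map. -/
abbrev restrictCentre :
    Module.Dual ℂ (complexify 𝔥) →ₗ[ℂ] Module.Dual ℂ (centre b black) :=
  (centre b black).dualRestrict

theorem restrictCentre_eq_kappa (α : (complexify 𝔥).root) :
    restrictCentre b black α.1.toLinear = kappa b black α := rfl

theorem kappa_eq_zero_of_mem {α : (complexify 𝔥).root} (hα : α ∈ rootsK b black) :
    kappa b black α = 0 := by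
  ext ⟨x, hx⟩
  simp only [centre, Submodule.mem_iInf] at hx
  exact hx α hα

/-- Roots of R_K restrict to zero on the centre, so for ξ ≠ 0 the condition α ∉ R_K is automatic. -/
theorem complexSummand_eq_rootSum {ξ : Module.Dual ℂ (centre b black)} (hξ : ξ ≠ 0) :
    complexSummand b black ξ = rootSum (rootsOfDegree (restrictCentre b black) ξ) := by
  unfold complexSummand rootSum
  have : ∀ α : (complexify 𝔥).root, (α ∉ rootsK b black ∧ kappa b black α = ξ) ↔
      α ∈ rootsOfDegree (restrictCentre b black) ξ := by
    intro α
    rw [mem_rootsOfDegree, restrictCentre_eq_kappa]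
    refine ⟨fun h => h.2, fun h => ⟨fun h' => hξ ?_, h⟩⟩
    rw [← h, kappa_eq_zero_of_mem b black h']
  simp only [this]

/-- The roots of degree `w` or `-w`. -/
def rootsOfDegreePM {L : Type*} [LieRing L] [LieAlgebra ℂ L] [FiniteDimensional ℂ L]
    [LieAlgebra.IsKilling ℂ L] {H : LieSubalgebra ℂ L} [H.IsCartanSubalgebra]
    {W : Type*} [AddCommGroup W] [Module ℂ W] (κ : Module.Dual ℂ H →ₗ[ℂ] W) (w : W) :
    Finset H.root :=
  open Classical in rootsOfDegree κ w ∪ rootsOfDegree κ (-w)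

@[simp] theorem mem_rootsOfDegreePM {L : Type*} [LieRing L] [LieAlgebra ℂ L]
    [FiniteDimensional ℂ L] [LieAlgebra.IsKilling ℂ L] {H : LieSubalgebra ℂ L}
    [H.IsCartanSubalgebra] {W : Type*} [AddCommGroup W] [Module ℂ W]
    {κ : Module.Dual ℂ H →ₗ[ℂ] W} {w : W} {γ : H.root} :
    γ ∈ rootsOfDegreePM κ w ↔ κ γ.1.toLinear = w ∨ κ γ.1.toLinear = -w := by
  simp [rootsOfDegreePM]

theorem negRoot_mem_rootsOfDegreePM {L : Type*} [LieRing L] [LieAlgebra ℂ L]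
    [FiniteDimensional ℂ L] [LieAlgebra.IsKilling ℂ L] {H : LieSubalgebra ℂ L}
    [H.IsCartanSubalgebra] {W : Type*} [AddCommGroup W] [Module ℂ W]
    (κ : Module.Dual ℂ H →ₗ[ℂ] W) (w : W) :
    ∀ γ ∈ rootsOfDegreePM κ w, negRoot γ ∈ rootsOfDegreePM κ w := by
  intro γ hγ
  rw [mem_rootsOfDegreePM] at hγ ⊢
  rw [toLinear_negRoot, map_neg, neg_inj, neg_eq_iff_eq_neg]
  exact hγ.symm

theorem mem_realSummand {ξ : Module.Dual ℂ (centre b black)} (hξ : ξ ≠ 0) (x : 𝔤) :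
    x ∈ realSummand b black ξ ↔
      (1 : ℂ) ⊗ₜ[ℝ] x ∈ rootSum (rootsOfDegreePM (restrictCentre b black) ξ) := by
  classical
  rw [rootsOfDegreePM, rootSum_union, ← complexSummand_eq_rootSum b black hξ,
    ← complexSummand_eq_rootSum b black (neg_ne_zero.2 hξ)]
  rfl

variable {b black}

/-- `[ijk] = 0` unless a signed sum of the three `𝔱`-roots vanishes. -/
theorem triple_eq_zero {ξ₁ ξ₂ ξ₃ : Module.Dual ℂ (centre b black)} (h₁ : ξ₁ ≠ 0) (h₂ : ξ₂ ≠ 0)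
    (h₃ : ξ₃ ≠ 0) (hpp : ξ₁ + ξ₂ + ξ₃ ≠ 0) (hpm : ξ₁ + ξ₂ - ξ₃ ≠ 0) (hmp : ξ₁ - ξ₂ + ξ₃ ≠ 0)
    (hmm : ξ₁ - ξ₂ - ξ₃ ≠ 0) {p q r : ℕ}
    {X : Module.Basis (Fin p) ℝ (realSummand b black ξ₁)}
    {Y : Module.Basis (Fin q) ℝ (realSummand b black ξ₂)}
    {Z : Module.Basis (Fin r) ℝ (realSummand b black ξ₃)}
    (hX : IsOrthonormalBasis X) (hY : IsOrthonormalBasis Y) (hZ : IsOrthonormalBasis Z) :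
    triple X Y Z = 0 := by
  obtain ⟨v⟩ := exists_rootVectors (H := complexify 𝔥)
  set κ := restrictCentre b black
  have h := triple_eq_neg_sum v (negRoot_mem_rootsOfDegreePM κ ξ₁)
    (negRoot_mem_rootsOfDegreePM κ ξ₂) (negRoot_mem_rootsOfDegreePM κ ξ₃)
    (mem_realSummand b black h₁) (mem_realSummand b black h₂) (mem_realSummand b black h₃) hX hY hZ
  rw [Finset.sum_eq_zero, neg_zero] at h
  · exact_mod_cast h
  · intro γ hγ
    refine Finset.sum_eq_zero fun δ hδ => Finset.sum_eq_zero fun ε hε => ?_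
    rw [mem_rootsOfDegreePM] at hγ hδ hε
    rw [v.killing_lie_mul_eq_zero κ, zero_mul]
    intro h0
    -- The eight choices of signs are excluded by four hypotheses, since an overall sign does not
    -- matter.
    rcases hγ with hγ | hγ <;> rcases hδ with hδ | hδ <;> rcases hε with hε | hε <;>
      rw [hγ, hδ, hε] at h0
    · exact hpm (by rw [h0]; abel)
    · exact hpp (by rw [h0]; abel)
    · exact hmm (by rw [sub_eq_add_neg ξ₁, h0]; abel)
    · exact hmp (by rw [sub_eq_add_neg ξ₁, h0]; abel)
    · exact hmp (by rw [← h0]; abel)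
    · exact hmm (by rw [← neg_eq_iff_eq_neg.2 h0]; abel)
    · exact hpp (by rw [← h0]; abel)
    · exact hpm (by rw [← neg_eq_iff_eq_neg.2 h0]; abel)

theorem sum_rootsOfDegree_neg (κ : Module.Dual ℂ (complexify 𝔥) →ₗ[ℂ] Module.Dual ℂ (centre b black))
    (ξ : Module.Dual ℂ (centre b black)) (f : (complexify 𝔥).root → ℂ) :
    ∑ γ ∈ rootsOfDegree κ (-ξ), f γ = ∑ γ ∈ rootsOfDegree κ ξ, f (negRoot γ) := by
  refine Finset.sum_nbij' negRoot negRoot ?_ ?_ ?_ ?_ ?_ <;>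
    simp +contextual [toLinear_negRoot]

/-- If `ξ₂ = ξ₁ + ξ₃` and `ξ₁ + ξ₂` is not the restriction of a root, then the number `[ijk]` is
given by the inner products of the roots that belong to `ξ₁` and `ξ₂`. -/
theorem triple_eq_two_mul_sum {ξ₁ ξ₂ ξ₃ : Module.Dual ℂ (centre b black)} (h₁ : ξ₁ ≠ 0)
    (h₂ : ξ₂ ≠ 0) (h₃ : ξ₃ ≠ 0) (hsum : ξ₂ = ξ₁ + ξ₃) (hne : ξ₁ + ξ₂ ≠ 0)
    (hno : ∀ γ, kappa b black γ ≠ ξ₁ + ξ₂) {p q r : ℕ}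
    {X : Module.Basis (Fin p) ℝ (realSummand b black ξ₁)}
    {Y : Module.Basis (Fin q) ℝ (realSummand b black ξ₂)}
    {Z : Module.Basis (Fin r) ℝ (realSummand b black ξ₃)}
    (hX : IsOrthonormalBasis X) (hY : IsOrthonormalBasis Y) (hZ : IsOrthonormalBasis Z) :
    ((triple X Y Z : ℝ) : ℂ) = 2 * ∑ γ ∈ rootsOfDegree (restrictCentre b black) ξ₁,
      ∑ δ ∈ rootsOfDegree (restrictCentre b black) ξ₂, rootInner γ δ := by
  classical
  obtain ⟨v⟩ := exists_rootVectors (H := complexify 𝔥)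
  rw [triple_eq_neg_sum v (negRoot_mem_rootsOfDegreePM _ ξ₁)
    (negRoot_mem_rootsOfDegreePM _ ξ₂) (negRoot_mem_rootsOfDegreePM _ ξ₃)
    (mem_realSummand b black h₁) (mem_realSummand b black h₂) (mem_realSummand b black h₃) hX hY hZ]
  set κ := restrictCentre b black with hκ
  have hno1 : ∀ γ : (complexify 𝔥).root, κ γ.1.toLinear ≠ ξ₁ + ξ₂ := hno
  have hno2 : ∀ γ : (complexify 𝔥).root, κ γ.1.toLinear ≠ -(ξ₁ + ξ₂) := by
    intro γ h
    apply hno1 (negRoot γ)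
    rw [toLinear_negRoot, map_neg, h, neg_neg]
  have hdisj : ∀ {ξ : Module.Dual ℂ (centre b black)}, ξ ≠ 0 →
      Disjoint (rootsOfDegree κ ξ) (rootsOfDegree κ (-ξ)) := by
    intro ξ hξ
    rw [Finset.disjoint_left]
    intro γ hγ hγ'
    rw [mem_rootsOfDegree] at hγ hγ'
    rw [hγ] at hγ'
    have h2 : (2 : ℂ) • ξ = 0 := by
      rw [two_smul]
      nth_rewrite 2 [hγ']
      exact add_neg_cancel ξ
    exact hξ ((smul_eq_zero.1 h2).resolve_left two_ne_zero)
  set T : (complexify 𝔥).root → (complexify 𝔥).root → ℂ := fun γ δ =>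
    ∑ ε ∈ rootsOfDegreePM κ ξ₃,
      killingForm ℂ _ ⁅v.E γ, v.E δ⁆ (v.F ε) * killingForm ℂ _ ⁅v.F γ, v.F δ⁆ (v.E ε) with hT
  change -∑ γ ∈ rootsOfDegreePM κ ξ₁, ∑ δ ∈ rootsOfDegreePM κ ξ₂, T γ δ = _
  have hpp : ∀ γ ∈ rootsOfDegree κ ξ₁, ∀ δ ∈ rootsOfDegree κ ξ₂, T γ δ = 0 := by
    intro γ hγ δ hδ
    rw [mem_rootsOfDegree] at hγ hδ
    have := lie_eq_zero κ (v.E_mem γ) (v.E_mem δ) (w := ξ₁ + ξ₂) (by rw [hγ, hδ]) hne hno1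
    simp [hT, this]
  have hmm : ∀ γ ∈ rootsOfDegree κ (-ξ₁), ∀ δ ∈ rootsOfDegree κ (-ξ₂), T γ δ = 0 := by
    intro γ hγ δ hδ
    rw [mem_rootsOfDegree] at hγ hδ
    have := lie_eq_zero κ (v.E_mem γ) (v.E_mem δ) (w := -(ξ₁ + ξ₂)) (by rw [hγ, hδ]; abel)
      (neg_ne_zero.2 hne) hno2
    simp [hT, this]
  -- Opposite signs are the surviving case: the sum of the degrees is -ξ₃, and their difference is
  -- -(ξ₁ + ξ₂), which is not the degree of a root.
  have hpm : ∀ γ ∈ rootsOfDegree κ ξ₁, ∀ δ ∈ rootsOfDegree κ (-ξ₂), T γ δ = rootInner γ δ := by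
    intro γ hγ δ hδ
    rw [mem_rootsOfDegree] at hγ hδ
    have e : κ δ.1.toLinear - κ γ.1.toLinear = -(ξ₁ + ξ₂) := by rw [hγ, hδ]; abel
    refine v.sum_killing_lie_mul κ (w := -ξ₃) (by rw [hγ, hδ, hsum]; abel) (neg_ne_zero.2 h₃)
      ?_ (by rw [e]; exact neg_ne_zero.2 hne) (by rw [e]; exact hno2)
    intro ε hε
    rw [mem_rootsOfDegree] at hε
    exact mem_rootsOfDegreePM.2 (Or.inr hε)
  have hmp : ∀ γ ∈ rootsOfDegree κ (-ξ₁), ∀ δ ∈ rootsOfDegree κ ξ₂, T γ δ = rootInner γ δ := by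
    intro γ hγ δ hδ
    rw [mem_rootsOfDegree] at hγ hδ
    have e : κ δ.1.toLinear - κ γ.1.toLinear = ξ₁ + ξ₂ := by rw [hγ, hδ]; abel
    refine v.sum_killing_lie_mul κ (w := ξ₃) (by rw [hγ, hδ, hsum]; abel) h₃
      ?_ (by rw [e]; exact hne) (by rw [e]; exact hno1)
    intro ε hε
    rw [mem_rootsOfDegree] at hε
    exact mem_rootsOfDegreePM.2 (Or.inl hε)
  unfold rootsOfDegreePM
  rw [Finset.sum_union (hdisj h₁)]
  -- Replacing δ by its opposite changes the sign of the inner product, which cancels the sign in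
  -- `triple_eq_neg_sum`. The halves `s1` and `s2` agree, whence the factor 2.
  have s1 : ∑ γ ∈ rootsOfDegree κ ξ₁, ∑ δ ∈ rootsOfDegree κ ξ₂ ∪ rootsOfDegree κ (-ξ₂), T γ δ =
      -∑ γ ∈ rootsOfDegree κ ξ₁, ∑ δ ∈ rootsOfDegree κ ξ₂, rootInner γ δ := by
    rw [← Finset.sum_neg_distrib]
    refine Finset.sum_congr rfl fun γ hγ => ?_
    rw [Finset.sum_union (hdisj h₂), Finset.sum_congr rfl (hpp γ hγ), Finset.sum_const_zero,
      zero_add, Finset.sum_congr rfl (hpm γ hγ), sum_rootsOfDegree_neg]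
    simp only [rootInner_negRoot_right, Finset.sum_neg_distrib]
  have s2 : ∑ γ ∈ rootsOfDegree κ (-ξ₁), ∑ δ ∈ rootsOfDegree κ ξ₂ ∪ rootsOfDegree κ (-ξ₂), T γ δ =
      -∑ γ ∈ rootsOfDegree κ ξ₁, ∑ δ ∈ rootsOfDegree κ ξ₂, rootInner γ δ := by
    have : ∀ γ ∈ rootsOfDegree κ (-ξ₁), ∑ δ ∈ rootsOfDegree κ ξ₂ ∪ rootsOfDegree κ (-ξ₂), T γ δ =
        ∑ δ ∈ rootsOfDegree κ ξ₂, rootInner γ δ := by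
      intro γ hγ
      rw [Finset.sum_union (hdisj h₂), Finset.sum_congr rfl (hmm γ hγ), Finset.sum_const_zero,
        add_zero, Finset.sum_congr rfl (hmp γ hγ)]
    rw [Finset.sum_congr rfl this, sum_rootsOfDegree_neg]
    simp only [rootInner_negRoot_left, Finset.sum_neg_distrib]
  rw [s1, s2]
  ring

end Summands

open Matrix

/-! ### Concrete models of root systems -/

/-- A finite set of integral vectors that realizes the root system with Cartan matrix `A`, together
with the matrix that gives the inner product induced by the Killing form. -/
structure RootModel (ℓ : ℕ) (A : Matrix (Fin ℓ) (Fin ℓ) ℤ) where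
  simple : Fin ℓ → Fin ℓ → ℤ
  cosimple : Fin ℓ → Fin ℓ → ℤ
  pairing : ∀ i j, simple i ⬝ᵥ cosimple j = A i j
  roots : Finset (Fin ℓ → ℤ)
  simple_mem : ∀ i, simple i ∈ roots
  neg_mem : ∀ v ∈ roots, -v ∈ roots
  reflect_mem : ∀ v ∈ roots, ∀ j, v - (v ⬝ᵥ cosimple j) • simple j ∈ roots
  -- Ensures that the model has no vectors besides those generated from the simple ones, so that
  -- every vector comes from a root.
  minimal : ∀ T : Set (Fin ℓ → ℤ), (∀ i, simple i ∈ T) → (∀ v ∈ T, -v ∈ T) →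
    (∀ v ∈ T, ∀ j, v - (v ⬝ᵥ cosimple j) • simple j ∈ T) → ∀ v ∈ roots, v ∈ T
  gram : Matrix (Fin ℓ) (Fin ℓ) ℤ
  scale : ℤ
  scale_ne : scale ≠ 0
  -- The counterpart of Σ_β (γ, β) β = γ, which determines the Killing inner product including its
  -- scale.
  moment : ∀ k m, ∑ v ∈ roots, (gram *ᵥ v) k * v m = if k = m then scale else 0

section Coordinates

variable {𝔤 : Type*} [LieRing 𝔤] [LieAlgebra ℝ 𝔤] [FiniteDimensional ℝ 𝔤] [IsCompactSemisimple 𝔤]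
  {𝔥 : LieSubalgebra ℝ 𝔤} [IsMaximalTorus 𝔥] (b : (roots 𝔥).Base) {ℓ : ℕ}
  (e : Fin ℓ ≃ b.support)

/-- The coefficients of a root with respect to the base. -/
def coeff (γ : (complexify 𝔥).root) (i : Fin ℓ) : ℤ :=
  (b.exists_root_eq_sum_int γ).choose (e i)

theorem root_eq_sum_coeff (γ : (complexify 𝔥).root) :
    (roots 𝔥).root γ = ∑ i, coeff b e γ i • (roots 𝔥).root (e i) := by
  have h := (b.exists_root_eq_sum_int γ).choose_spec.2.2
  rw [← Finset.sum_coe_sort, ← Equiv.sum_comp e] at h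
  exact h

theorem eq_coeff {γ : (complexify 𝔥).root} {c : Fin ℓ → ℤ}
    (h : (roots 𝔥).root γ = ∑ i, c i • (roots 𝔥).root (e i)) : c = coeff b e γ := by
  have hli : LinearIndependent ℤ fun i : Fin ℓ => (roots 𝔥).root (e i) :=
    ((b.linearIndepOn_root.restrict_scalars' ℤ).comp e e.injective)
  rw [root_eq_sum_coeff b e γ] at h
  funext i
  exact Fintype.linearIndependent_iffₛ.mp hli c (coeff b e γ) h.symm i

variable {A : Matrix (Fin ℓ) (Fin ℓ) ℤ} (R : RootModel ℓ A)

/-- The vector that a root system model assigns to a root. -/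
def vec (γ : (complexify 𝔥).root) : Fin ℓ → ℤ := ∑ i, coeff b e γ i • R.simple i

variable {b e}

theorem vec_eq_sum {γ : (complexify 𝔥).root} {c : Fin ℓ → ℤ}
    (h : (roots 𝔥).root γ = ∑ i, c i • (roots 𝔥).root (e i)) :
    vec b e R γ = ∑ i, c i • R.simple i := by
  rw [vec, eq_coeff b e h]

theorem vec_simple (i : Fin ℓ) : vec b e R (e i) = R.simple i := by
  rw [vec_eq_sum R (c := Pi.single i 1)]
  · simp [Pi.single_apply]
  · simp [Pi.single_apply]

theorem pairingIn_eq_dotProduct (he : IsNumbering b A e) (γ : (complexify 𝔥).root) (j : Fin ℓ) :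
    (roots 𝔥).pairingIn ℤ γ (e j) = vec b e R γ ⬝ᵥ R.cosimple j := by
  have h1 : (roots 𝔥).pairingIn ℤ γ (e j) =
      ∑ i, coeff b e γ i * (roots 𝔥).pairingIn ℤ (e i) (e j) := by
    apply FaithfulSMul.algebraMap_injective ℤ ℂ
    simp only [map_sum, map_mul, RootPairing.algebraMap_pairingIn,
      ← RootPairing.root_coroot_eq_pairing]
    conv_lhs => rw [root_eq_sum_coeff b e γ]
    simp
  have h2 : ∀ i, (roots 𝔥).pairingIn ℤ (e i) (e j) = A i j := fun i => he i j
  rw [h1, vec, sum_dotProduct]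
  simp only [h2, smul_dotProduct, R.pairing, smul_eq_mul]

/-- A root is determined by its pairings with the simple coroots, and the model computes these as
dot products. -/
theorem vec_injective (he : IsNumbering b A e) : Function.Injective (vec b e R) := by
  intro γ δ h
  apply b.injective_pairingIn
  funext k
  obtain ⟨j, rfl⟩ := e.surjective k
  simp only [pairingIn_eq_dotProduct R he, h]

theorem vec_negRoot (γ : (complexify 𝔥).root) : vec b e R (negRoot γ) = -vec b e R γ := by
  rw [vec_eq_sum R (c := -coeff b e γ), vec]
  · simp
  · have h : (roots 𝔥).root (negRoot γ) = -(roots 𝔥).root γ := rfl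
    rw [h, root_eq_sum_coeff b e γ]
    simp

theorem vec_reflectionPerm (he : IsNumbering b A e) (γ : (complexify 𝔥).root) (j : Fin ℓ) :
    vec b e R ((roots 𝔥).reflectionPerm (e j) γ) =
      vec b e R γ - (vec b e R γ ⬝ᵥ R.cosimple j) • R.simple j := by
  rw [vec_eq_sum R (c := coeff b e γ - (vec b e R γ ⬝ᵥ R.cosimple j) • Pi.single j 1)]
  · simp only [Pi.sub_apply, sub_smul, Finset.sum_sub_distrib]
    simp [vec, Pi.single_apply]
  · rw [RootPairing.root_reflectionPerm, RootPairing.reflection_apply_root' ℤ,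
      pairingIn_eq_dotProduct R he]
    simp only [Pi.sub_apply, sub_smul, Finset.sum_sub_distrib, ← root_eq_sum_coeff b e γ]
    simp [Pi.single_apply]

/-- Every root is reached from simple roots by simple reflections and negation, and the model is
closed under the corresponding operations. -/
theorem vec_mem (he : IsNumbering b A e) (γ : (complexify 𝔥).root) : vec b e R γ ∈ R.roots := by
  refine b.induction_reflect γ (p := fun γ => vec b e R γ ∈ R.roots) ?_ ?_ ?_
  · intro i hi
    have : (roots 𝔥).reflectionPerm i i = negRoot i := by
      apply (roots 𝔥).root.injective
      rw [RootPairing.root_reflectionPerm, RootPairing.reflection_apply_self]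
      rfl
    rw [this, vec_negRoot]
    exact R.neg_mem _ hi
  · intro i hi
    have := vec_simple (b := b) (e := e) R (e.symm ⟨i, hi⟩)
    rw [Equiv.apply_symm_apply] at this
    rw [this]
    exact R.simple_mem _
  · intro i j hi hj
    have := vec_reflectionPerm R he i (e.symm ⟨j, hj⟩)
    rw [Equiv.apply_symm_apply] at this
    rw [this]
    exact R.reflect_mem _ hi _

/-- The image of the roots contains the simple vectors and is closed under negation and simple
reflections, so minimality of the model applies to it. -/
theorem exists_vec_eq (he : IsNumbering b A e) {v : Fin ℓ → ℤ} (hv : v ∈ R.roots) :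
    ∃ γ, vec b e R γ = v := by
  refine R.minimal (Set.range (vec b e R)) (fun i => ⟨_, vec_simple R i⟩) ?_ ?_ v hv
  · rintro _ ⟨γ, rfl⟩
    exact ⟨_, vec_negRoot R γ⟩
  · rintro _ ⟨γ, rfl⟩ j
    exact ⟨_, vec_reflectionPerm R he γ j⟩

theorem sum_filter_vec (he : IsNumbering b A e) {N : Type*} [AddCommMonoid N]
    (P : (Fin ℓ → ℤ) → Prop) [DecidablePred P] (I : Finset (complexify 𝔥).root)
    (hI : ∀ γ, γ ∈ I ↔ P (vec b e R γ)) (f : (Fin ℓ → ℤ) → N) :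
    ∑ γ ∈ I, f (vec b e R γ) = ∑ v ∈ R.roots.filter P, f v := by
  refine Finset.sum_bij (fun γ _ => vec b e R γ) ?_ ?_ ?_ ?_
  · intro γ hγ
    exact Finset.mem_filter.2 ⟨vec_mem R he γ, (hI γ).1 hγ⟩
  · intro γ _ δ _ h
    exact vec_injective R he h
  · intro v hv
    rw [Finset.mem_filter] at hv
    obtain ⟨γ, rfl⟩ := exists_vec_eq R he hv.1
    exact ⟨γ, (hI γ).2 hv.2, rfl⟩
  · intro γ _; rfl

theorem sum_vec (he : IsNumbering b A e) {N : Type*} [AddCommMonoid N] (f : (Fin ℓ → ℤ) → N) :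
    ∑ γ, f (vec b e R γ) = ∑ v ∈ R.roots, f v := by
  rw [sum_filter_vec R he (fun _ => True) Finset.univ (by simp) f, Finset.filter_true]

/-- A root is the sum of all roots, weighted by their inner products with it. -/
theorem root_apply_eq_sum_rootInner (γ : (complexify 𝔥).root) (x : complexify 𝔥) :
    γ.1 x = ∑ β : (complexify 𝔥).root, rootInner γ β * β.1 x := by
  have h1 : cartanEquivDual (complexify 𝔥) ((cartanEquivDual (complexify 𝔥)).symm γ.1.toLinear) x =
      γ.1 x := by
    rw [LinearEquiv.apply_symm_apply, Weight.toLinear_apply]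
  -- On the Cartan subalgebra the Killing form is the sum of β ⊗ β over all roots β; it is evaluated
  -- at `x` and the element dual to γ.
  have h2 := LinearMap.congr_fun₂ (restrict_killingForm_eq_sum (H := complexify 𝔥))
    ((cartanEquivDual (complexify 𝔥)).symm γ.1.toLinear) x
  rw [← h1]
  refine Eq.trans (Eq.trans rfl h2) ?_
  rw [← Finset.sum_coe_sort]
  simp only [LinearMap.sum_apply, LinearMap.smulRight_apply, LinearMap.smul_apply, smul_eq_mul]
  rfl

/-- The inner product with γ is evaluation at the Cartan element dual to γ. Expanding this element
in simple coroots expresses it through dot products with `R.cosimple`. -/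
theorem exists_rootInner_eq_sum (he : IsNumbering b A e) (γ : (complexify 𝔥).root) :
    ∃ u : Fin ℓ → ℂ, ∀ δ, rootInner γ δ = ∑ k, u k * (vec b e R δ k : ℂ) := by
  set h := (cartanEquivDual (complexify 𝔥)).symm γ.1.toLinear with hh
  refine ⟨fun k => ∑ j, b.toCoweightBasis.repr h (e j) * (R.cosimple j k : ℂ), fun δ => ?_⟩
  have h1 : h = ∑ j, b.toCoweightBasis.repr h (e j) • (roots 𝔥).coroot (e j) := by
    conv_lhs => rw [← b.toCoweightBasis.sum_repr h, ← Equiv.sum_comp e]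
    simp
  have h2 : ∀ j, (roots 𝔥).root δ ((roots 𝔥).coroot (e j)) =
      ((vec b e R δ ⬝ᵥ R.cosimple j : ℤ) : ℂ) := by
    intro j
    rw [← pairingIn_eq_dotProduct R he]
    exact ((roots 𝔥).algebraMap_pairingIn ℤ δ (e j)).symm
  change (roots 𝔥).root δ h = _
  conv_lhs => rw [h1]
  rw [map_sum]
  simp only [map_smul, h2, smul_eq_mul, dotProduct, Int.cast_sum, Int.cast_mul, Finset.mul_sum,
    Finset.sum_mul]
  rw [Finset.sum_comm]
  exact Finset.sum_congr rfl fun k _ => Finset.sum_congr rfl fun j _ => by ring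

/-- Each coordinate of `vec` extends to a linear functional on the dual of the Cartan subalgebra;
apply it to γ = Σ_β (γ, β) β. -/
theorem vec_eq_sum_rootInner (γ : (complexify 𝔥).root) (m : Fin ℓ) :
    (vec b e R γ m : ℂ) = ∑ β, rootInner γ β * (vec b e R β m : ℂ) := by
  set Φ : Module.Dual ℂ (complexify 𝔥) →ₗ[ℂ] ℂ :=
    b.toWeightBasis.constr ℂ fun i => (R.simple (e.symm i) m : ℂ) with hΦ
  have hΦ1 : ∀ β, Φ ((roots 𝔥).root β) = (vec b e R β m : ℂ) := by
    intro β
    rw [root_eq_sum_coeff b e β, map_sum, vec]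
    simp only [map_zsmul, Finset.sum_apply, Int.cast_sum]
    refine Finset.sum_congr rfl fun i _ => ?_
    have : Φ ((roots 𝔥).root (e i)) = (R.simple i m : ℂ) := by
      rw [← b.toWeightBasis_apply, hΦ, Module.Basis.constr_basis, Equiv.symm_apply_apply]
    rw [this]
    simp
  have h : (roots 𝔥).root γ = ∑ β, rootInner γ β • (roots 𝔥).root β := by
    ext x
    rw [LinearMap.sum_apply]
    exact root_apply_eq_sum_rootInner γ x
  rw [← hΦ1, h, map_sum]
  simp only [map_smul, hΦ1, smul_eq_mul]

/-- Write (γ, β) = u · vec β and apply the Gram matrix to vec γ = Σ_β (γ, β) vec β. By `R.moment`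
the right side contracts to `R.scale` times u. -/
theorem scale_mul_rootInner (he : IsNumbering b A e) (γ δ : (complexify 𝔥).root) :
    (R.scale : ℂ) * rootInner γ δ = (((R.gram *ᵥ vec b e R γ) ⬝ᵥ vec b e R δ : ℤ) : ℂ) := by
  obtain ⟨u, hu⟩ := exists_rootInner_eq_sum R he γ
  have key : ∀ k, (R.scale : ℂ) * u k = ((R.gram *ᵥ vec b e R γ) k : ℂ) := by
    intro k
    have h1 : ((R.gram *ᵥ vec b e R γ) k : ℂ) =
        ∑ β, rootInner γ β * ((R.gram *ᵥ vec b e R β) k : ℂ) := by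
      simp only [mulVec, dotProduct, Int.cast_sum, Int.cast_mul]
      simp only [vec_eq_sum_rootInner R γ, Finset.mul_sum]
      rw [Finset.sum_comm]
      refine Finset.sum_congr rfl fun β _ => Finset.sum_congr rfl fun m _ => ?_
      ring
    rw [h1]
    simp only [hu, Finset.sum_mul]
    rw [Finset.sum_comm]
    have h2 : ∀ m, ∑ β, u m * (vec b e R β m : ℂ) * ((R.gram *ᵥ vec b e R β) k : ℂ) =
        u m * (if k = m then (R.scale : ℂ) else 0) := by
      intro m
      have h3 := congrArg (Int.cast : ℤ → ℂ) (R.moment k m)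
      rw [← sum_vec R he (fun v => (R.gram *ᵥ v) k * v m)] at h3
      push_cast at h3
      rw [← h3, Finset.mul_sum]
      exact Finset.sum_congr rfl fun β _ => by ring
    simp only [h2, mul_ite, mul_zero, Finset.sum_ite_eq, Finset.mem_univ, if_true, mul_comm]
  rw [hu, Finset.mul_sum, dotProduct]
  push_cast
  exact Finset.sum_congr rfl fun k _ => by rw [← key]; ring

/-! ### The degrees of the roots -/

variable (b e) in
/-- The `𝔱`-root with given coordinates with respect to the restrictions of `α` and `β`. -/
def tRoot (α β : (complexify 𝔥).root) : ℤ × ℤ →+ Module.Dual ℂ (centre b {α, β}) where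
  toFun n := n.1 • kappa b {α, β} α + n.2 • kappa b {α, β} β
  map_zero' := by simp
  map_add' m n := by simp only [Prod.fst_add, Prod.snd_add, add_smul]; abel

theorem tRoot_apply (α β : (complexify 𝔥).root) (n : ℤ × ℤ) :
    tRoot b α β n = n.1 • kappa b {α, β} α + n.2 • kappa b {α, β} β := rfl

variable (e) in
theorem kappa_eq_sum (black : Set (complexify 𝔥).root) (γ : (complexify 𝔥).root) :
    kappa b black γ = ∑ i, coeff b e γ i • kappa b black (e i) := by
  have := congrArg (restrictCentre b black) (root_eq_sum_coeff b e γ)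
  rw [map_sum] at this
  simp only [map_zsmul] at this
  exact this

theorem kappa_eq_zero {black : Set (complexify 𝔥).root} {i : (complexify 𝔥).root}
    (hi : i ∈ b.support) (hb : i ∉ black) : kappa b black i = 0 :=
  kappa_eq_zero_of_mem b black (Submodule.subset_span ⟨i, ⟨hi, hb⟩, rfl⟩)

set_option maxHeartbeats 1600000 in
-- Simple roots outside Π_M restrict to zero, so only the coefficients at `p` and `q` survive.
theorem kappa_eq_tRoot {α β : (complexify 𝔥).root} {p q : Fin ℓ} (hpq : p ≠ q)
    (hα : (e p : (complexify 𝔥).root) = α) (hβ : (e q : (complexify 𝔥).root) = β)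
    (γ : (complexify 𝔥).root) :
    kappa b {α, β} γ = tRoot b α β (coeff b e γ p, coeff b e γ q) := by
  have h : ∀ i ∉ ({p, q} : Finset (Fin ℓ)), kappa b {α, β} (e i) = 0 := by
    intro i hi
    simp only [Finset.mem_insert, Finset.mem_singleton, not_or] at hi
    refine kappa_eq_zero (e i).2 ?_
    rintro (h | h)
    · exact hi.1 (e.injective (Subtype.ext (h.trans hα.symm)))
    · exact hi.2 (e.injective (Subtype.ext (h.trans hβ.symm)))
  have h2 : ∑ i ∈ ({p, q} : Finset (Fin ℓ)), coeff b e γ i • kappa b {α, β} (e i) =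
      ∑ i, coeff b e γ i • kappa b {α, β} (e i) :=
    Finset.sum_subset (Finset.subset_univ _) fun i _ hi => by rw [h i hi, smul_zero]
  have h3 : kappa b {α, β} γ =
      coeff b e γ p • kappa b {α, β} (e p) + coeff b e γ q • kappa b {α, β} (e q) := by
    rw [kappa_eq_sum e, ← h2, Finset.sum_pair hpq]
  rw [hα, hβ] at h3
  exact h3

/-- The fundamental coweight of a black simple root kills all other simple roots, in particular Π_K,
and so lies in the centre. These coweights show that the restrictions of the black simple roots are
independent. -/
theorem exists_coweight {i : (complexify 𝔥).root} (hi : i ∈ b.support)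
    {black : Set (complexify 𝔥).root} (hb : i ∈ black) :
    ∃ y : centre b black, kappa b black i y = 1 ∧
      ∀ j ∈ b.support, j ≠ i → kappa b black j y = 0 := by
  classical
  set y := (Module.evalEquiv ℂ (complexify 𝔥)).symm (b.toWeightBasis.coord ⟨i, hi⟩) with hy
  have h1 : ∀ f : Module.Dual ℂ (complexify 𝔥), f y = b.toWeightBasis.coord ⟨i, hi⟩ f := by
    intro f
    rw [hy, Module.apply_evalEquiv_symm_apply]
  have h2 : ∀ j ∈ b.support, (roots 𝔥).root j y = if j = i then 1 else 0 := by
    intro j hj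
    rw [h1, Module.Basis.coord_apply, ← b.toWeightBasis_apply ⟨j, hj⟩, Module.Basis.repr_self,
      Finsupp.single_apply]
    simp only [Subtype.mk.injEq]
  have hmem : y ∈ centre b black := by
    simp only [centre, Submodule.mem_iInf, LinearMap.mem_ker]
    intro φ hφ
    have : ∀ f ∈ Submodule.span ℤ ((roots 𝔥).root '' ((b.support : Set _) \ black)), f y = 0 := by
      intro f hf
      induction hf using Submodule.span_induction with
      | zero => exact LinearMap.zero_apply y
      | add f g _ _ hf hg => rw [LinearMap.add_apply, hf, hg, add_zero]
      | smul c f _ hf => rw [LinearMap.smul_apply, hf, smul_zero]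
      | mem f hf =>
        obtain ⟨j, hj, rfl⟩ := hf
        rw [h2 j hj.1, if_neg]
        rintro rfl
        exact hj.2 hb
    exact this _ hφ
  refine ⟨⟨y, hmem⟩, (h2 i hi).trans (if_pos rfl), fun j hj hji => (h2 j hj).trans (if_neg hji)⟩

theorem tRoot_injective {α β : (complexify 𝔥).root} (hα : α ∈ b.support) (hβ : β ∈ b.support)
    (hne : α ≠ β) : Function.Injective (tRoot b α β) := by
  rw [injective_iff_map_eq_zero]
  rintro ⟨m, n⟩ h
  rw [tRoot_apply] at h
  obtain ⟨y, hy, hy'⟩ := exists_coweight hα (Set.mem_insert α {β})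
  obtain ⟨z, hz, hz'⟩ := exists_coweight hβ (Set.mem_insert_of_mem α (Set.mem_singleton β))
  have h1 := LinearMap.congr_fun h y
  have h2 := LinearMap.congr_fun h z
  rw [LinearMap.add_apply, LinearMap.smul_apply, LinearMap.smul_apply, LinearMap.zero_apply] at h1 h2
  rw [hy, hy' _ hβ hne.symm, smul_zero, add_zero, zsmul_eq_mul, mul_one] at h1
  rw [hz, hz' _ hα hne, smul_zero, zero_add, zsmul_eq_mul, mul_one] at h2
  exact Prod.ext (Int.cast_eq_zero.1 h1) (Int.cast_eq_zero.1 h2)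

end Coordinates

/-! ### The numbers `[ijk]` in terms of a model of the root system -/

section Model

variable {𝔤 : Type*} [LieRing 𝔤] [LieAlgebra ℝ 𝔤] [FiniteDimensional ℝ 𝔤] [IsCompactSemisimple 𝔤]
  {𝔥 : LieSubalgebra ℝ 𝔤} [IsMaximalTorus 𝔥] {b : (roots 𝔥).Base} {ℓ : ℕ}
  {e : Fin ℓ ≃ b.support} {A : Matrix (Fin ℓ) (Fin ℓ) ℤ} (R : RootModel ℓ A)

/-- `deg` computes the coefficients of the simple roots number `p` and `q`. -/
def RootModel.IsDegree (deg : (Fin ℓ → ℤ) → ℤ × ℤ) (p q : Fin ℓ) : Prop :=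
  ∀ c : Fin ℓ → ℤ, deg (∑ i, c i • R.simple i) = (c p, c q)

/-- The sum of the inner products of the roots of degree `d₁` with those of degree `d₂`. -/
def RootModel.innerSum (deg : (Fin ℓ → ℤ) → ℤ × ℤ) (d₁ d₂ : ℤ × ℤ) : ℤ :=
  ∑ v ∈ R.roots with deg v = d₁, ∑ w ∈ R.roots with deg w = d₂, (R.gram *ᵥ v) ⬝ᵥ w

variable {R} {deg : (Fin ℓ → ℤ) → ℤ × ℤ} {α β : (complexify 𝔥).root} {p q : Fin ℓ}

theorem kappa_eq_tRoot_deg (hdeg : R.IsDegree deg p q) (hpq : p ≠ q)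
    (hα : (e p : (complexify 𝔥).root) = α) (hβ : (e q : (complexify 𝔥).root) = β)
    (γ : (complexify 𝔥).root) : kappa b {α, β} γ = tRoot b α β (deg (vec b e R γ)) := by
  rw [kappa_eq_tRoot hpq hα hβ, vec, hdeg]

theorem tRoot_injective' (hpq : p ≠ q) (hα : (e p : (complexify 𝔥).root) = α)
    (hβ : (e q : (complexify 𝔥).root) = β) : Function.Injective (tRoot b α β) :=
  tRoot_injective (hα ▸ (e p).2) (hβ ▸ (e q).2) fun h =>
    hpq (e.injective (Subtype.ext (hα.trans (h.trans hβ.symm))))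

theorem scale_mul_sum_rootInner (he : IsNumbering b A e) {d₁ d₂ : ℤ × ℤ}
    {I J : Finset (complexify 𝔥).root} (hI : ∀ γ, γ ∈ I ↔ deg (vec b e R γ) = d₁)
    (hJ : ∀ γ, γ ∈ J ↔ deg (vec b e R γ) = d₂) :
    (R.scale : ℂ) * ∑ γ ∈ I, ∑ δ ∈ J, rootInner γ δ = (R.innerSum deg d₁ d₂ : ℂ) := by
  have h : R.innerSum deg d₁ d₂ =
      ∑ γ ∈ I, ∑ δ ∈ J, (R.gram *ᵥ vec b e R γ) ⬝ᵥ vec b e R δ := by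
    unfold RootModel.innerSum
    rw [← sum_filter_vec R he (fun v => deg v = d₁) I hI
      (fun v => ∑ w ∈ R.roots with deg w = d₂, (R.gram *ᵥ v) ⬝ᵥ w)]
    refine Finset.sum_congr rfl fun γ _ => ?_
    exact (sum_filter_vec R he (fun v => deg v = d₂) J hJ
      (fun w => (R.gram *ᵥ vec b e R γ) ⬝ᵥ w)).symm
  rw [h, Int.cast_sum, Finset.mul_sum]
  refine Finset.sum_congr rfl fun γ _ => ?_
  rw [Int.cast_sum, Finset.mul_sum]
  exact Finset.sum_congr rfl fun δ _ => scale_mul_rootInner R he γ δ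

theorem mem_rootsOfDegree_tRoot (hdeg : R.IsDegree deg p q) (hpq : p ≠ q)
    (hα : (e p : (complexify 𝔥).root) = α) (hβ : (e q : (complexify 𝔥).root) = β)
    (d : ℤ × ℤ) (γ : (complexify 𝔥).root) :
    γ ∈ rootsOfDegree (restrictCentre b {α, β}) (tRoot b α β d) ↔ deg (vec b e R γ) = d := by
  rw [mem_rootsOfDegree, restrictCentre_eq_kappa, kappa_eq_tRoot_deg hdeg hpq hα hβ,
    (tRoot_injective' hpq hα hβ).eq_iff]

theorem triple_eq_of_model (he : IsNumbering b A e) (hdeg : R.IsDegree deg p q) (hpq : p ≠ q)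
    (hα : (e p : (complexify 𝔥).root) = α) (hβ : (e q : (complexify 𝔥).root) = β)
    {d₁ d₂ d₃ : ℤ × ℤ} (h₁ : d₁ ≠ 0) (h₂ : d₂ ≠ 0) (h₃ : d₃ ≠ 0) (hsum : d₂ = d₁ + d₃)
    (hne : d₁ + d₂ ≠ 0) (hno : ∀ v ∈ R.roots, deg v ≠ d₁ + d₂) {x : ℝ}
    (hx : (R.scale : ℝ) * x = 2 * (R.innerSum deg d₁ d₂ : ℝ)) {k m n : ℕ}
    {X : Module.Basis (Fin k) ℝ (realSummand b {α, β} (tRoot b α β d₁))}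
    {Y : Module.Basis (Fin m) ℝ (realSummand b {α, β} (tRoot b α β d₂))}
    {Z : Module.Basis (Fin n) ℝ (realSummand b {α, β} (tRoot b α β d₃))}
    (hX : IsOrthonormalBasis X) (hY : IsOrthonormalBasis Y) (hZ : IsOrthonormalBasis Z) :
    triple X Y Z = x := by
  have hinj := tRoot_injective' (b := b) hpq hα hβ
  have hz : ∀ {d : ℤ × ℤ}, d ≠ 0 → tRoot b α β d ≠ 0 := fun hd h =>
    hd (hinj (h.trans (map_zero _).symm))
  have hκ := kappa_eq_tRoot_deg (b := b) hdeg hpq hα hβ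
  have h := triple_eq_two_mul_sum (hz h₁) (hz h₂) (hz h₃) (by rw [hsum, map_add])
    (by rw [← map_add]; exact hz hne)
    (fun γ => by
      rw [hκ, ← map_add]
      exact fun h => hno _ (vec_mem R he γ) (hinj h)) hX hY hZ
  have hs := scale_mul_sum_rootInner (R := R) he (mem_rootsOfDegree_tRoot hdeg hpq hα hβ d₁)
    (mem_rootsOfDegree_tRoot hdeg hpq hα hβ d₂)
  have h0 : (R.scale : ℝ) ≠ 0 := Int.cast_ne_zero.2 R.scale_ne
  apply mul_left_cancel₀ h0
  rw [hx]
  apply Complex.ofReal_injective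
  rw [Complex.ofReal_mul, h, mul_left_comm]
  push_cast
  rw [hs]

theorem triple_eq_zero_of_model (hpq : p ≠ q) (hα : (e p : (complexify 𝔥).root) = α)
    (hβ : (e q : (complexify 𝔥).root) = β) {d₁ d₂ d₃ : ℤ × ℤ}
    (h₁ : d₁ ≠ 0) (h₂ : d₂ ≠ 0) (h₃ : d₃ ≠ 0) (hpp : d₁ + d₂ + d₃ ≠ 0)
    (hpm : d₁ + d₂ - d₃ ≠ 0) (hmp : d₁ - d₂ + d₃ ≠ 0) (hmm : d₁ - d₂ - d₃ ≠ 0) {k m n : ℕ}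
    {X : Module.Basis (Fin k) ℝ (realSummand b {α, β} (tRoot b α β d₁))}
    {Y : Module.Basis (Fin m) ℝ (realSummand b {α, β} (tRoot b α β d₂))}
    {Z : Module.Basis (Fin n) ℝ (realSummand b {α, β} (tRoot b α β d₃))}
    (hX : IsOrthonormalBasis X) (hY : IsOrthonormalBasis Y) (hZ : IsOrthonormalBasis Z) :
    triple X Y Z = 0 := by
  have hinj := tRoot_injective' (b := b) hpq hα hβ
  have hz : ∀ {d : ℤ × ℤ}, d ≠ 0 → tRoot b α β d ≠ 0 := fun hd h =>
    hd (hinj (h.trans (map_zero _).symm))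
  refine triple_eq_zero (hz h₁) (hz h₂) (hz h₃) ?_ ?_ ?_ ?_ hX hY hZ
  · rw [← map_add, ← map_add]; exact hz hpp
  · rw [← map_add, ← map_sub]; exact hz hpm
  · rw [← map_sub, ← map_add]; exact hz hmp
  · rw [← map_sub, ← map_sub]; exact hz hmm

theorem eq_of_multiset_eq {T : Type*} (t : Fin 4 → Fin 4 → Fin 4 → T)
    (hl : ∀ i j k, t i j k = t j i k) (hr : ∀ i j k, t i j k = t i k j) {i j k i' j' k' : Fin 4}
    (h : ({i, j, k} : Multiset (Fin 4)) = {i', j', k'}) : t i j k = t i' j' k' := by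
  have key : ∀ i j k i' j' k' : Fin 4, ({i, j, k} : Multiset (Fin 4)) = {i', j', k'} →
      (i, j, k) = (i', j', k') ∨ (i, j, k) = (i', k', j') ∨ (i, j, k) = (j', i', k') ∨
      (i, j, k) = (j', k', i') ∨ (i, j, k) = (k', i', j') ∨ (i, j, k) = (k', j', i') := by
    decide +kernel
  rcases key _ _ _ _ _ _ h with h | h | h | h | h | h <;>
    simp only [Prod.mk.injEq] at h <;> obtain ⟨rfl, rfl, rfl⟩ := h
  · rfl
  · exact hr _ _ _
  · exact hl _ _ _
  · rw [hr, hl]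
  · rw [hl, hr]
  · rw [hl, hr, hl]

/-- The degrees of the four isotropy summands for type IIa. -/
def degreesIIa : Fin 4 → ℤ × ℤ := ![(1, 0), (0, 1), (1, 1), (1, 2)]

/-- The degrees of the four isotropy summands for type IIb. -/
def degreesIIb : Fin 4 → ℤ × ℤ := ![(1, 0), (0, 1), (1, 1), (2, 1)]

variable (b α β) in
theorem summandsIIa_eq :
    summandsIIa b α β = fun i => realSummand b {α, β} (tRoot b α β (degreesIIa i)) := by
  funext i
  have h2 : (2 : ℂ) • kappa b {α, β} β = (2 : ℤ) • kappa b {α, β} β := by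
    rw [two_smul, two_smul]
  fin_cases i <;> simp [summandsIIa, degreesIIa, tRoot_apply, h2]

variable (b α β) in
theorem summandsIIb_eq :
    summandsIIb b α β = fun i => realSummand b {α, β} (tRoot b α β (degreesIIb i)) := by
  funext i
  have h2 : (2 : ℂ) • kappa b {α, β} α = (2 : ℤ) • kappa b {α, β} α := by
    rw [two_smul, two_smul]
  fin_cases i <;> simp [summandsIIb, degreesIIb, tRoot_apply, h2]

theorem hasNonzeroTriplesIIa_of_model (he : IsNumbering b A e) (hdeg : R.IsDegree deg p q)
    (hpq : p ≠ q) (hα : (e p : (complexify 𝔥).root) = α) (hβ : (e q : (complexify 𝔥).root) = β)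
    (h21 : ∀ v ∈ R.roots, deg v ≠ (2, 1)) (h13 : ∀ v ∈ R.roots, deg v ≠ (1, 3)) {x y : ℝ}
    (hx0 : x ≠ 0) (hy0 : y ≠ 0)
    (hx : (R.scale : ℝ) * x = 2 * (R.innerSum deg (1, 0) (1, 1) : ℝ))
    (hy : (R.scale : ℝ) * y = 2 * (R.innerSum deg (0, 1) (1, 2) : ℝ)) :
    HasNonzeroTriplesIIa (summandsIIa b α β) x y := by
  refine ⟨hx0, hy0, ?_⟩
  rw [summandsIIa_eq]
  intro d X hX i j k
  set t : Fin 4 → Fin 4 → Fin 4 → ℝ := fun i j k => triple (X i) (X j) (X k) with ht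
  have hl : ∀ i j k, t i j k = t j i k := fun _ _ _ => triple_swap_left _ _ _
  have hr : ∀ i j k, t i j k = t i k j := fun _ _ _ => triple_swap_right _ _ _
  change t i j k = _
  beta_reduce
  -- A finite check on integer degrees: no signed sum vanishes outside the two listed triples.
  have hd : ∀ i j k : Fin 4, ({i, j, k} : Multiset (Fin 4)) ≠ {0, 1, 2} →
      ({i, j, k} : Multiset (Fin 4)) ≠ {1, 2, 3} →
      degreesIIa i + degreesIIa j + degreesIIa k ≠ 0 ∧
      degreesIIa i + degreesIIa j - degreesIIa k ≠ 0 ∧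
      degreesIIa i - degreesIIa j + degreesIIa k ≠ 0 ∧
      degreesIIa i - degreesIIa j - degreesIIa k ≠ 0 := by
    decide +kernel
  have hd0 : ∀ i, degreesIIa i ≠ 0 := by decide
  split_ifs with h1 h2
  -- The middle summand must have the sum of the outer degrees: (1,1) = (1,0) + (0,1), and (1,0) +
  -- (1,1) = (2,1) is excluded by `h21`. The next case uses (1,2) = (0,1) + (1,1), with (0,1) +
  -- (1,2) = (1,3) excluded.
  · rw [eq_of_multiset_eq t hl hr (h1.trans (by decide : _ = ({0, 2, 1} : Multiset (Fin 4))))]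
    exact triple_eq_of_model he hdeg hpq hα hβ (hd0 0) (hd0 2) (hd0 1) (by decide) (by decide)
      h21 hx (hX 0) (hX 2) (hX 1)
  · rw [eq_of_multiset_eq t hl hr (h2.trans (by decide : _ = ({1, 3, 2} : Multiset (Fin 4))))]
    exact triple_eq_of_model he hdeg hpq hα hβ (hd0 1) (hd0 3) (hd0 2) (by decide) (by decide)
      h13 hy (hX 1) (hX 3) (hX 2)
  · obtain ⟨a, b, c, d⟩ := hd i j k h1 h2
    exact triple_eq_zero_of_model hpq hα hβ (hd0 i) (hd0 j) (hd0 k) a b c d (hX i) (hX j) (hX k)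

theorem hasNonzeroTriplesIIb_of_model (he : IsNumbering b A e) (hdeg : R.IsDegree deg p q)
    (hpq : p ≠ q) (hα : (e p : (complexify 𝔥).root) = α) (hβ : (e q : (complexify 𝔥).root) = β)
    (h12 : ∀ v ∈ R.roots, deg v ≠ (1, 2)) (h31 : ∀ v ∈ R.roots, deg v ≠ (3, 1)) {x y : ℝ}
    (hx0 : x ≠ 0) (hy0 : y ≠ 0)
    (hx : (R.scale : ℝ) * x = 2 * (R.innerSum deg (0, 1) (1, 1) : ℝ))
    (hy : (R.scale : ℝ) * y = 2 * (R.innerSum deg (1, 0) (2, 1) : ℝ)) :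
    HasNonzeroTriplesIIb (summandsIIb b α β) x y := by
  refine ⟨hx0, hy0, ?_⟩
  rw [summandsIIb_eq]
  intro d X hX i j k
  set t : Fin 4 → Fin 4 → Fin 4 → ℝ := fun i j k => triple (X i) (X j) (X k) with ht
  have hl : ∀ i j k, t i j k = t j i k := fun _ _ _ => triple_swap_left _ _ _
  have hr : ∀ i j k, t i j k = t i k j := fun _ _ _ => triple_swap_right _ _ _
  change t i j k = _
  beta_reduce
  have hd : ∀ i j k : Fin 4, ({i, j, k} : Multiset (Fin 4)) ≠ {0, 1, 2} →
      ({i, j, k} : Multiset (Fin 4)) ≠ {0, 2, 3} →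
      degreesIIb i + degreesIIb j + degreesIIb k ≠ 0 ∧
      degreesIIb i + degreesIIb j - degreesIIb k ≠ 0 ∧
      degreesIIb i - degreesIIb j + degreesIIb k ≠ 0 ∧
      degreesIIb i - degreesIIb j - degreesIIb k ≠ 0 := by
    decide +kernel
  have hd0 : ∀ i, degreesIIb i ≠ 0 := by decide
  split_ifs with h1 h2
  -- Here (1,1) = (0,1) + (1,0) with (1,2) excluded; in the next case (2,1) = (1,0) + (1,1) with
  -- (3,1) excluded.
  · rw [eq_of_multiset_eq t hl hr (h1.trans (by decide : _ = ({1, 2, 0} : Multiset (Fin 4))))]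
    exact triple_eq_of_model he hdeg hpq hα hβ (hd0 1) (hd0 2) (hd0 0) (by decide) (by decide)
      h12 hx (hX 1) (hX 2) (hX 0)
  · rw [eq_of_multiset_eq t hl hr (h2.trans (by decide : _ = ({0, 3, 2} : Multiset (Fin 4))))]
    exact triple_eq_of_model he hdeg hpq hα hβ (hd0 0) (hd0 3) (hd0 2) (by decide) (by decide)
      h31 hy (hX 0) (hX 3) (hX 2)
  · obtain ⟨a, b, c, d⟩ := hd i j k h1 h2
    exact triple_eq_zero_of_model hpq hα hβ (hd0 i) (hd0 j) (hd0 k) a b c d (hX i) (hX j) (hX k)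

end Model

/-! ### The exceptional root systems `E₆` and `E₇` -/

section SimplyLaced

/-- The vector whose coordinates are the decimal digits of `k`, the units first. -/
def digitVector (n k : ℕ) : Fin n → ℤ := fun i => ((k / 10 ^ (i : ℕ) % 10 : ℕ) : ℤ)

/-- The set `{v, -v : v ∈ P}`. -/
def withNegatives {n : ℕ} (P : List (Fin n → ℤ)) : Finset (Fin n → ℤ) :=
  (P ++ P.map fun v => -v).toFinset

variable {n : ℕ} {P : List (Fin n → ℤ)}

theorem mem_withNegatives {v : Fin n → ℤ} : v ∈ withNegatives P ↔ v ∈ P ∨ -v ∈ P := by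
  simp [withNegatives, neg_eq_iff_eq_neg]

theorem nodup_append_neg (hP : P.Nodup) (hpos : ∀ v ∈ P, 0 < ∑ i, v i) :
    (P ++ P.map fun v => -v).Nodup := by
  refine hP.append (hP.map neg_injective) fun v hv hv' => ?_
  obtain ⟨w, hw, rfl⟩ := List.mem_map.1 hv'
  have h1 := hpos _ hv
  have h2 := hpos _ hw
  simp only [Pi.neg_apply, Finset.sum_neg_distrib] at h1
  omega

theorem sum_withNegatives (hP : P.Nodup) (hpos : ∀ v ∈ P, 0 < ∑ i, v i) (f : (Fin n → ℤ) → ℤ) :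
    ∑ v ∈ withNegatives P, f v = (P.map f).sum + (P.map fun v => f (-v)).sum := by
  rw [withNegatives, List.sum_toFinset f (nodup_append_neg hP hpos), List.map_append,
    List.sum_append, List.map_map]
  rfl

/-- The model of a simply laced root system in the coordinates with respect to the base. Here `P`
is the list of the positive roots. -/
def simplyLacedModel (A : Matrix (Fin n) (Fin n) ℤ) (P : List (Fin n → ℤ)) (s : ℤ) (hs : s ≠ 0)
    (hdiag : ∀ i, A i i = 2) (hP : P.Nodup) (hpos : ∀ v ∈ P, 0 < ∑ i, v i)
    (hsimple : ∀ i, Pi.single i 1 ∈ P)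
    (hreflect : ∀ v ∈ P, ∀ j, v = Pi.single j 1 ∨
      v - (∑ i, v i * A i j) • Pi.single j 1 ∈ P)
    (hheight : ∀ v ∈ P, ∃ j, 0 < ∑ i, v i * A i j)
    (hmoment : ∀ k m, (P.map fun v => (∑ i, A k i * v i) * v m).sum * 2 = if k = m then s else 0) :
    RootModel n A where
  simple i := Pi.single i 1
  cosimple j i := A i j
  pairing i j := by simp
  roots := withNegatives P
  simple_mem i := mem_withNegatives.2 (Or.inl (hsimple i))
  neg_mem v hv := by
    rw [mem_withNegatives] at hv ⊢
    rw [neg_neg]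
    exact hv.symm
  reflect_mem := by
    have key : ∀ v ∈ P, ∀ j, v - (v ⬝ᵥ fun i => A i j) • Pi.single j 1 ∈ withNegatives P := by
      intro v hv j
      rcases hreflect v hv j with rfl | h
      · rw [mem_withNegatives]
        right
        simpa [hdiag, two_smul] using hsimple j
      · exact mem_withNegatives.2 (Or.inl h)
    intro v hv j
    rcases mem_withNegatives.1 hv with hv | hv
    · exact key v hv j
    · have h := key _ hv j
      rw [mem_withNegatives] at h ⊢
      rw [or_comm]
      convert h using 2 <;> simp only [neg_dotProduct, neg_smul] <;> abel
  minimal T h1 h2 h3 := by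
    -- Induction on the height: a positive root pairs positively with some simple coroot. Unless it
    -- is that simple root, reflecting it gives a lower positive root, and reflecting back recovers
    -- it.
    have key : ∀ (N : ℕ) (v : Fin n → ℤ), v ∈ P → (∑ i, v i).toNat ≤ N → v ∈ T := by
      intro N
      induction N with
      | zero =>
        intro v hv hN
        have := hpos v hv
        omega
      | succ N ih =>
        intro v hv hN
        obtain ⟨j, hj⟩ := hheight v hv
        rcases hreflect v hv j with rfl | h
        · exact h1 j
        · have hw := h3 _ (ih _ h ?_) j
          · convert hw using 1
            have : (v - (∑ i, v i * A i j) • Pi.single j 1) ⬝ᵥ (fun i => A i j) =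
                -∑ i, v i * A i j := by
              rw [sub_dotProduct, smul_dotProduct, single_dotProduct, hdiag, dotProduct,
                smul_eq_mul]
              ring
            rw [this, neg_smul]
            abel
          · have : ∑ i, (v - (∑ i, v i * A i j) • Pi.single j 1 : Fin n → ℤ) i =
                ∑ i, v i - ∑ i, v i * A i j := by
              simp [Finset.sum_sub_distrib, Pi.single_apply]
            have := hpos _ h
            omega
    intro v hv
    rcases mem_withNegatives.1 hv with hv | hv
    · exact key _ v hv le_rfl
    · exact neg_neg v ▸ h2 _ (key _ _ hv le_rfl)
  gram := A
  scale := s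
  scale_ne := hs
  moment k m := by
    rw [sum_withNegatives hP hpos, ← hmoment k m]
    simp only [mulVec, dotProduct, Pi.neg_apply, mul_neg, Finset.sum_neg_distrib, neg_mul, neg_neg]
    ring

theorem isDegree_of_simple_eq_single {A : Matrix (Fin n) (Fin n) ℤ} {R : RootModel n A}
    (h : ∀ i, R.simple i = Pi.single i 1) (p q : Fin n) :
    R.IsDegree (fun v => (v p, v q)) p q := by
  intro c
  simp [h, Pi.single_apply]

end SimplyLaced

/-- The positive roots of `E₆`. -/
def positiveE₆ : List (Fin 6 → ℤ) :=
  [100000, 10000, 1000, 100, 10, 1, 110000, 11000, 1100, 1010, 101, 111000, 11100, 11010, 1110,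
    1101, 111100, 111010, 11110, 11101, 1111, 111110, 12110, 111101, 11111, 112110, 111111,
    12111, 122110, 112111, 12211, 122111, 112211, 122211, 123211, 123221].map (digitVector 6)

/-- The positive roots of `E₇`. -/
def positiveE₇ : List (Fin 7 → ℤ) :=
  [1000000, 100000, 10000, 1000, 100, 10, 1, 1100000, 110000, 11000, 1100, 1010, 101, 1110000,
    111000, 11100, 11010, 1110, 1101, 1111000, 111100, 111010, 11110, 11101, 1111, 1111100,
    1111010, 111110, 12110, 111101, 11111, 1111110, 112110, 1111101, 111111, 12111, 1112110,
    122110, 1111111, 112111, 12211, 1122110, 1112111, 122111, 112211, 1222110, 1122111, 1112211,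
    122211, 1222111, 1122211, 123211, 1222211, 1123211, 123221, 1223211, 1123221, 1233211,
    1223221, 1233221, 1234221, 1234321, 1234322].map (digitVector 7)

/-- The root system `E₆`. -/
def modelE₆ : RootModel 6 CartanMatrix.E₆ :=
  -- The scale is twice the Coxeter number: 24 = 2 · 12 here and 36 = 2 · 18 for E₇.
  simplyLacedModel CartanMatrix.E₆ positiveE₆ 24 (by decide) (by decide +kernel)
    (by decide +kernel) (by decide +kernel) (by decide +kernel) (by decide +kernel)
    (by decide +kernel) (by decide +kernel)

/-- The root system `E₇`. -/
def modelE₇ : RootModel 7 CartanMatrix.E₇ :=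
  simplyLacedModel CartanMatrix.E₇ positiveE₇ 36 (by decide) (by decide +kernel)
    (by decide +kernel) (by decide +kernel) (by decide +kernel) (by decide +kernel)
    (by decide +kernel) (by decide +kernel)

theorem innerSum_modelE₆ :
    modelE₆.innerSum (fun v => (v 0, v 2)) (1, 0) (1, 1) = 10 ∧
      modelE₆.innerSum (fun v => (v 0, v 2)) (0, 1) (1, 2) = 30 := by
  decide +kernel

theorem innerSum_modelE₇ :
    modelE₇.innerSum (fun v => (v 6, v 5)) (1, 0) (1, 1) = 16 ∧
      modelE₇.innerSum (fun v => (v 6, v 5)) (0, 1) (1, 2) = 80 := by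
  decide +kernel

/-! ### The values of [ijk] for E₆ and E₇ -/

section

variable {𝔤 : Type*} [LieRing 𝔤] [LieAlgebra ℝ 𝔤] [FiniteDimensional ℝ 𝔤] [IsCompactSemisimple 𝔤]
  {𝔥 : LieSubalgebra ℝ 𝔤} [IsMaximalTorus 𝔥] {b : (roots 𝔥).Base}

theorem hasNonzeroTriplesIIa_E₆ {e : Fin 6 ≃ b.support} (he : IsNumbering b CartanMatrix.E₆ e) :
    HasNonzeroTriplesIIa (summandsIIa b (e 0) (e 2)) (5 / 6) (5 / 2) := by
  have hs : (modelE₆.scale : ℝ) = 24 := by norm_num [modelE₆, simplyLacedModel]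
  refine hasNonzeroTriplesIIa_of_model (R := modelE₆) he
    (isDegree_of_simple_eq_single (fun _ => rfl) 0 2) (by decide) rfl rfl
    (by decide +kernel) (by decide +kernel) (by norm_num) (by norm_num) ?_ ?_
  · rw [innerSum_modelE₆.1, hs]; norm_num
  · rw [innerSum_modelE₆.2, hs]; norm_num

theorem hasNonzeroTriplesIIa_E₇ {e : Fin 7 ≃ b.support} (he : IsNumbering b CartanMatrix.E₇ e) :
    HasNonzeroTriplesIIa (summandsIIa b (e 6) (e 5)) (8 / 9) (40 / 9) := by
  have hs : (modelE₇.scale : ℝ) = 36 := by norm_num [modelE₇, simplyLacedModel]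
  refine hasNonzeroTriplesIIa_of_model (R := modelE₇) he
    (isDegree_of_simple_eq_single (fun _ => rfl) 6 5) (by decide) rfl rfl
    (by decide +kernel) (by decide +kernel) (by norm_num) (by norm_num) ?_ ?_
  · rw [innerSum_modelE₇.1, hs]; norm_num
  · rw [innerSum_modelE₇.2, hs]; norm_num

end

/-! ### The classical root systems -/

section Classical

variable {ℓ : ℕ}

/-- The standard basis vector number `i`. -/
def unitVec (i : Fin ℓ) : Fin ℓ → ℤ := Pi.single i 1

theorem unitVec_apply (i k : Fin ℓ) : unitVec i k = if k = i then 1 else 0 := by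
  simp [unitVec, Pi.single_apply]

@[simp]
theorem dotProduct_unitVec (v : Fin ℓ → ℤ) (i : Fin ℓ) : v ⬝ᵥ unitVec i = v i := by
  simp [unitVec]

@[simp]
theorem sum_unitVec (i : Fin ℓ) : ∑ k, unitVec i k = 1 := by
  simp [unitVec_apply]

theorem unitVec_injective : Function.Injective (unitVec : Fin ℓ → Fin ℓ → ℤ) := by
  intro i j h
  simpa [unitVec_apply] using congrFun h i

theorem unitVec_sub_injective {x y : Fin ℓ × Fin ℓ} (hx : x.1 ≠ x.2)
    (h : unitVec x.1 - unitVec x.2 = unitVec y.1 - unitVec y.2) : x = y := by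
  have h1 := congrFun h x.1
  have h2 := congrFun h x.2
  simp only [Pi.sub_apply, unitVec_apply] at h1 h2
  refine Prod.ext ?_ ?_
  · by_contra hc
    simp only [if_true, if_neg hx, if_neg hc] at h1
    split_ifs at h1 <;> omega
  · by_contra hc
    simp only [if_true, if_neg hx.symm, if_neg hc] at h2
    split_ifs at h2 <;> omega

theorem unitVec_add_injective {x y : Fin ℓ × Fin ℓ} (hx : x.1 ≤ x.2) (hy : y.1 ≤ y.2)
    (h : unitVec x.1 + unitVec x.2 = unitVec y.1 + unitVec y.2) : x = y := by
  have h1 := congrFun h x.1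
  have h2 := congrFun h x.2
  have h3 := congrFun h y.1
  have h4 := congrFun h y.2
  obtain ⟨i, j⟩ := x
  obtain ⟨k, m⟩ := y
  simp only [Pi.add_apply, unitVec_apply, Fin.ext_iff, Fin.le_def, Prod.mk.injEq] at *
  grind

/-- The roots `e_i + e_j` for `i < j`, together with `e_i` if `a = 1` and `2 e_i` if `a = 2`. -/
def plusRoots (ℓ : ℕ) (a : ℤ) : Finset (Fin ℓ → ℤ) :=
  ((Finset.univ.filter fun x : Fin ℓ × Fin ℓ => x.1 < x.2 ∨ a = 2 ∧ x.1 = x.2).image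
    fun x => unitVec x.1 + unitVec x.2) ∪ if a = 1 then Finset.univ.image unitVec else ∅

/-- The roots `±e_i ± e_j` for `i ≠ j`, together with `±a e_i` if `a = 1` or `a = 2`. -/
def classicalRoots (ℓ : ℕ) (a : ℤ) : Finset (Fin ℓ → ℤ) :=
  ((Finset.univ.filter fun x : Fin ℓ × Fin ℓ => x.1 ≠ x.2).image fun x => unitVec x.1 - unitVec x.2) ∪
    (plusRoots ℓ a ∪ (plusRoots ℓ a).image fun v => -v)

variable {a : ℤ}

theorem mem_plusRoots {v : Fin ℓ → ℤ} : v ∈ plusRoots ℓ a ↔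
    (∃ i j, (i < j ∨ a = 2 ∧ i = j) ∧ unitVec i + unitVec j = v) ∨ a = 1 ∧ ∃ i, unitVec i = v := by
  unfold plusRoots
  split_ifs with h <;> simp [h]

theorem sum_pos_of_mem_plusRoots {v : Fin ℓ → ℤ} (hv : v ∈ plusRoots ℓ a) : 0 < ∑ k, v k := by
  rcases mem_plusRoots.1 hv with ⟨i, j, -, rfl⟩ | ⟨-, i, rfl⟩ <;>
    simp [Finset.sum_add_distrib]

theorem sum_plusRoots (f : (Fin ℓ → ℤ) → ℤ) : ∑ v ∈ plusRoots ℓ a, f v =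
    (∑ i, ∑ j, if i < j ∨ a = 2 ∧ i = j then f (unitVec i + unitVec j) else 0) +
      if a = 1 then ∑ i, f (unitVec i) else 0 := by
  rw [plusRoots, Finset.sum_union]
  · congr 1
    · rw [Finset.sum_image, Finset.sum_filter, Fintype.sum_prod_type]
      intro x hx y hy h
      simp only [Finset.coe_filter, Finset.mem_univ, true_and, Set.mem_ofPred_eq] at hx hy
      exact unitVec_add_injective (hx.elim le_of_lt fun h => h.2.le)
        (hy.elim le_of_lt fun h => h.2.le) h
    · split_ifs
      · exact Finset.sum_image fun _ _ _ _ h => unitVec_injective h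
      · simp
  · rw [Finset.disjoint_left]
    intro v hv hv'
    split_ifs at hv'
    · simp only [Finset.mem_image, Finset.mem_filter, Finset.mem_univ, true_and] at hv hv'
      obtain ⟨x, -, rfl⟩ := hv
      obtain ⟨i, hi⟩ := hv'
      have := congrArg (fun v => ∑ k, v k) hi
      simp [Finset.sum_add_distrib] at this
    · simp at hv'

/-- The three families are disjoint because the sum of the coordinates is zero, positive and
negative on them, respectively. -/
theorem sum_classicalRoots (f : (Fin ℓ → ℤ) → ℤ) : ∑ v ∈ classicalRoots ℓ a, f v =
    (∑ i, ∑ j, if i ≠ j then f (unitVec i - unitVec j) else 0) +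
      ∑ v ∈ plusRoots ℓ a, (f v + f (-v)) := by
  rw [classicalRoots, Finset.sum_union, Finset.sum_union, Finset.sum_add_distrib]
  · congr 1
    · rw [Finset.sum_image, Finset.sum_filter, Fintype.sum_prod_type]
      exact fun x hx y _ h => unitVec_sub_injective (Finset.mem_filter.1 hx).2 h
    · rw [Finset.sum_image fun _ _ _ _ h => neg_injective h]
  · rw [Finset.disjoint_left]
    intro v hv hv'
    obtain ⟨w, hw, rfl⟩ := Finset.mem_image.1 hv'
    have h1 := sum_pos_of_mem_plusRoots hv
    have h2 := sum_pos_of_mem_plusRoots hw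
    simp at h1
    omega
  · rw [Finset.disjoint_left]
    intro v hv hv'
    obtain ⟨x, -, rfl⟩ := Finset.mem_image.1 hv
    have h0 : ∑ k, (unitVec x.1 - unitVec x.2) k = 0 := by simp [Finset.sum_sub_distrib]
    rcases Finset.mem_union.1 hv' with h | h
    · exact (sum_pos_of_mem_plusRoots h).ne' h0
    · obtain ⟨w, hw, hw'⟩ := Finset.mem_image.1 h
      rw [← hw'] at h0
      have := sum_pos_of_mem_plusRoots hw
      simp at h0
      omega

/-- With independent signs, invariance under signed permutations becomes evident; the definition
with ordered pairs serves for summation without repetition. -/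
theorem mem_classicalRoots (ha : a = 0 ∨ a = 1 ∨ a = 2) {v : Fin ℓ → ℤ} :
    v ∈ classicalRoots ℓ a ↔
      (∃ i j, i ≠ j ∧ ∃ x y : ℤˣ, v = (x : ℤ) • unitVec i + (y : ℤ) • unitVec j) ∨
        a ≠ 0 ∧ ∃ i, ∃ x : ℤˣ, v = (x * a : ℤ) • unitVec i := by
  simp only [classicalRoots, Finset.mem_union, Finset.mem_image, mem_plusRoots,
    Finset.mem_filter, Finset.mem_univ, true_and]
  constructor
  · rintro (⟨x, hx, rfl⟩ | (⟨i, j, h | ⟨h, rfl⟩, rfl⟩ | ⟨h, i, rfl⟩) |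
      ⟨w, ⟨i, j, h | ⟨h, rfl⟩, rfl⟩ | ⟨h, i, rfl⟩, rfl⟩)
    · exact Or.inl ⟨x.1, x.2, hx, 1, -1, by simp [sub_eq_add_neg]⟩
    · exact Or.inl ⟨i, j, h.ne, 1, 1, by simp⟩
    · exact Or.inr ⟨by omega, i, 1, by simp [h, two_smul]⟩
    · exact Or.inr ⟨by omega, i, 1, by simp [h]⟩
    · exact Or.inl ⟨i, j, h.ne, -1, -1, by simp; abel⟩
    · exact Or.inr ⟨by omega, i, -1, by simp [h, two_smul]⟩
    · exact Or.inr ⟨by omega, i, -1, by simp [h]⟩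
  · rintro (⟨i, j, hij, x, y, rfl⟩ | ⟨h, i, x, rfl⟩)
    · rcases Int.units_eq_one_or x with rfl | rfl <;> rcases Int.units_eq_one_or y with rfl | rfl
      · right; left; left
        rcases lt_or_gt_of_ne hij with h | h
        · exact ⟨i, j, Or.inl h, by simp⟩
        · exact ⟨j, i, Or.inl h, by simp [add_comm]⟩
      · left
        exact ⟨(i, j), hij, by simp [sub_eq_add_neg]⟩
      · left
        exact ⟨(j, i), hij.symm, by simp [sub_eq_add_neg, add_comm]⟩
      · right; right
        refine ⟨unitVec i + unitVec j, Or.inl ?_, by simp; abel⟩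
        rcases lt_or_gt_of_ne hij with h | h
        · exact ⟨i, j, Or.inl h, by simp⟩
        · exact ⟨j, i, Or.inl h, by simp [add_comm]⟩
    · right
      have h' : a • unitVec i = unitVec i + unitVec i ∧ a = 2 ∨ a • unitVec i = unitVec i ∧ a = 1 := by
        rcases ha with rfl | rfl | rfl
        · exact absurd rfl h
        · exact Or.inr ⟨by simp, rfl⟩
        · exact Or.inl ⟨by simp [two_smul], rfl⟩
      have key : (∃ k j, (k < j ∨ a = 2 ∧ k = j) ∧ unitVec k + unitVec j = a • unitVec i) ∨
          a = 1 ∧ ∃ k, unitVec k = a • unitVec i := by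
        rcases h' with ⟨h1, h2⟩ | ⟨h1, h2⟩
        · exact Or.inl ⟨i, i, Or.inr ⟨h2, rfl⟩, h1.symm⟩
        · exact Or.inr ⟨h2, i, h1.symm⟩
      rcases Int.units_eq_one_or x with rfl | rfl
      · left; simpa using key
      · right; exact ⟨_, key, by simp⟩

/-- The image of a vector under a signed permutation of the coordinates. -/
def signedPerm (σ : Equiv.Perm (Fin ℓ)) (s : Fin ℓ → ℤˣ) (v : Fin ℓ → ℤ) : Fin ℓ → ℤ :=
  fun k => s k * v (σ k)

theorem signedPerm_smul_unitVec (σ : Equiv.Perm (Fin ℓ)) (s : Fin ℓ → ℤˣ) (x : ℤ) (i : Fin ℓ) :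
    signedPerm σ s (x • unitVec i) = (s (σ.symm i) * x : ℤ) • unitVec (σ.symm i) := by
  funext k
  simp only [signedPerm, Pi.smul_apply, unitVec_apply, smul_eq_mul, Equiv.eq_symm_apply]
  split_ifs with h
  · simp [← h]
  · simp

theorem signedPerm_add (σ : Equiv.Perm (Fin ℓ)) (s : Fin ℓ → ℤˣ) (v w : Fin ℓ → ℤ) :
    signedPerm σ s (v + w) = signedPerm σ s v + signedPerm σ s w := by
  funext k
  simp [signedPerm, mul_add]

theorem signedPerm_mem (ha : a = 0 ∨ a = 1 ∨ a = 2) {v : Fin ℓ → ℤ} (hv : v ∈ classicalRoots ℓ a)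
    (σ : Equiv.Perm (Fin ℓ)) (s : Fin ℓ → ℤˣ) : signedPerm σ s v ∈ classicalRoots ℓ a := by
  rw [mem_classicalRoots ha] at hv ⊢
  rcases hv with ⟨i, j, hij, x, y, rfl⟩ | ⟨h, i, x, rfl⟩
  · refine Or.inl ⟨σ.symm i, σ.symm j, σ.symm.injective.ne hij, s (σ.symm i) * x,
      s (σ.symm j) * y, ?_⟩
    rw [signedPerm_add, signedPerm_smul_unitVec, signedPerm_smul_unitVec]
    simp
  · refine Or.inr ⟨h, σ.symm i, s (σ.symm i) * x, ?_⟩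
    rw [signedPerm_smul_unitVec]
    simp [mul_assoc]

theorem exists_perm_pair {i j k m : Fin ℓ} (hij : i ≠ j) (hkm : k ≠ m) :
    ∃ σ : Equiv.Perm (Fin ℓ), σ i = k ∧ σ j = m := by
  refine ⟨(Equiv.swap i k).trans (Equiv.swap (Equiv.swap i k j) m), ?_, ?_⟩
  · rw [Equiv.trans_apply, Equiv.swap_apply_left, Equiv.swap_apply_of_ne_of_ne _ hkm]
    intro h
    apply hij
    apply (Equiv.swap i k).injective
    exact (Equiv.swap_apply_left i k).trans h
  · simp

theorem unitVec_comp (σ : Equiv.Perm (Fin ℓ)) (i : Fin ℓ) : unitVec (σ i) ∘ σ = unitVec i := by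
  funext k
  simp [unitVec_apply]

/-- Adjacent transpositions generate the symmetric group. -/
theorem comp_perm_mem {T : Set (Fin ℓ → ℤ)}
    (hT : ∀ v ∈ T, ∀ i j : Fin ℓ, (i : ℕ) + 1 = j → v ∘ Equiv.swap i j ∈ T)
    (σ : Equiv.Perm (Fin ℓ)) : ∀ v ∈ T, v ∘ σ ∈ T := by
  cases ℓ with
  | zero => intro v hv; rwa [Subsingleton.elim (v ∘ σ) v]
  | succ n =>
    have hσ : σ ∈ (⊤ : Submonoid (Equiv.Perm (Fin (n + 1)))) := trivial
    rw [← Equiv.Perm.mclosure_swap_castSucc_succ] at hσ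
    induction hσ using Submonoid.closure_induction with
    | mem τ hτ =>
      obtain ⟨i, rfl⟩ := hτ
      exact fun v hv => hT v hv _ _ (by simp)
    | one => exact fun v hv => hv
    | mul τ ρ _ _ h1 h2 => exact fun v hv => h2 _ (h1 v hv)

theorem classicalRoots_subset (ha : a = 0 ∨ a = 1 ∨ a = 2) {T : Set (Fin ℓ → ℤ)}
    (hneg : ∀ v ∈ T, -v ∈ T)
    (hT : ∀ v ∈ T, ∀ i j : Fin ℓ, (i : ℕ) + 1 = j → v ∘ Equiv.swap i j ∈ T)
    {p q : Fin ℓ} (hpq : p ≠ q) (hsub : unitVec p - unitVec q ∈ T)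
    (hadd : unitVec p + unitVec q ∈ T) (hunit : a ≠ 0 → a • unitVec q ∈ T) :
    ∀ v ∈ classicalRoots ℓ a, v ∈ T := by
  have h1 : ∀ i j, i ≠ j → unitVec i - unitVec j ∈ T := by
    intro i j hij
    obtain ⟨σ, rfl, rfl⟩ := exists_perm_pair hij hpq
    have h := comp_perm_mem hT σ _ hsub
    rwa [Pi.sub_comp, unitVec_comp, unitVec_comp] at h
  have h2 : ∀ i j, i ≠ j → unitVec i + unitVec j ∈ T := by
    intro i j hij
    obtain ⟨σ, rfl, rfl⟩ := exists_perm_pair hij hpq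
    have h := comp_perm_mem hT σ _ hadd
    rwa [Pi.add_comp, unitVec_comp, unitVec_comp] at h
  have h3 : a ≠ 0 → ∀ i, a • unitVec i ∈ T := by
    intro h0 i
    have h := comp_perm_mem hT (Equiv.swap i q) _ (hunit h0)
    have h' := unitVec_comp (Equiv.swap i q) i
    rw [Equiv.swap_apply_left] at h'
    rwa [Pi.smul_comp, h'] at h
  intro v hv
  rcases (mem_classicalRoots ha).1 hv with ⟨i, j, hij, x, y, rfl⟩ | ⟨h, i, x, rfl⟩
  · rcases Int.units_eq_one_or x with rfl | rfl <;> rcases Int.units_eq_one_or y with rfl | rfl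
    · simpa using h2 i j hij
    · simpa [sub_eq_add_neg] using h1 i j hij
    · simpa [sub_eq_add_neg, add_comm] using h1 j i hij.symm
    · simpa [add_comm] using hneg _ (h2 i j hij)
  · rcases Int.units_eq_one_or x with rfl | rfl
    · simpa using h3 h i
    · simpa using hneg _ (h3 h i)

/-- Twice a triangular sum of a symmetric function is the full square without its diagonal; for `a =
2` the triangle contains the diagonal, which is then counted once more instead. -/
theorem two_mul_sum_lt {g : Fin ℓ → Fin ℓ → ℤ} (hg : ∀ i j, g i j = g j i) :
    2 * (∑ i, ∑ j, if i < j ∨ a = 2 ∧ i = j then g i j else 0) =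
      ∑ i, ∑ j, g i j + (if a = 2 then 1 else -1) * ∑ i, g i i := by
  have h1 : (∑ i, ∑ j, if i < j ∨ a = 2 ∧ i = j then g i j else 0) =
      ∑ i, ∑ j, if j < i ∨ a = 2 ∧ i = j then g i j else 0 := by
    rw [Finset.sum_comm]
    refine Finset.sum_congr rfl fun i _ => Finset.sum_congr rfl fun j _ => ?_
    rw [hg j i]
    simp only [eq_comm]
  have h2 : ∑ i, g i i = ∑ i, ∑ j, if i = j then g i j else 0 := by simp
  rw [two_mul]
  nth_rewrite 2 [h1]
  rw [h2, Finset.mul_sum, ← Finset.sum_add_distrib, ← Finset.sum_add_distrib]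
  refine Finset.sum_congr rfl fun i _ => ?_
  rw [Finset.mul_sum, ← Finset.sum_add_distrib, ← Finset.sum_add_distrib]
  refine Finset.sum_congr rfl fun j _ => ?_
  rcases lt_trichotomy i j with h | rfl | h
  · simp [h, h.ne, h.not_gt]
  · split_ifs <;> simp_all
  · simp [h, h.ne', h.not_gt]

theorem sum_classicalRoots_mul (k m : Fin ℓ) :
    ∑ v ∈ classicalRoots ℓ a, v k * v m = if k = m then
      4 * (ℓ : ℤ) - 4 + (if a = 2 then 8 else 0) + (if a = 1 then 2 else 0) else 0 := by
  rw [sum_classicalRoots]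
  have h2 : ∀ v : Fin ℓ → ℤ, v k * v m + (-v) k * (-v) m = 2 * (v k * v m) := by
    intro v; simp only [Pi.neg_apply]; ring
  simp only [h2, ← Finset.mul_sum]
  rw [sum_plusRoots, mul_add, two_mul_sum_lt fun i j => by rw [add_comm]]
  have h3 : ∀ i j : Fin ℓ, (if i ≠ j then (unitVec i - unitVec j) k * (unitVec i - unitVec j) m
      else 0) = (unitVec i - unitVec j) k * (unitVec i - unitVec j) m := by
    intro i j
    split_ifs with h
    · rfl
    · simp [not_not.1 h]
  simp only [h3]
  simp only [Pi.sub_apply, Pi.add_apply, unitVec_apply]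
  have h4 : ∀ i : Fin ℓ, (if k = i then (1 : ℤ) else 0) * (if m = i then 1 else 0) =
      if k = i then (if k = m then 1 else 0) else 0 := by
    intro i; split_ifs <;> simp_all
  simp only [sub_mul, mul_sub, add_mul, mul_add, h4, Finset.sum_sub_distrib, Finset.sum_add_distrib]
  simp
  split_ifs <;> omega

end Classical

/-! ### Models of the root systems B, C and D -/

section ClassicalModel

variable {ℓ : ℕ} {a : ℤ}

/-- The simple roots `e_i - e_{i+1}`, followed by `a e_ℓ` or, if `a = 0`, by `e_{ℓ-1} + e_ℓ`. -/
def classicalSimple (ℓ : ℕ) (a : ℤ) (i : Fin ℓ) : Fin ℓ → ℤ :=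
  if h : (i : ℕ) + 1 < ℓ then unitVec i - unitVec ⟨i + 1, h⟩
  else if a = 0 then unitVec ⟨i - 1, by omega⟩ + unitVec i else a • unitVec i

/-- The coroots of the simple roots. -/
def classicalCosimple (ℓ : ℕ) (a : ℤ) (i : Fin ℓ) : Fin ℓ → ℤ :=
  if h : (i : ℕ) + 1 < ℓ then unitVec i - unitVec ⟨i + 1, h⟩
  else if a = 0 then unitVec ⟨i - 1, by omega⟩ + unitVec i
  else (if a = 1 then 2 else 1 : ℤ) • unitVec i

theorem dotProduct_classicalCosimple (v : Fin ℓ → ℤ) (j : Fin ℓ) :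
    v ⬝ᵥ classicalCosimple ℓ a j =
      if h : (j : ℕ) + 1 < ℓ then v j - v ⟨j + 1, h⟩
      else if a = 0 then v ⟨j - 1, by omega⟩ + v j else (if a = 1 then 2 else 1) * v j := by
  unfold classicalCosimple
  split_ifs <;>
    simp only [dotProduct_sub, dotProduct_add, dotProduct_smul, dotProduct_unitVec, smul_eq_mul]

theorem classicalSimple_mem (ha : a = 0 ∨ a = 1 ∨ a = 2) (hℓ : 2 ≤ ℓ) (i : Fin ℓ) :
    classicalSimple ℓ a i ∈ classicalRoots ℓ a := by
  rw [mem_classicalRoots ha, classicalSimple]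
  split_ifs with h1 h2
  · exact Or.inl ⟨i, ⟨i + 1, h1⟩, by simp [Fin.ext_iff], 1, -1, by simp [sub_eq_add_neg]⟩
  · exact Or.inl ⟨⟨i - 1, by omega⟩, i, by simp only [ne_eq, Fin.ext_iff]; omega, 1, 1, by simp⟩
  · exact Or.inr ⟨h2, i, 1, by simp⟩

theorem reflect_of_lt (v : Fin ℓ → ℤ) {i j : Fin ℓ} (h : (i : ℕ) + 1 = j) :
    v - (v ⬝ᵥ classicalCosimple ℓ a i) • classicalSimple ℓ a i = v ∘ Equiv.swap i j := by
  have hi : (i : ℕ) + 1 < ℓ := h ▸ j.2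
  obtain rfl : (⟨i + 1, hi⟩ : Fin ℓ) = j := Fin.ext h
  rw [dotProduct_classicalCosimple, classicalSimple, dif_pos hi, dif_pos hi]
  funext k
  simp only [Pi.sub_apply, Pi.smul_apply, unitVec_apply, smul_eq_mul, Function.comp_apply,
    Equiv.swap_apply_def]
  have : i ≠ ⟨i + 1, hi⟩ := by simp [Fin.ext_iff]
  split_ifs <;> simp_all

/-- All simple reflections but the last are transpositions. The last one negates the final
coordinate, or for `a = 0` swaps and negates the final two. -/
theorem reflect_eq_signedPerm (ha : a = 0 ∨ a = 1 ∨ a = 2) (hℓ : 2 ≤ ℓ) (v : Fin ℓ → ℤ)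
    (i : Fin ℓ) : ∃ σ s, v - (v ⬝ᵥ classicalCosimple ℓ a i) • classicalSimple ℓ a i =
      signedPerm σ s v := by
  by_cases hi : (i : ℕ) + 1 < ℓ
  · refine ⟨Equiv.swap i ⟨i + 1, hi⟩, 1, ?_⟩
    rw [reflect_of_lt v (j := ⟨i + 1, hi⟩) rfl]
    funext k
    simp [signedPerm]
  · rw [dotProduct_classicalCosimple, classicalSimple, dif_neg hi, dif_neg hi]
    by_cases h0 : a = 0
    · set j : Fin ℓ := ⟨i - 1, by omega⟩
      have hj : j ≠ i := by simp only [ne_eq, Fin.ext_iff, j]; omega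
      refine ⟨Equiv.swap j i, fun k => if k = j ∨ k = i then -1 else 1, ?_⟩
      rw [if_pos h0, if_pos h0]
      funext k
      simp only [Pi.sub_apply, Pi.smul_apply, Pi.add_apply, unitVec_apply, smul_eq_mul,
        signedPerm, Equiv.swap_apply_def]
      split_ifs <;> simp_all
    · refine ⟨1, fun k => if k = i then -1 else 1, ?_⟩
      rw [if_neg h0, if_neg h0]
      funext k
      simp only [Pi.sub_apply, Pi.smul_apply, unitVec_apply, smul_eq_mul, signedPerm,
        Equiv.Perm.one_apply]
      rcases ha with rfl | rfl | rfl
      · exact absurd rfl h0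
      · split_ifs <;> simp_all; ring
      · split_ifs <;> simp_all; ring

/-- The model of the classical root system of type `D` (`a = 0`), `B` (`a = 1`), `C` (`a = 2`). -/
def classicalModel {A : Matrix (Fin ℓ) (Fin ℓ) ℤ} (ha : a = 0 ∨ a = 1 ∨ a = 2) (hℓ : 2 ≤ ℓ)
    (hA : ∀ i j, classicalSimple ℓ a i ⬝ᵥ classicalCosimple ℓ a j = A i j) : RootModel ℓ A where
  simple := classicalSimple ℓ a
  cosimple := classicalCosimple ℓ a
  pairing := hA
  roots := classicalRoots ℓ a
  simple_mem := classicalSimple_mem ha hℓ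
  neg_mem v hv := by
    convert signedPerm_mem ha hv 1 (fun _ => -1) using 1
    funext k
    simp [signedPerm]
  reflect_mem v hv j := by
    obtain ⟨σ, s, h⟩ := reflect_eq_signedPerm ha hℓ v j
    rw [h]
    exact signedPerm_mem ha hv σ s
  minimal T h1 h2 h3 := by
    set p : Fin ℓ := ⟨ℓ - 2, by omega⟩ with hp
    set q : Fin ℓ := ⟨ℓ - 1, by omega⟩ with hq
    have hpq : (p : ℕ) + 1 = q := by simp only [hp, hq]; omega
    have hpℓ : (p : ℕ) + 1 < ℓ := hpq ▸ q.2
    have hne : p ≠ q := by rw [ne_eq, Fin.ext_iff]; omega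
    have hqℓ : ¬(q : ℕ) + 1 < ℓ := by simp only [hq]; omega
    have hsub : unitVec p - unitVec q ∈ T := by
      have h := h1 p
      rw [classicalSimple, dif_pos hpℓ] at h
      convert h
      exact hpq.symm
    refine classicalRoots_subset ha h2 (fun v hv i j hij => ?_) hne hsub ?_ fun h0 => ?_
    · rw [← reflect_of_lt (a := a) v hij]
      exact h3 v hv i
    -- The vector e_{ℓ-1} + e_ℓ is the last simple root in type D; in types B and C it is the
    -- reflection of e_{ℓ-1} - e_ℓ in the last simple root.
    · by_cases h0 : a = 0
      · have h := h1 q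
        rw [classicalSimple, dif_neg hqℓ, if_pos h0] at h
        convert h using 3
        exact Fin.ext (by simp only [hp]; omega)
      · have h := h3 _ hsub q
        rw [dotProduct_classicalCosimple, classicalSimple, dif_neg hqℓ, dif_neg hqℓ, if_neg h0,
          if_neg h0] at h
        convert h using 1
        funext k
        simp only [Pi.sub_apply, Pi.smul_apply, Pi.add_apply, unitVec_apply, smul_eq_mul]
        rcases ha with rfl | rfl | rfl
        · exact absurd rfl h0
        · split_ifs <;> simp_all
        · split_ifs <;> simp_all
    · have h := h1 q
      rwa [classicalSimple, dif_neg hqℓ, if_neg h0] at h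
  gram := 1
  scale := 4 * (ℓ : ℤ) - 4 + (if a = 2 then 8 else 0) + (if a = 1 then 2 else 0)
  scale_ne := by split_ifs <;> omega
  moment k m := by simpa using sum_classicalRoots_mul k m

theorem classical_pairing_B (hℓ : 2 ≤ ℓ) (i j : Fin ℓ) :
    classicalSimple ℓ 1 i ⬝ᵥ classicalCosimple ℓ 1 j = CartanMatrix.B ℓ i j := by
  obtain ⟨i, hi⟩ := i
  obtain ⟨j, hj⟩ := j
  rw [dotProduct_classicalCosimple]
  simp only [classicalSimple, CartanMatrix.B, Matrix.of_apply]
  split_ifs <;> simp [unitVec_apply, Fin.ext_iff] at * <;> grind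

theorem classical_pairing_C (hℓ : 2 ≤ ℓ) (i j : Fin ℓ) :
    classicalSimple ℓ 2 i ⬝ᵥ classicalCosimple ℓ 2 j = CartanMatrix.C ℓ i j := by
  obtain ⟨i, hi⟩ := i
  obtain ⟨j, hj⟩ := j
  rw [dotProduct_classicalCosimple]
  simp only [classicalSimple, CartanMatrix.C, Matrix.of_apply]
  split_ifs <;> simp [unitVec_apply, Fin.ext_iff] at * <;> grind

theorem classical_pairing_D (hℓ : 4 ≤ ℓ) (i j : Fin ℓ) :
    classicalSimple ℓ 0 i ⬝ᵥ classicalCosimple ℓ 0 j = CartanMatrix.D ℓ i j := by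
  obtain ⟨i, hi⟩ := i
  obtain ⟨j, hj⟩ := j
  rw [dotProduct_classicalCosimple]
  simp only [classicalSimple, CartanMatrix.D, Matrix.of_apply]
  split_ifs <;> simp [unitVec_apply, Fin.ext_iff] at * <;> grind

end ClassicalModel

/-! ### Degrees and inner product sums in the classical models -/

section ClassicalDegrees

variable {ℓ : ℕ} {a : ℤ} {A : Matrix (Fin ℓ) (Fin ℓ) ℤ}

theorem innerSum_classicalModel (ha : a = 0 ∨ a = 1 ∨ a = 2) (hℓ : 2 ≤ ℓ)
    (hA : ∀ i j, classicalSimple ℓ a i ⬝ᵥ classicalCosimple ℓ a j = A i j)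
    (deg : (Fin ℓ → ℤ) → ℤ × ℤ) (d₁ d₂ : ℤ × ℤ) :
    (classicalModel ha hℓ hA).innerSum deg d₁ d₂ =
      ∑ v ∈ classicalRoots ℓ a with deg v = d₁,
        ∑ w ∈ classicalRoots ℓ a with deg w = d₂, v ⬝ᵥ w := by
  simp [RootModel.innerSum, classicalModel]

theorem sum_filter_classicalRoots (P : (Fin ℓ → ℤ) → Prop) [DecidablePred P]
    (f : (Fin ℓ → ℤ) → ℤ) : ∑ v ∈ classicalRoots ℓ a with P v, f v =
    (∑ i, ∑ j, if i ≠ j ∧ P (unitVec i - unitVec j) then f (unitVec i - unitVec j) else 0) +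
      ((∑ i, ∑ j, if i < j ∨ a = 2 ∧ i = j then
          (if P (unitVec i + unitVec j) then f (unitVec i + unitVec j) else 0) +
          (if P (-(unitVec i + unitVec j)) then f (-(unitVec i + unitVec j)) else 0) else 0) +
        if a = 1 then ∑ i, ((if P (unitVec i) then f (unitVec i) else 0) +
          (if P (-unitVec i) then f (-unitVec i) else 0)) else 0) := by
  rw [Finset.sum_filter, sum_classicalRoots, sum_plusRoots]
  simp only [ite_and]

/-- The coefficients of the first two simple roots in type `B` or `D`. -/
def firstDegree (z o : Fin ℓ) (v : Fin ℓ → ℤ) : ℤ × ℤ := (v z, v z + v o)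

/-- Partial sums of coordinates read off the coefficients of e_i - e_{i+1}. In type D the bound 4 ≤
ℓ keeps the last simple root e_{ℓ-1} + e_ℓ away from the first two coordinates. -/
theorem isDegree_firstDegree (ha : a = 0 ∨ a = 1 ∨ a = 2) (hℓ : 2 ≤ ℓ)
    (hA : ∀ i j, classicalSimple ℓ a i ⬝ᵥ classicalCosimple ℓ a j = A i j)
    (ha' : a = 1 ∨ a = 0 ∧ 4 ≤ ℓ) {z o : Fin ℓ} (hz : (z : ℕ) = 0) (ho : (o : ℕ) = 1) :
    (classicalModel ha hℓ hA).IsDegree (firstDegree z o) z o := by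
  intro c
  have h1 : ∀ i, classicalSimple ℓ a i z = if i = z then 1 else 0 := by
    rintro ⟨i, hi⟩
    simp only [classicalSimple]
    split_ifs <;> simp [unitVec_apply, Fin.ext_iff] at * <;> grind
  have h2 : ∀ i, classicalSimple ℓ a i z + classicalSimple ℓ a i o = if i = o then 1 else 0 := by
    rintro ⟨i, hi⟩
    simp only [classicalSimple]
    split_ifs <;> simp [unitVec_apply, Fin.ext_iff] at * <;> grind
  simp only [firstDegree, classicalModel, Finset.sum_apply, Pi.smul_apply, smul_eq_mul,
    ← Finset.sum_add_distrib, ← mul_add, h2]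
  simp [h1]

/-- Excludes the degrees (2,1) and (1,3), which would force a coordinate equal to 2. -/
theorem apply_le_one (ha : a = 0 ∨ a = 1) {v : Fin ℓ → ℤ} (hv : v ∈ classicalRoots ℓ a)
    (k : Fin ℓ) : v k ≤ 1 := by
  rcases (mem_classicalRoots (by omega)).1 hv with ⟨i, j, hij, x, y, rfl⟩ | ⟨h, i, x, rfl⟩
  · rcases Int.units_eq_one_or x with rfl | rfl <;> rcases Int.units_eq_one_or y with rfl | rfl <;>
      simp [unitVec_apply] <;> grind
  · rcases Int.units_eq_one_or x with rfl | rfl <;> simp [unitVec_apply] <;> grind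

/-! ### Type IIa: the first two simple roots -/

section First

variable {z o : Fin ℓ}

theorem sum_firstDegree_one_zero (hzo : z < o) (f : (Fin ℓ → ℤ) → ℤ) :
    ∑ v ∈ classicalRoots ℓ a with firstDegree z o v = (1, 0), f v = f (unitVec z - unitVec o) := by
  rw [sum_filter_classicalRoots]
  have h1 : ∀ i j, (if i ≠ j ∧ firstDegree z o (unitVec i - unitVec j) = (1, 0) then
      f (unitVec i - unitVec j) else 0) =
      if i = z then if j = o then f (unitVec z - unitVec o) else 0 else 0 := by
    intro i j
    simp only [firstDegree, Pi.sub_apply, unitVec_apply, Prod.mk.injEq]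
    grind
  have h2 : ∀ i j, firstDegree z o (unitVec i + unitVec j) ≠ (1, 0) ∧
      firstDegree z o (-(unitVec i + unitVec j)) ≠ (1, 0) := by
    intro i j
    simp only [firstDegree, Pi.add_apply, Pi.neg_apply, unitVec_apply, ne_eq, Prod.mk.injEq]
    grind
  have h3 : ∀ i, firstDegree z o (unitVec i) ≠ (1, 0) ∧
      firstDegree z o (-unitVec i) ≠ (1, 0) := by
    intro i
    simp only [firstDegree, Pi.neg_apply, unitVec_apply, ne_eq, Prod.mk.injEq]
    grind
  simp only [h1, h2, h3, if_false]
  simp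

theorem sum_firstDegree_one_two (hzo : z < o) (f : (Fin ℓ → ℤ) → ℤ) :
    ∑ v ∈ classicalRoots ℓ a with firstDegree z o v = (1, 2), f v = f (unitVec z + unitVec o) := by
  rw [sum_filter_classicalRoots]
  have h1 : ∀ i j, ¬(i ≠ j ∧ firstDegree z o (unitVec i - unitVec j) = (1, 2)) := by
    intro i j
    simp only [firstDegree, Pi.sub_apply, unitVec_apply, Prod.mk.injEq]
    grind
  have h2 : ∀ i j, (if i < j ∨ a = 2 ∧ i = j then
      (if firstDegree z o (unitVec i + unitVec j) = (1, 2) then f (unitVec i + unitVec j) else 0) +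
      (if firstDegree z o (-(unitVec i + unitVec j)) = (1, 2) then
        f (-(unitVec i + unitVec j)) else 0) else 0) =
      if i = z then if j = o then f (unitVec z + unitVec o) else 0 else 0 := by
    intro i j
    simp only [firstDegree, Pi.add_apply, Pi.neg_apply, unitVec_apply, Prod.mk.injEq]
    grind
  have h3 : ∀ i, firstDegree z o (unitVec i) ≠ (1, 2) ∧
      firstDegree z o (-unitVec i) ≠ (1, 2) := by
    intro i
    simp only [firstDegree, Pi.neg_apply, unitVec_apply, ne_eq, Prod.mk.injEq]
    grind
  simp only [h1, h2, h3, if_false]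
  simp

theorem sum_one_firstDegree {d : ℤ × ℤ} {z o : Fin ℓ} (hz : (z : ℕ) = 0)
    (ho : (o : ℕ) = 1) (hd : d = (1, 1) ∨ d = (0, 1)) :
    ∑ v ∈ classicalRoots ℓ a with firstDegree z o v = d, (1 : ℤ) =
      2 * (ℓ - 2) + if a = 1 then 1 else 0 := by
  rw [sum_filter_classicalRoots]
  have hzo : z ≠ o := by rw [ne_eq, Fin.ext_iff]; omega
  -- A root of degree `d` has entry 1 at `t` and entry 0 at the other of `z`, `o`. So it is e_t ±
  -- e_j with j beyond the first two indices, or e_t in type B.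
  set t : Fin ℓ := if d = (1, 1) then z else o with ht
  have h1 : ∀ i j, (if i ≠ j ∧ firstDegree z o (unitVec i - unitVec j) = d then (1 : ℤ) else 0) =
      if i = t then 1 - (if j = z then 1 else 0) - (if j = o then 1 else 0) else 0 := by
    intro i j
    rcases hd with rfl | rfl <;>
      simp [firstDegree, unitVec_apply, ht] <;> grind
  have h2 : ∀ i j, (if i < j ∨ a = 2 ∧ i = j then
      (if firstDegree z o (unitVec i + unitVec j) = d then (1 : ℤ) else 0) +
      (if firstDegree z o (-(unitVec i + unitVec j)) = d then 1 else 0) else 0) =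
      if i = t then 1 - (if j = z then 1 else 0) - (if j = o then 1 else 0) else 0 := by
    intro i j
    rcases hd with rfl | rfl <;>
      simp only [firstDegree, Pi.add_apply, Pi.neg_apply, unitVec_apply, Prod.mk.injEq, ht,
        Fin.lt_def, Fin.ext_iff, hz, ho] <;> grind
  have h3 : ∀ i, ((if firstDegree z o (unitVec i) = d then (1 : ℤ) else 0) +
      (if firstDegree z o (-unitVec i) = d then 1 else 0)) = if i = t then 1 else 0 := by
    intro i
    rcases hd with rfl | rfl <;>
      simp [firstDegree, unitVec_apply, ht] <;> grind
  simp only [h1, h2, h3]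
  simp [Finset.sum_sub_distrib]
  split_ifs <;> ring

/-- The only root of degree (1,0) is e₁ - e₂ and the only one of degree (1,2) is e₁ + e₂. They have
inner product 1 with every root of degree (1,1) and (0,1), respectively, so both sums are
cardinalities. -/
theorem innerSum_firstDegree (hz : (z : ℕ) = 0) (ho : (o : ℕ) = 1)
    (ha : a = 0 ∨ a = 1 ∨ a = 2) (hℓ : 2 ≤ ℓ)
    (hA : ∀ i j, classicalSimple ℓ a i ⬝ᵥ classicalCosimple ℓ a j = A i j) :
    (classicalModel ha hℓ hA).innerSum (firstDegree z o) (1, 0) (1, 1) =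
        2 * (ℓ - 2) + (if a = 1 then 1 else 0) ∧
      (classicalModel ha hℓ hA).innerSum (firstDegree z o) (0, 1) (1, 2) =
        2 * (ℓ - 2) + if a = 1 then 1 else 0 := by
  have hzo : z < o := by rw [Fin.lt_def]; omega
  rw [innerSum_classicalModel, innerSum_classicalModel]
  constructor
  · rw [sum_firstDegree_one_zero hzo, ← sum_one_firstDegree hz ho (Or.inl rfl)]
    refine Finset.sum_congr rfl fun v hv => ?_
    have h := (Finset.mem_filter.1 hv).2
    simp only [firstDegree, Prod.mk.injEq] at h
    rw [dotProduct_comm, dotProduct_sub, dotProduct_unitVec, dotProduct_unitVec]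
    omega
  · rw [← sum_one_firstDegree hz ho (Or.inr rfl)]
    refine Finset.sum_congr rfl fun v hv => ?_
    have h := (Finset.mem_filter.1 hv).2
    simp only [firstDegree, Prod.mk.injEq] at h
    rw [sum_firstDegree_one_two hzo, dotProduct_add, dotProduct_unitVec, dotProduct_unitVec]
    omega

end First

/-- The sum of the first `p` coordinates. -/
def headSum (p : ℕ) (v : Fin ℓ → ℤ) : ℤ := ∑ k : Fin ℓ, if (k : ℕ) < p then v k else 0

theorem headSum_add (p : ℕ) (v w : Fin ℓ → ℤ) :
    headSum p (v + w) = headSum p v + headSum p w := by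
  rw [headSum, headSum, headSum, ← Finset.sum_add_distrib]
  exact Finset.sum_congr rfl fun k _ => by split_ifs <;> simp

theorem headSum_neg (p : ℕ) (v : Fin ℓ → ℤ) : headSum p (-v) = -headSum p v := by
  rw [headSum, headSum, ← Finset.sum_neg_distrib]
  exact Finset.sum_congr rfl fun k _ => by split_ifs <;> simp

theorem headSum_sub (p : ℕ) (v w : Fin ℓ → ℤ) :
    headSum p (v - w) = headSum p v - headSum p w := by
  rw [sub_eq_add_neg, headSum_add, headSum_neg, sub_eq_add_neg]

theorem headSum_smul (p : ℕ) (c : ℤ) (v : Fin ℓ → ℤ) : headSum p (c • v) = c * headSum p v := by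
  rw [headSum, headSum, Finset.mul_sum]
  exact Finset.sum_congr rfl fun k _ => by split_ifs <;> simp

theorem headSum_unitVec (p : ℕ) (i : Fin ℓ) :
    headSum p (unitVec i) = if (i : ℕ) < p then 1 else 0 := by
  simp only [headSum, unitVec_apply, ← ite_and]
  rw [Finset.sum_eq_single i] <;> simp +contextual

/-- The coefficients of the simple roots number `p` and `ℓ`, counted from `1`, in type `C` or
`D`. -/
def lastDegree (p : ℕ) (v : Fin ℓ → ℤ) : ℤ × ℤ := (headSum p v, headSum ℓ v / 2)

theorem headSum_sum (p : ℕ) {ι : Type*} (s : Finset ι) (v : ι → Fin ℓ → ℤ) :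
    headSum p (∑ i ∈ s, v i) = ∑ i ∈ s, headSum p (v i) := by
  simp only [headSum, Finset.sum_apply]
  rw [Finset.sum_comm]
  exact Finset.sum_congr rfl fun k _ => by split_ifs <;> simp

/-- Among the simple roots, only e_p - e_{p+1} has a nonzero sum of the first p coordinates; the
bounds on p ensure this for the last simple root. Only the last one has a nonzero total sum, namely
2, hence the halving in `lastDegree`. -/
theorem isDegree_lastDegree (ha : a = 0 ∨ a = 1 ∨ a = 2) (hℓ : 2 ≤ ℓ)
    (hA : ∀ i j, classicalSimple ℓ a i ⬝ᵥ classicalCosimple ℓ a j = A i j) {p : ℕ}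
    (hpℓ : a = 2 ∧ p ≤ ℓ - 1 ∨ a = 0 ∧ p ≤ ℓ - 2) {i₁ i₂ : Fin ℓ} (h₁ : (i₁ : ℕ) + 1 = p)
    (h₂ : (i₂ : ℕ) + 1 = ℓ) : (classicalModel ha hℓ hA).IsDegree (lastDegree p) i₁ i₂ := by
  intro c
  have h1 : ∀ i, headSum p (classicalSimple ℓ a i) = if i = i₁ then 1 else 0 := by
    rintro ⟨i, hi⟩
    simp only [classicalSimple]
    split_ifs <;> simp only [headSum_sub, headSum_add, headSum_smul, headSum_unitVec,
      Fin.ext_iff] at * <;> grind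
  have h2 : ∀ i, headSum ℓ (classicalSimple ℓ a i) = if i = i₂ then 2 else 0 := by
    rintro ⟨i, hi⟩
    simp only [classicalSimple]
    split_ifs <;> simp only [headSum_sub, headSum_add, headSum_smul, headSum_unitVec,
      Fin.ext_iff] at * <;> grind
  simp only [lastDegree, classicalModel, headSum_sum, headSum_smul, h1, h2]
  simp

theorem headSum_le_two (ha : a = 0 ∨ a = 2) {v : Fin ℓ → ℤ} (hv : v ∈ classicalRoots ℓ a)
    (p : ℕ) : headSum p v ≤ 2 := by
  rcases (mem_classicalRoots (by omega)).1 hv with ⟨i, j, hij, x, y, rfl⟩ | ⟨h, i, x, rfl⟩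
  · rw [headSum_add, headSum_smul, headSum_smul, headSum_unitVec, headSum_unitVec]
    rcases Int.units_eq_one_or x with rfl | rfl <;> rcases Int.units_eq_one_or y with rfl | rfl <;>
      simp <;> grind
  · rw [headSum_smul, headSum_unitVec]
    rcases Int.units_eq_one_or x with rfl | rfl <;> simp <;> grind

/-! ### Type IIb: the simple roots number p and ℓ -/

section Last

variable {p : ℕ}

theorem sum_lastDegree_one_zero (ha : a = 0 ∨ a = 2) (f : (Fin ℓ → ℤ) → ℤ) :
    ∑ v ∈ classicalRoots ℓ a with lastDegree p v = (1, 0), f v =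
      ∑ i : Fin ℓ, ∑ j : Fin ℓ,
        if (i : ℕ) < p ∧ p ≤ (j : ℕ) then f (unitVec i - unitVec j) else 0 := by
  rw [sum_filter_classicalRoots]
  have h1 : ∀ i j : Fin ℓ, (i ≠ j ∧ lastDegree p (unitVec i - unitVec j) = (1, 0)) ↔
      ((i : ℕ) < p ∧ p ≤ (j : ℕ)) := by
    intro i j
    simp only [lastDegree, headSum_sub, headSum_unitVec, Prod.mk.injEq]
    grind
  have h2 : ∀ i j : Fin ℓ, lastDegree p (unitVec i + unitVec j) ≠ (1, 0) ∧
      lastDegree p (-(unitVec i + unitVec j)) ≠ (1, 0) := by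
    intro i j
    simp only [lastDegree, headSum_add, headSum_neg, headSum_unitVec, ne_eq, Prod.mk.injEq]
    grind
  have h3 : a ≠ 1 := by omega
  simp only [h1, h2, h3, if_false]
  simp

/-- Second degree 1 singles out the roots e_i + e_j, and the first degree counts the indices among
the first p. -/
theorem sum_lastDegree_add (ha : a = 0 ∨ a = 2) {d : ℤ × ℤ} (hd : d.2 = 1)
    (f : (Fin ℓ → ℤ) → ℤ) : ∑ v ∈ classicalRoots ℓ a with lastDegree p v = d, f v =
      ∑ i : Fin ℓ, ∑ j : Fin ℓ, if i < j ∨ a = 2 ∧ i = j then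
        (if (if (i : ℕ) < p then 1 else 0) + (if (j : ℕ) < p then 1 else 0) = d.1 then
          f (unitVec i + unitVec j) else 0) else 0 := by
  obtain ⟨d, d'⟩ := d
  obtain rfl : d' = 1 := hd
  rw [sum_filter_classicalRoots]
  have h1 : ∀ i j : Fin ℓ, ¬(i ≠ j ∧ lastDegree p (unitVec i - unitVec j) = (d, 1)) := by
    intro i j
    simp only [lastDegree, headSum_sub, headSum_unitVec, Prod.mk.injEq]
    grind
  have h2 : ∀ i j : Fin ℓ, lastDegree p (unitVec i + unitVec j) = (d, 1) ↔
      (if (i : ℕ) < p then 1 else 0) + (if (j : ℕ) < p then 1 else 0) = d := by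
    intro i j
    simp only [lastDegree, headSum_add, headSum_unitVec, Prod.mk.injEq]
    grind
  have h4 : ∀ i j : Fin ℓ, lastDegree p (-(unitVec i + unitVec j)) ≠ (d, 1) := by
    intro i j
    simp only [lastDegree, headSum_add, headSum_neg, headSum_unitVec, ne_eq, Prod.mk.injEq]
    grind
  have h3 : a ≠ 1 := by omega
  simp only [h1, h2, h3, h4, if_false]
  simp

theorem sum_lastDegree_one_one (ha : a = 0 ∨ a = 2) (f : (Fin ℓ → ℤ) → ℤ) :
    ∑ v ∈ classicalRoots ℓ a with lastDegree p v = (1, 1), f v =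
      ∑ i : Fin ℓ, ∑ j : Fin ℓ,
        if (i : ℕ) < p ∧ p ≤ (j : ℕ) then f (unitVec i + unitVec j) else 0 := by
  rw [sum_lastDegree_add ha rfl]
  refine Finset.sum_congr rfl fun i _ => Finset.sum_congr rfl fun j _ => ?_
  simp only [Fin.lt_def, Fin.ext_iff]
  grind

theorem sum_lt_eq (hp : p ≤ ℓ) : ∑ i : Fin ℓ, (if (i : ℕ) < p then (1 : ℤ) else 0) = p := by
  rw [Fin.sum_univ_eq_sum_range (fun i => if i < p then (1 : ℤ) else 0), ← Finset.sum_filter]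
  have : (Finset.range ℓ).filter (· < p) = Finset.range p := by
    ext; simp; omega
  rw [this]
  simp

theorem sum_ge_eq (hp : p ≤ ℓ) : ∑ i : Fin ℓ, (if p ≤ (i : ℕ) then (1 : ℤ) else 0) = ℓ - p := by
  rw [← sum_lt_eq hp, eq_sub_iff_add_eq, ← Finset.sum_add_distrib]
  have h : ∀ i : Fin ℓ, (if p ≤ (i : ℕ) then (1 : ℤ) else 0) + (if (i : ℕ) < p then 1 else 0) =
      1 := by
    intro i; grind
  simp [h]

/-- For c = 1 and c = -1 this is the sum of the inner products of v with all e_i + e_j, or all e_i -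
e_j, where i is among the first p indices and j is not. -/
theorem sum_rectangle (hp : p ≤ ℓ) (c : ℤ) (v : Fin ℓ → ℤ) :
    (∑ i : Fin ℓ, ∑ j : Fin ℓ, if (i : ℕ) < p ∧ p ≤ (j : ℕ) then v i + c * v j else 0) =
      (ℓ - p) * headSum p v + c * p * (headSum ℓ v - headSum p v) := by
  have h1 : headSum ℓ v - headSum p v = ∑ j : Fin ℓ, if p ≤ (j : ℕ) then v j else 0 := by
    rw [headSum, headSum, ← Finset.sum_sub_distrib]
    refine Finset.sum_congr rfl fun k _ => ?_
    grind
  have h2 : ∀ i j : Fin ℓ, (if (i : ℕ) < p ∧ p ≤ (j : ℕ) then v i + c * v j else 0) =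
      (if (i : ℕ) < p then v i else 0) * (if p ≤ (j : ℕ) then 1 else 0) +
      c * ((if (i : ℕ) < p then 1 else 0) * (if p ≤ (j : ℕ) then v j else 0)) := by
    intro i j; split_ifs <;> simp_all
  simp only [h2, Finset.sum_add_distrib, ← Finset.mul_sum, ← Finset.sum_mul]
  rw [h1, sum_ge_eq hp, sum_lt_eq hp, headSum]
  ring

/-- The roots counted are e_i + e_j with both indices in a block of size ℓ - p or p: a triangle,
including its diagonal 2e_i exactly in type C. -/
theorem two_mul_sum_one_lastDegree (ha : a = 0 ∨ a = 2) (hp : p ≤ ℓ) :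
    2 * ∑ v ∈ classicalRoots ℓ a with lastDegree p v = (0, 1), (1 : ℤ) =
        (ℓ - p) * (ℓ - p + if a = 2 then 1 else -1) ∧
      2 * ∑ v ∈ classicalRoots ℓ a with lastDegree p v = (2, 1), (1 : ℤ) =
        p * (p + if a = 2 then 1 else -1) := by
  rw [sum_lastDegree_add ha rfl, sum_lastDegree_add ha rfl]
  have h1 : ∀ i j : Fin ℓ, (if (if (i : ℕ) < p then 1 else 0) + (if (j : ℕ) < p then 1 else 0) =
      (0 : ℤ) then (1 : ℤ) else 0) =
      (if p ≤ (i : ℕ) then 1 else 0) * (if p ≤ (j : ℕ) then 1 else 0) := by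
    intro i j; grind
  have h2 : ∀ i j : Fin ℓ, (if (if (i : ℕ) < p then 1 else 0) + (if (j : ℕ) < p then 1 else 0) =
      (2 : ℤ) then (1 : ℤ) else 0) =
      (if (i : ℕ) < p then 1 else 0) * (if (j : ℕ) < p then 1 else 0) := by
    intro i j; grind
  have h3 : ∀ (P : Prop) [Decidable P], (if P then (1 : ℤ) else 0) * (if P then 1 else 0) =
      if P then 1 else 0 := by
    intro P _; split_ifs <;> rfl
  simp only [h1, h2]
  rw [two_mul_sum_lt fun i j => mul_comm _ _, two_mul_sum_lt fun i j => mul_comm _ _]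
  simp only [h3, ← Finset.mul_sum, ← Finset.sum_mul, sum_ge_eq hp, sum_lt_eq hp]
  constructor <;> ring

/-- By `sum_rectangle`, each root of degree (0,1) has total inner product 2p with the roots of
degree (1,1), and each root of degree (2,1) has total 2(ℓ - p) with those of degree (1,0). It
remains to count. -/
theorem innerSum_lastDegree (ha : a = 0 ∨ a = 2) (hℓ : 2 ≤ ℓ)
    (hA : ∀ i j, classicalSimple ℓ a i ⬝ᵥ classicalCosimple ℓ a j = A i j) (hp : p ≤ ℓ) :
    (classicalModel (by omega) hℓ hA).innerSum (lastDegree p) (0, 1) (1, 1) =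
        p * ((ℓ - p) * (ℓ - p + if a = 2 then 1 else -1)) ∧
      (classicalModel (by omega) hℓ hA).innerSum (lastDegree p) (1, 0) (2, 1) =
        (ℓ - p) * (p * (p + if a = 2 then 1 else -1)) := by
  rw [innerSum_classicalModel, innerSum_classicalModel, ← (two_mul_sum_one_lastDegree ha hp).1,
    ← (two_mul_sum_one_lastDegree ha hp).2]
  constructor
  · rw [← mul_assoc, Finset.mul_sum]
    refine Finset.sum_congr rfl fun v hv => ?_
    obtain ⟨hv, h⟩ := Finset.mem_filter.1 hv
    -- Integer division leaves 2 or 3 for the coordinate sum; this bound makes it 2.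
    have h2 := headSum_le_two ha hv ℓ
    simp only [lastDegree, Prod.mk.injEq] at h
    have h3 := sum_rectangle hp 1 v
    simp only [one_mul] at h3
    rw [sum_lastDegree_one_one ha]
    simp only [dotProduct_add, dotProduct_unitVec]
    rw [h3, h.1, (by omega : headSum ℓ v = 2)]
    ring
  · rw [Finset.sum_comm, ← mul_assoc, Finset.mul_sum]
    refine Finset.sum_congr rfl fun v hv => ?_
    obtain ⟨hv, h⟩ := Finset.mem_filter.1 hv
    have h2 := headSum_le_two ha hv ℓ
    simp only [lastDegree, Prod.mk.injEq] at h
    have h3 := sum_rectangle hp (-1) v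
    simp only [neg_mul, one_mul, ← sub_eq_add_neg] at h3
    rw [sum_lastDegree_one_zero ha]
    simp only [dotProduct_comm _ v, dotProduct_sub, dotProduct_unitVec]
    rw [h3, h.1, (by omega : headSum ℓ v = 2)]
    ring

end Last

end ClassicalDegrees

/-! ### The values of [ijk] for the classical groups -/

section ClassicalTriples

variable {𝔤 : Type*} [LieRing 𝔤] [LieAlgebra ℝ 𝔤] [FiniteDimensional ℝ 𝔤] [IsCompactSemisimple 𝔤]
  {𝔥 : LieSubalgebra ℝ 𝔤} [IsMaximalTorus 𝔥] {b : (roots 𝔥).Base} {ℓ : ℕ}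
  {e : Fin ℓ ≃ b.support} {A : Matrix (Fin ℓ) (Fin ℓ) ℤ} {a : ℤ}

theorem hasNonzeroTriplesIIa_classical (he : IsNumbering b A e) (ha : a = 0 ∨ a = 1) (hℓ : 2 ≤ ℓ)
    (hA : ∀ i j, classicalSimple ℓ a i ⬝ᵥ classicalCosimple ℓ a j = A i j)
    (ha' : a = 1 ∨ a = 0 ∧ 4 ≤ ℓ) {z o : Fin ℓ} (hz : (z : ℕ) = 0) (ho : (o : ℕ) = 1) {x : ℝ} (hx0 : x ≠ 0)
    (hx : (4 * ℓ - 4 + (if a = 1 then 2 else 0) : ℝ) * x =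
      2 * (2 * (ℓ - 2) + if a = 1 then 1 else 0)) :
    HasNonzeroTriplesIIa (summandsIIa b (e z) (e o)) x x := by
  have h2 : a ≠ 2 := by omega
  have ha3 : a = 0 ∨ a = 1 ∨ a = 2 := by omega
  have hs : ((classicalModel ha3 hℓ hA).scale : ℝ) = 4 * ℓ - 4 + if a = 1 then 2 else 0 := by
    simp only [classicalModel, if_neg h2]
    push_cast
    simp
  have hI := innerSum_firstDegree hz ho ha3 hℓ hA
  refine hasNonzeroTriplesIIa_of_model (R := classicalModel ha3 hℓ hA) he
    (isDegree_firstDegree ha3 hℓ hA ha' hz ho) (by rw [ne_eq, Fin.ext_iff]; omega) rfl rfl (fun v hv h => ?_) (fun v hv h => ?_)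
    hx0 hx0 ?_ ?_
  · have h1 := apply_le_one ha hv z
    simp only [firstDegree, Prod.mk.injEq] at h
    omega
  · have h1 := apply_le_one ha hv o
    simp only [firstDegree, Prod.mk.injEq] at h
    omega
  · rw [hs, hI.1, hx]
    push_cast
    rfl
  · rw [hs, hI.2, hx]
    push_cast
    rfl

theorem hasNonzeroTriplesIIb_classical (he : IsNumbering b A e) (ha : a = 0 ∨ a = 2) (hℓ : 2 ≤ ℓ)
    (hA : ∀ i j, classicalSimple ℓ a i ⬝ᵥ classicalCosimple ℓ a j = A i j) {p : ℕ}
    (hpℓ : a = 2 ∧ p ≤ ℓ - 1 ∨ a = 0 ∧ p ≤ ℓ - 2) {i₁ i₂ : Fin ℓ}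
    (h₁ : (i₁ : ℕ) + 1 = p) (h₂ : (i₂ : ℕ) + 1 = ℓ) {x y : ℝ} (hx0 : x ≠ 0) (hy0 : y ≠ 0)
    (hx : (4 * ℓ - 4 + (if a = 2 then 8 else 0) : ℝ) * x =
      2 * (p * ((ℓ - p) * (ℓ - p + if a = 2 then 1 else -1))))
    (hy : (4 * ℓ - 4 + (if a = 2 then 8 else 0) : ℝ) * y =
      2 * ((ℓ - p) * (p * (p + if a = 2 then 1 else -1)))) :
    HasNonzeroTriplesIIb (summandsIIb b (e i₁) (e i₂)) x y := by
  have h1 : a ≠ 1 := by omega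
  have ha3 : a = 0 ∨ a = 1 ∨ a = 2 := by omega
  have hs : ((classicalModel ha3 hℓ hA).scale : ℝ) = 4 * ℓ - 4 + if a = 2 then 8 else 0 := by
    simp only [classicalModel, if_neg h1]
    push_cast
    simp
  have hI := innerSum_lastDegree ha hℓ hA (by omega : p ≤ ℓ)
  refine hasNonzeroTriplesIIb_of_model (R := classicalModel ha3 hℓ hA) he
    (isDegree_lastDegree ha3 hℓ hA hpℓ h₁ h₂) (by rw [ne_eq, Fin.ext_iff]; omega) rfl rfl
    (fun v hv h => ?_) (fun v hv h => ?_) hx0 hy0 ?_ ?_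
  · have h1 := headSum_le_two ha hv ℓ
    simp only [lastDegree, Prod.mk.injEq] at h
    omega
  · have h1 := headSum_le_two ha hv p
    simp only [lastDegree, Prod.mk.injEq] at h
    omega
  · rw [hs, hI.1, hx]
    push_cast
    rfl
  · rw [hs, hI.2, hy]
    push_cast
    rfl

theorem hasNonzeroTriplesIIa_B (hℓ : 2 ≤ ℓ) {z o : Fin ℓ} (hz : (z : ℕ) = 0) (ho : (o : ℕ) = 1)
    (he : IsNumbering b (CartanMatrix.B ℓ) e) :
    HasNonzeroTriplesIIa (summandsIIa b (e z) (e o))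
      ((2 * ℓ - 3) / (2 * ℓ - 1)) ((2 * ℓ - 3) / (2 * ℓ - 1)) := by
  have hℓ' : (2 : ℝ) ≤ ℓ := by exact_mod_cast hℓ
  have h0 : (2 * ℓ - 1 : ℝ) ≠ 0 := by linarith
  refine hasNonzeroTriplesIIa_classical he (Or.inr rfl) hℓ (classical_pairing_B hℓ) (Or.inl rfl)
    hz ho (div_ne_zero (by linarith) h0) ?_
  simp only [if_true]
  rw [mul_div_assoc', div_eq_iff h0]
  ring

theorem hasNonzeroTriplesIIa_D (hℓ : 4 ≤ ℓ) {z o : Fin ℓ} (hz : (z : ℕ) = 0) (ho : (o : ℕ) = 1)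
    (he : IsNumbering b (CartanMatrix.D ℓ) e) :
    HasNonzeroTriplesIIa (summandsIIa b (e z) (e o))
      ((ℓ - 2) / (ℓ - 1)) ((ℓ - 2) / (ℓ - 1)) := by
  have hℓ' : (4 : ℝ) ≤ ℓ := by exact_mod_cast hℓ
  have h0 : (ℓ - 1 : ℝ) ≠ 0 := by linarith
  refine hasNonzeroTriplesIIa_classical he (Or.inl rfl) (by omega) (classical_pairing_D hℓ)
    (Or.inr ⟨rfl, hℓ⟩) hz ho (div_ne_zero (by linarith) h0) ?_
  simp only [zero_ne_one, if_false]
  field_simp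
  ring

theorem hasNonzeroTriplesIIb_C {p : ℕ} (hp : 1 ≤ p) (hpℓ : p ≤ ℓ - 1) (hℓ : 2 ≤ ℓ)
    {i₁ i₂ : Fin ℓ} (h₁ : (i₁ : ℕ) + 1 = p)
    (h₂ : (i₂ : ℕ) + 1 = ℓ) (he : IsNumbering b (CartanMatrix.C ℓ) e) :
    HasNonzeroTriplesIIb (summandsIIb b (e i₁) (e i₂))
      (p * (ℓ - p) * (ℓ - p + 1) / (2 * (ℓ + 1))) (p * (p + 1) * (ℓ - p) / (2 * (ℓ + 1))) := by
  have hp' : (0 : ℝ) < p := by exact_mod_cast hp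
  have hpℓ' : (0 : ℝ) < ℓ - p := sub_pos.2 (by exact_mod_cast (by omega : p < ℓ))
  have h0 : (ℓ + 1 : ℝ) ≠ 0 := by positivity
  refine hasNonzeroTriplesIIb_classical he (Or.inr rfl) hℓ (classical_pairing_C hℓ)
    (Or.inl ⟨rfl, hpℓ⟩) h₁ h₂ (by positivity) (by positivity) ?_ ?_
  · simp only [if_true]
    field_simp
    ring
  · simp only [if_true]
    field_simp
    ring

theorem hasNonzeroTriplesIIb_D {p : ℕ} (hp : 2 ≤ p) (hpℓ : p ≤ ℓ - 2) (hℓ : 4 ≤ ℓ)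
    {i₁ i₂ : Fin ℓ} (h₁ : (i₁ : ℕ) + 1 = p)
    (h₂ : (i₂ : ℕ) + 1 = ℓ) (he : IsNumbering b (CartanMatrix.D ℓ) e) :
    HasNonzeroTriplesIIb (summandsIIb b (e i₁) (e i₂))
      (p * (ℓ - p) * (ℓ - p - 1) / (2 * (ℓ - 1))) (p * (p - 1) * (ℓ - p) / (2 * (ℓ - 1))) := by
  have hp' : (2 : ℝ) ≤ p := by exact_mod_cast hp
  have hpℓ' : (p : ℝ) + 2 ≤ ℓ := by exact_mod_cast (by omega : p + 2 ≤ ℓ)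
  have hp0 : (p : ℝ) ≠ 0 := by linarith
  have hp1 : (p - 1 : ℝ) ≠ 0 := by linarith
  have hℓp : (ℓ - p : ℝ) ≠ 0 := by linarith
  have hℓp1 : (ℓ - p - 1 : ℝ) ≠ 0 := by linarith
  have h0 : (ℓ - 1 : ℝ) ≠ 0 := by linarith
  have h02 : (2 * (ℓ - 1) : ℝ) ≠ 0 := mul_ne_zero two_ne_zero h0
  refine hasNonzeroTriplesIIb_classical he (Or.inl rfl) (by omega) (classical_pairing_D hℓ)
    (Or.inr ⟨rfl, hpℓ⟩) h₁ h₂ (div_ne_zero (mul_ne_zero (mul_ne_zero hp0 hℓp) hℓp1) h02)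
    (div_ne_zero (mul_ne_zero (mul_ne_zero hp0 hp1) hℓp) h02) ?_ ?_
  · simp only [(by norm_num : (0 : ℤ) ≠ 2), if_false]
    field_simp
    ring
  · simp only [(by norm_num : (0 : ℤ) ≠ 2), if_false]
    field_simp
    ring

end ClassicalTriples

end FlagManifold

end

theorem mainTheorem11 {𝔤 : Type*} [LieRing 𝔤] [LieAlgebra ℝ 𝔤] [FiniteDimensional ℝ 𝔤]
    [FlagManifold.IsCompactSemisimple 𝔤]
    (𝔥 : LieSubalgebra ℝ 𝔤) [FlagManifold.IsMaximalTorus 𝔥]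
    (b : (FlagManifold.roots 𝔥).Base) :
    -- Type IIa, `SO(2ℓ+1)`, `Π_M = {α₁, α₂}`
    (∀ (ℓ : ℕ) (hℓ : 2 ≤ ℓ) (e : Fin ℓ ≃ b.support),
      FlagManifold.IsNumbering b (CartanMatrix.B ℓ) e →
        FlagManifold.HasNonzeroTriplesIIa
          (FlagManifold.summandsIIa b (e ⟨0, by omega⟩) (e ⟨1, by omega⟩))
          ((2 * ℓ - 3) / (2 * ℓ - 1)) ((2 * ℓ - 3) / (2 * ℓ - 1))) ∧
    -- Type IIa, `SO(2ℓ)`, `Π_M = {α₁, α₂}`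
    (∀ (ℓ : ℕ) (hℓ : 4 ≤ ℓ) (e : Fin ℓ ≃ b.support),
      FlagManifold.IsNumbering b (CartanMatrix.D ℓ) e →
        FlagManifold.HasNonzeroTriplesIIa
          (FlagManifold.summandsIIa b (e ⟨0, by omega⟩) (e ⟨1, by omega⟩))
          ((ℓ - 2) / (ℓ - 1)) ((ℓ - 2) / (ℓ - 1))) ∧
    -- Type IIa, `E₆`: the end of a long arm and its neighbour
    -- (nodes 1 and 3 in Bourbaki's numbering)
    (∀ e : Fin 6 ≃ b.support,
      FlagManifold.IsNumbering b CartanMatrix.E₆ e →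
        FlagManifold.HasNonzeroTriplesIIa
          (FlagManifold.summandsIIa b (e 0) (e 2)) (5 / 6) (5 / 2)) ∧
    -- Type IIa, `E₇`: the end of the longest arm and its neighbour
    -- (nodes 7 and 6 in Bourbaki's numbering)
    (∀ e : Fin 7 ≃ b.support,
      FlagManifold.IsNumbering b CartanMatrix.E₇ e →
        FlagManifold.HasNonzeroTriplesIIa
          (FlagManifold.summandsIIa b (e 6) (e 5)) (8 / 9) (40 / 9)) ∧
    -- Type IIb, `Sp(ℓ)`, `Π_M = {α_p, α_ℓ}`
    (∀ (ℓ p : ℕ) (hp : 1 ≤ p) (hpℓ : p ≤ ℓ - 1) (hℓ : 2 ≤ ℓ) (e : Fin ℓ ≃ b.support),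
      FlagManifold.IsNumbering b (CartanMatrix.C ℓ) e →
        FlagManifold.HasNonzeroTriplesIIb
          (FlagManifold.summandsIIb b (e ⟨p - 1, by omega⟩) (e ⟨ℓ - 1, by omega⟩))
          (p * (ℓ - p) * (ℓ - p + 1) / (2 * (ℓ + 1)))
          (p * (p + 1) * (ℓ - p) / (2 * (ℓ + 1)))) ∧
    -- Type IIb, `SO(2ℓ)`, `Π_M = {α_p, α_ℓ}`
    (∀ (ℓ p : ℕ) (hp : 2 ≤ p) (hpℓ : p ≤ ℓ - 2) (hℓ : 4 ≤ ℓ) (e : Fin ℓ ≃ b.support),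
      FlagManifold.IsNumbering b (CartanMatrix.D ℓ) e →
        FlagManifold.HasNonzeroTriplesIIb
          (FlagManifold.summandsIIb b (e ⟨p - 1, by omega⟩) (e ⟨ℓ - 1, by omega⟩))
          (p * (ℓ - p) * (ℓ - p - 1) / (2 * (ℓ - 1)))
          (p * (p - 1) * (ℓ - p) / (2 * (ℓ - 1)))) := by
  refine ⟨fun ℓ hℓ e he => FlagManifold.hasNonzeroTriplesIIa_B hℓ rfl rfl he,
    fun ℓ hℓ e he => FlagManifold.hasNonzeroTriplesIIa_D hℓ rfl rfl he,
    fun e he => FlagManifold.hasNonzeroTriplesIIa_E₆ he,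
    fun e he => FlagManifold.hasNonzeroTriplesIIa_E₇ he,
    fun ℓ p hp hpℓ hℓ e he => FlagManifold.hasNonzeroTriplesIIb_C hp hpℓ hℓ
      (Nat.sub_add_cancel hp) (Nat.sub_add_cancel (one_le_two.trans hℓ)) he,
    fun ℓ p hp hpℓ hℓ e he => FlagManifold.hasNonzeroTriplesIIb_D hp hpℓ hℓ
      (Nat.sub_add_cancel (one_le_two.trans hp))
      (Nat.sub_add_cancel ((by norm_num : 1 ≤ 4).trans hℓ)) he⟩
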